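/- Let $k$ be a field, $n\ge 0$, and $S=k[x_1,\dots,x_n]$ with its $\mathbb Z^n$-grading; graded means $\mathbb Z^n$-graded, and morphisms of graded modules preserve degrees. Let $\mathfrak m=(x_1,\dots,x_n)$, $\omega_S=S(-1,\dots,-1)$, and identify a subset $F\subseteq[n]$ with its characteristic vector in $\{0,1\}^n$; put $F^{\mathsf c}=[n]\setminus F$ and $\operatorname{supp}_+(a)=\{i: a_i>0\}$. For graded modules $M,N$, let $\operatorname{Hom}_S(M,N)$ be the graded $S$-module whose degree $a$ part is the space of morphisms $M\to N(a)$, and let $\operatorname{Ext}^i_S(M^\bullet,N)=H^i(\operatorname{Hom}_S(Q^\bullet,N))$, where $Q^\bullet\to M^\bullet$ is a projective resolution (bounded above) in the category of graded $S$-modules. A graded $S$-module $M$ is squarefree if $M_a=0$ for $a\notin\mathbb N^n$, $\dim_k M_a<\infty$ for all $a \in\mathbb N^n$, and multiplication by $x^b$ is a bijection $M_a\to M_{a+b}$ for all $a,b\in\mathbb N^n$ with $\operatorname{supp}_+(a+b)=\operatorname{supp}_+(a)$. The objects of $D^b(\mathbf{Sq})$ are the bounded cochain complexes of squarefree modules.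 The Alexander dual $\mathbf A(M)$ of a squarefree module $M$ is the squarefree module with $\mathbf A(M)_F=\operatorname{Hom}_k(M_{F^{\mathsf c}},k)$ for $F\subseteq[n]$, where the multiplication by $x_l$ from $\mathbf A(M)_F$ to $\mathbf A(M)_{F\cup\{l\}}$, $l\notin F$, is the dual of $x_l:M_{F^{\mathsf c}\setminus\{l\}}\to M_{F^{\mathsf c}}$; for complexes, $\mathbf A(M^\bullet)^j=\mathbf A(M^{-j})$. Let ${}^*E(S/P_F)$ be the graded injective envelope of $S/P_F$, $P_F=(x_l: l\notin F)$, which is $k$ in the degrees $a$ with $\operatorname{supp}_+(a)\subseteq F$ and $0$ in all other degrees, and let $\omega^\bullet$ be the minimal graded injective resolution of $\omega_S[n]$: $\omega^i=\bigoplus_{|F|=-i}{}^*E(S/P_F)$, with differential composed of $(-1)^{\#\{l\in F:\,l<j\}}$ times the natural surjections ${}^*E(S/P_F)\to{}^*E(S/P_{F\setminus\{j\}})$, $j\in F$. For a squarefree module $M$ let $\mathbf D(M)$ be the complex $\mathcal N(\operatorname{Hom}_S(M,\omega^\bullet))$, where $\mathcal N(N)=\bigoplus_{a\in\mathbb N^n}N_a$,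 and let $\mathcal F(M)=\mathbf A(\mathbf D(M))$. Let $M^\bullet\in D^b(\mathbf{Sq})$, and let $P^\bullet\to M^\bullet$ be a minimal graded free resolution of $M^\bullet$ (a minimal projective resolution in $\mathbf{Sq}$): a quasi-isomorphism from a bounded complex with $P^j=\bigoplus_{F\subseteq[n]}S(-F)^{\beta_{-j}(F)}$, $\beta_{-j}(F) \in \mathbb N$, and $d(P^{j})\subseteq\mathfrak m P^{j+1}$ for all $j$. For $i\in\mathbb Z$, the $i$-linear strand $P^\bullet_{\langle i\rangle}$ is the complex whose term $P^j_{\langle i\rangle}=\bigoplus_{|F|=i-j}S(-F)^{\beta_{-j}(F)}$ is a direct summand of $P^j$ and whose differential is the corresponding component of the differential of $P^\bullet$. Then, for every $i\in\mathbb Z$, there is an isomorphism of complexes of graded $S$-modules $$P^\bullet_{\langle i\rangle}\;\cong\;\mathcal F\bigl(\operatorname{Ext}^i_S(\mathbf A(M^\bullet),\omega_S)\bigr)[n-i].$$ -/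

import Mathlib

open CategoryTheory CategoryTheory.Limits Opposite DirectSum

universe u

noncomputable section

/-- Degrees in `ℤⁿ`, with the componentwise partial order (a type of its own, so that its category
structure is the one given by this order). -/
def Deg (n : ℕ) : Type := Fin n → ℤ

namespace Deg

instance (n : ℕ) : AddCommGroup (Deg n) := inferInstanceAs (AddCommGroup (Fin n → ℤ))
instance (n : ℕ) : PartialOrder (Deg n) := inferInstanceAs (PartialOrder (Fin n → ℤ))
instance (n : ℕ) : DecidableEq (Deg n) := inferInstanceAs (DecidableEq (Fin n → ℤ))

variable {n : ℕ}

/-- The coordinates of a degree. -/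
def coord (a : Deg n) (i : Fin n) : ℤ := a i

/-- A vector of natural numbers, seen in `ℤⁿ`. -/
def ofNat (b : Fin n →₀ ℕ) : Deg n := fun i => (b i : ℤ)

/-- The positive support `supp₊ a = {i | 0 < a i}`. -/
def supp (a : Deg n) : Finset (Fin n) := Finset.univ.filter fun i => 0 < a.coord i

/-- The squarefree vector with support `F`. -/
def ofFinset (F : Finset (Fin n)) : Deg n := fun i => if i ∈ F then 1 else 0

lemma add_apply (a b : Deg n) (i : Fin n) : (a + b).coord i = a.coord i + b.coord i := rfl
lemma sub_apply (a b : Deg n) (i : Fin n) : (a - b).coord i = a.coord i - b.coord i := rfl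
lemma neg_apply (a : Deg n) (i : Fin n) : (-a).coord i = -a.coord i := rfl
lemma zero_apply (i : Fin n) : (0 : Deg n).coord i = 0 := rfl
lemma le_def {a b : Deg n} : a ≤ b ↔ ∀ i, a.coord i ≤ b.coord i := Iff.rfl
lemma ofNat_apply (b : Fin n →₀ ℕ) (i : Fin n) : (ofNat b).coord i = b i := rfl
lemma ofFinset_apply (F : Finset (Fin n)) (i : Fin n) :
    (ofFinset F).coord i = if i ∈ F then 1 else 0 := rfl
lemma mem_supp {a : Deg n} {i : Fin n} : i ∈ supp a ↔ 0 < a.coord i := by simp [supp]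

@[ext]
lemma ext {a b : Deg n} (h : ∀ i, a.coord i = b.coord i) : a = b := funext h

lemma supp_mono {a b : Deg n} (h : a ≤ b) : supp a ⊆ supp b := fun i hi =>
  mem_supp.2 ((mem_supp.1 hi).trans_le (le_def.1 h i))

lemma le_ofNat_add (b : Fin n →₀ ℕ) (a : Deg n) : a ≤ ofNat b + a := le_def.2 fun i => by
  simp only [add_apply, ofNat_apply]
  omega

lemma ofNat_zero_add (a : Deg n) : ofNat 0 + a = a := by
  ext i
  simp [add_apply, ofNat_apply]

lemma ofNat_add_add (b c : Fin n →₀ ℕ) (a : Deg n) :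
    ofNat (b + c) + a = ofNat b + (ofNat c + a) := by
  ext i
  simp [add_apply, ofNat_apply, add_assoc]

lemma ofFinset_mono {F G : Finset (Fin n)} (h : F ⊆ G) : ofFinset F ≤ ofFinset G := le_def.2 fun i => by
  simp only [ofFinset_apply]
  split_ifs with h₁ h₂ <;> first | exact absurd (h h₁) h₂ | norm_num

/-- The `i`-th coordinate as an additive map. -/
def coordHom (i : Fin n) : Deg n →+ ℤ where
  toFun a := a.coord i
  map_zero' := rfl
  map_add' _ _ := rfl

lemma weight_eq (b : Fin n →₀ ℕ) :
    Finsupp.weight (fun i : Fin n => ofFinset {i}) b = ofNat b := by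
  ext j
  have key : ∀ a : Deg n, a.coord j = coordHom j a := fun _ => rfl
  rw [Finsupp.weight_apply, ofNat_apply, key, map_finsuppSum]
  simp only [map_nsmul]
  rw [Finsupp.sum_fintype _ _ (by simp)]
  have (i : Fin n) : coordHom j (ofFinset {i}) = if j = i then 1 else 0 := by
    rw [← key, ofFinset_apply]
    simp
  simp [this]

end Deg

/-- A `ℤⁿ`-graded module over `S = k[x₁, …, xₙ]`: an `S`-module that is the internal direct sum
of `k`-subspaces `gr a`, `a ∈ ℤⁿ`, with `x^b • gr a ⊆ gr (b + a)`. (The `k`-structure is the one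
coming from `S`, by the scalar tower condition.) -/
structure GrMod (k : Type u) [Field k] (n : ℕ) where
  carrier : Type u
  [addCommGroup : AddCommGroup carrier]
  [moduleS : Module (MvPolynomial (Fin n) k) carrier]
  [moduleK : Module k carrier]
  [tower : IsScalarTower k (MvPolynomial (Fin n) k) carrier]
  gr : Deg n → Submodule k carrier
  isInternal : DirectSum.IsInternal gr
  monomial_smul_mem : ∀ (b : Fin n →₀ ℕ) (a : Deg n) (y : carrier), y ∈ gr a →
    MvPolynomial.monomial b (1 : k) • y ∈ gr (Deg.ofNat b + a)

namespace GrMod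

attribute [instance] addCommGroup moduleS moduleK tower

variable {k : Type u} [Field k] {n : ℕ}

/-- Degree-preserving `S`-linear maps. -/
@[ext]
structure Hom (M N : GrMod k n) where
  lin : M.carrier →ₗ[MvPolynomial (Fin n) k] N.carrier
  map_mem : ∀ (a : Deg n) (y : M.carrier), y ∈ M.gr a → lin y ∈ N.gr a

instance : Category (GrMod k n) where
  Hom M N := Hom M N
  id M := ⟨LinearMap.id, fun _ _ h => h⟩
  comp f g := ⟨g.lin ∘ₗ f.lin, fun a y h => g.map_mem a _ (f.map_mem a y h)⟩

@[ext]
lemma hom_ext {M N : GrMod k n} {f g : M ⟶ N} (h : f.lin = g.lin) : f = g := Hom.ext h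

@[simp] lemma id_lin (M : GrMod k n) : Hom.lin (𝟙 M) = LinearMap.id := rfl

@[simp] lemma comp_lin {M N L : GrMod k n} (f : M ⟶ N) (g : N ⟶ L) :
    Hom.lin (f ≫ g) = g.lin ∘ₗ f.lin := rfl

section Hom

variable {M N : GrMod k n}

instance : Zero (M ⟶ N) := ⟨⟨0, fun a _ _ => (N.gr a).zero_mem⟩⟩
instance : Add (M ⟶ N) :=
  ⟨fun f g => ⟨f.lin + g.lin, fun a y h => (N.gr a).add_mem (f.map_mem a y h) (g.map_mem a y h)⟩⟩
instance : Neg (M ⟶ N) := ⟨fun f => ⟨-f.lin, fun a y h => (N.gr a).neg_mem (f.map_mem a y h)⟩⟩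
instance : Sub (M ⟶ N) :=
  ⟨fun f g => ⟨f.lin - g.lin, fun a y h => (N.gr a).sub_mem (f.map_mem a y h) (g.map_mem a y h)⟩⟩
instance : SMul ℕ (M ⟶ N) :=
  ⟨fun c f => ⟨c • f.lin, fun a y h => (N.gr a).nsmul_mem (f.map_mem a y h) c⟩⟩
instance : SMul ℤ (M ⟶ N) :=
  ⟨fun c f => ⟨c • f.lin, fun a y h => zsmul_mem (f.map_mem a y h) c⟩⟩
instance : SMul k (M ⟶ N) :=
  ⟨fun c f => ⟨c • f.lin, fun a y h => (N.gr a).smul_mem c (f.map_mem a y h)⟩⟩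

lemma lin_injective :
    Function.Injective (fun f : M ⟶ N => f.lin) := fun _ _ h => hom_ext h

instance : AddCommGroup (M ⟶ N) :=
  lin_injective.addCommGroup _ rfl (fun _ _ => rfl) (fun _ => rfl) (fun _ _ => rfl)
    (fun _ _ => rfl) (fun _ _ => rfl)

@[simp] lemma zero_lin : Hom.lin (0 : M ⟶ N) = 0 := rfl
@[simp] lemma add_lin (f g : M ⟶ N) : Hom.lin (f + g) = f.lin + g.lin := rfl

/-- `Hom.lin` as an additive map. -/
def linHom : (M ⟶ N) →+ (M.carrier →ₗ[MvPolynomial (Fin n) k] N.carrier) where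
  toFun f := f.lin
  map_zero' := rfl
  map_add' _ _ := rfl

instance : Module k (M ⟶ N) :=
  lin_injective.module k (linHom (M := M) (N := N)) (fun _ _ => rfl)

@[simp] lemma smul_lin (c : k) (f : M ⟶ N) : Hom.lin (c • f) = c • f.lin := rfl

end Hom

instance : Preadditive (GrMod k n) where
  add_comp _ _ _ f f' g := by ext; simp
  comp_add _ _ _ f g g' := by ext; simp

instance : Linear k (GrMod k n) where
  smul_comp _ _ _ r f g := by
    ext x
    simp only [comp_lin, smul_lin, LinearMap.comp_apply, LinearMap.smul_apply]
    exact (g.lin.restrictScalars k).map_smul r _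
  comp_smul _ _ _ f r g := by ext; simp

/-- The vector of natural numbers underlying a non-negative integer vector. -/
def expo (c : Deg n) : Fin n →₀ ℕ := Finsupp.equivFunOnFinite.symm fun i => (c.coord i).toNat

lemma expo_apply (c : Deg n) (i : Fin n) : expo c i = (c.coord i).toNat := rfl

lemma coe_expo_sub {a b : Deg n} (h : a ≤ b) :
    Deg.ofNat (expo (b - a)) + a = b := by
  ext i
  have := Deg.le_def.1 h i
  simp only [Deg.ofNat_apply, Deg.add_apply, expo_apply, Deg.sub_apply]
  omega

lemma expo_add {a b c : Deg n} (h : a ≤ b) (h' : b ≤ c) :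
    expo (c - b) + expo (b - a) = expo (c - a) := by
  ext i
  have := Deg.le_def.1 h i
  have := Deg.le_def.1 h' i
  simp only [Finsupp.add_apply, expo_apply, Deg.sub_apply]
  omega

lemma expo_self (a : Deg n) : expo (a - a) = 0 := by
  ext i; simp [expo_apply, Deg.zero_apply]

/-- The monomial `x^(b - a)`, for `a ≤ b`. -/
def mon (k : Type u) [Field k] {n : ℕ} (a b : Deg n) : MvPolynomial (Fin n) k :=
  MvPolynomial.monomial (expo (b - a)) 1

lemma mon_self (a : Deg n) : mon k a a = 1 := by
  rw [mon, expo_self]; rfl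

lemma mon_mul {a b c : Deg n} (h : a ≤ b) (h' : b ≤ c) :
    mon k b c * mon k a b = mon k a c := by
  simp [mon, MvPolynomial.monomial_mul, expo_add h h']

lemma mon_smul_mem (M : GrMod k n) {a b : Deg n} (h : a ≤ b) {y : M.carrier}
    (hy : y ∈ M.gr a) : mon k a b • y ∈ M.gr b := by
  have := M.monomial_smul_mem (expo (b - a)) a y hy
  rwa [coe_expo_sub h] at this

/-- Multiplication `M_a → M_b`, `y ↦ x^(b - a) y`, for `a ≤ b`. -/
def mulMap (M : GrMod k n) {a b : Deg n} (h : a ≤ b) : M.gr a →ₗ[k] M.gr b where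
  toFun y := ⟨mon k a b • (y : M.carrier), M.mon_smul_mem h y.2⟩
  map_add' y z := by ext; simp
  map_smul' c y := Subtype.ext (smul_comm _ c (y : M.carrier))

@[simp] lemma coe_mulMap (M : GrMod k n) {a b : Deg n} (h : a ≤ b) (y : M.gr a) :
    (M.mulMap h y : M.carrier) = mon k a b • (y : M.carrier) := rfl

/-- The functor sending a graded module to the diagram of its graded components, with the
multiplications by monomials as transition maps. -/
def comps (k : Type u) [Field k] (n : ℕ) : GrMod k n ⥤ Deg n ⥤ ModuleCat.{u} k where
  obj M :=
    { obj a := ModuleCat.of k (M.gr a)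
      map {a b} h := ModuleCat.ofHom (M.mulMap h.le)
      map_id a := by
        ext y
        simp [mon_self]
      map_comp {a b c} h h' := by
        ext y
        simp [← mul_smul, mon_mul h.le h'.le] }
  map {M N} f :=
    { app a := ModuleCat.ofHom (((f.lin.restrictScalars k).restrict (f.map_mem a)))
      naturality {a b} h := by
        ext y
        exact f.lin.map_smul (mon k a b) (y : M.gr a) }

section Tot

variable (V : Deg n ⥤ ModuleCat.{u} k)

/-- Multiplication by `x^b` on `⨁ₐ V_a`. -/
def totMul (b : Fin n →₀ ℕ) : (⨁ a, V.obj a) →ₗ[k] ⨁ a, V.obj a :=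
  DirectSum.toModule k (Deg n) _ fun a =>
    DirectSum.lof k (Deg n) (fun a => V.obj a) (Deg.ofNat b + a) ∘ₗ
      (V.map (homOfLE (Deg.le_ofNat_add b a))).hom

lemma totMul_lof (b : Fin n →₀ ℕ) (a : Deg n) (v : V.obj a) :
    totMul V b (DirectSum.lof k (Deg n) (fun a => V.obj a) a v) =
      DirectSum.lof k (Deg n) (fun a => V.obj a) (Deg.ofNat b + a)
        (V.map (homOfLE (Deg.le_ofNat_add b a)) v) := by
  simp [totMul]

lemma lof_map_congr {a b c : Deg n} (h : b = c) (h₁ : a ≤ b) (h₂ : a ≤ c) (v : V.obj a) :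
    DirectSum.lof k (Deg n) (fun a => V.obj a) b (V.map (homOfLE h₁) v) =
      DirectSum.lof k (Deg n) (fun a => V.obj a) c (V.map (homOfLE h₂) v) := by
  subst h; rfl

/-- The action of `S` on `⨁ₐ V_a`. -/
def totAlgHom : MvPolynomial (Fin n) k →ₐ[k] Module.End k (⨁ a, V.obj a) :=
  AddMonoidAlgebra.lift k _ (Fin n →₀ ℕ)
    { toFun b := totMul V b.toAdd
      map_one' := by
        refine DirectSum.linearMap_ext k fun a => LinearMap.ext fun v => ?_
        rw [LinearMap.comp_apply, totMul_lof,
          lof_map_congr V (b := Deg.ofNat (Multiplicative.toAdd 1) + a)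
            (Deg.ofNat_zero_add a) _ le_rfl]
        simp
      map_mul' b c := by
        refine DirectSum.linearMap_ext k fun a => LinearMap.ext fun v => ?_
        rw [LinearMap.comp_apply, totMul_lof, LinearMap.comp_apply, Module.End.mul_apply,
          totMul_lof, totMul_lof]
        rw [lof_map_congr V (b := Deg.ofNat (b * c).toAdd + a)
          (Deg.ofNat_add_add b.toAdd c.toAdd a) _
          ((Deg.le_ofNat_add _ _).trans (Deg.le_ofNat_add _ _)), ← ModuleCat.comp_apply,
          ← V.map_comp]
        rfl }

lemma totAlgHom_monomial (b : Fin n →₀ ℕ) (c : k) :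
    totAlgHom V (MvPolynomial.monomial b c) = c • totMul V b := by
  erw [AddMonoidAlgebra.lift_single]
  rfl

/-- The graded module `⨁ₐ V_a` with graded components `V_a` and multiplications by monomials given
by the transition maps of the diagram `V`. -/
def totObj : GrMod k n :=
  letI : Module (MvPolynomial (Fin n) k) (⨁ a, V.obj a) :=
    Module.compHom _ (totAlgHom V).toRingHom
  { carrier := ⨁ a, V.obj a
    tower := ⟨fun c p x => by
      change totAlgHom V (c • p) x = c • totAlgHom V p x
      rw [map_smul]; rfl⟩
    gr a := LinearMap.range (DirectSum.lof k (Deg n) (fun a => V.obj a) a)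
    isInternal := by
      rw [DirectSum.isInternal_submodule_iff_iSupIndep_and_iSup_eq_top]
      refine ⟨fun a => Submodule.disjoint_def.2 ?_, DFinsupp.iSup_range_lsingle⟩
      rintro _ ⟨v, rfl⟩ hv
      have hle : (⨆ (b : Deg n) (_ : b ≠ a),
          LinearMap.range (DirectSum.lof k (Deg n) (fun a => V.obj a) b)) ≤
          LinearMap.ker (DirectSum.component k (Deg n) (fun a => V.obj a) a) := by
        refine iSup₂_le fun b hb => ?_
        rintro _ ⟨w, rfl⟩
        exact DFinsupp.single_eq_of_ne hb.symm
      have h0 : v = 0 := by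
        have := hle hv
        rwa [LinearMap.mem_ker, DirectSum.component.lof_self] at this
      rw [h0, map_zero]
    monomial_smul_mem := by
      rintro b a _ ⟨v, rfl⟩
      refine ⟨V.map (homOfLE (Deg.le_ofNat_add b a)) v, ?_⟩
      change _ = totAlgHom V _ _
      rw [totAlgHom_monomial, one_smul, totMul_lof] }

/-- The inclusion of the component `V_a` in `⨁ₐ V_a`. -/
def totOf (a : Deg n) : V.obj a →ₗ[k] (totObj V).carrier :=
  DirectSum.lof k (Deg n) (fun a => V.obj a) a

lemma totOf_injective (a : Deg n) : Function.Injective (totOf V a) :=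
  DirectSum.of_injective (β := fun a => V.obj a) a

lemma totOf_mem (a : Deg n) (v : V.obj a) : totOf V a v ∈ (totObj V).gr a := ⟨v, rfl⟩

lemma exists_totOf (a : Deg n) (y : (totObj V).carrier) (hy : y ∈ (totObj V).gr a) :
    ∃ v, totOf V a v = y := hy

lemma totOf_map_congr {a b c : Deg n} (h : b = c) (h₁ : a ≤ b) (h₂ : a ≤ c) (v : V.obj a) :
    totOf V b (V.map (homOfLE h₁) v) = totOf V c (V.map (homOfLE h₂) v) :=
  lof_map_congr V h h₁ h₂ v

lemma monomial_smul_totOf (b : Fin n →₀ ℕ) (a : Deg n) (v : V.obj a) :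
    MvPolynomial.monomial b (1 : k) • totOf V a v =
      totOf V (Deg.ofNat b + a) (V.map (homOfLE (Deg.le_ofNat_add b a)) v) := by
  change totAlgHom V _ _ = _
  rw [totAlgHom_monomial, one_smul]
  exact totMul_lof V b a v

lemma mon_smul_totOf {a b : Deg n} (h : a ≤ b) (v : V.obj a) :
    mon k a b • totOf V a v = totOf V b (V.map (homOfLE h) v) := by
  rw [mon, monomial_smul_totOf]
  exact totOf_map_congr V (coe_expo_sub h) _ _ v

variable {V} {W : Deg n ⥤ ModuleCat.{u} k}

/-- The `k`-linear map `⨁ₐ V_a → ⨁ₐ W_a` induced by a morphism of diagrams. -/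
def totMapLin (η : V ⟶ W) : (totObj V).carrier →ₗ[k] (totObj W).carrier :=
  DirectSum.lmap fun a => (η.app a).hom

lemma totMapLin_totOf (η : V ⟶ W) (a : Deg n) (v : V.obj a) :
    totMapLin η (totOf V a v) = totOf W a (η.app a v) :=
  DirectSum.lmap_lof (fun a => (η.app a).hom) a v

end Tot

lemma gr_induction (M : GrMod k n) {p : M.carrier → Prop} (y : M.carrier)
    (hgr : ∀ (a : Deg n) (y : M.carrier), y ∈ M.gr a → p y)
    (h0 : p 0) (hadd : ∀ y z, p y → p z → p (y + z)) : p y := by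
  have hy : y ∈ iSup M.gr := by rw [M.isInternal.submodule_iSup_eq_top]; trivial
  exact Submodule.iSup_induction M.gr (motive := p) hy hgr h0 hadd

lemma hom_ext_gr {M N : GrMod k n} {f g : M ⟶ N}
    (h : ∀ (a : Deg n) (y : M.carrier), y ∈ M.gr a → f.lin y = g.lin y) : f = g := by
  ext y
  exact M.gr_induction y h (by simp) (fun y z hy hz => by rw [map_add, map_add, hy, hz])

lemma expo_ofNat_add_sub (b : Fin n →₀ ℕ) (a : Deg n) : expo (Deg.ofNat b + a - a) = b := by
  ext i
  simp [expo_apply, Deg.ofNat_apply]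

lemma mon_ofNat_add (b : Fin n →₀ ℕ) (a : Deg n) :
    mon k a (Deg.ofNat b + a) = MvPolynomial.monomial b 1 := by
  rw [mon, expo_ofNat_add_sub]

/-- A `k`-linear map that preserves degrees and commutes with monomials on homogeneous elements is
a morphism of graded modules. -/
def homMk {M N : GrMod k n} (g : M.carrier →ₗ[k] N.carrier)
    (hg : ∀ (a : Deg n) (y : M.carrier), y ∈ M.gr a → g y ∈ N.gr a)
    (hmon : ∀ (b : Fin n →₀ ℕ) (a : Deg n) (y : M.carrier), y ∈ M.gr a →
      g (MvPolynomial.monomial b (1 : k) • y) = MvPolynomial.monomial b (1 : k) • g y) :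
    M ⟶ N where
  lin :=
    { g with
      map_smul' p y := by
        simp only [AddHom.toFun_eq_coe, LinearMap.coe_toAddHom, RingHom.id_apply]
        refine M.gr_induction (p := fun y => g (p • y) = p • g y) y (fun a y hy => ?_) (by simp)
          (fun y z hy hz => by simp only [smul_add, map_add, hy, hz])
        induction p using MvPolynomial.induction_on' with
        | monomial b c =>
          have : MvPolynomial.monomial b c = c • MvPolynomial.monomial b (1 : k) := by
            rw [MvPolynomial.smul_monomial, smul_eq_mul, mul_one]
          rw [this, smul_assoc, map_smul, hmon b a y hy, smul_assoc]
        | add p q hp hq => rw [add_smul, map_add, hp, hq, add_smul] }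
  map_mem := hg

@[simp] lemma homMk_lin_apply {M N : GrMod k n} (g : M.carrier →ₗ[k] N.carrier) (hg) (hmon)
    (y : M.carrier) : (homMk (M := M) (N := N) g hg hmon).lin y = g y := rfl

/-- The functor `V ↦ ⨁ₐ V_a`. -/
def tot (k : Type u) [Field k] (n : ℕ) : (Deg n ⥤ ModuleCat.{u} k) ⥤ GrMod k n where
  obj V := totObj V
  map {V W} η := homMk (totMapLin η)
    (by
      intro a y hy
      obtain ⟨v, rfl⟩ := exists_totOf V a y hy
      rw [totMapLin_totOf]
      exact totOf_mem ..)
    (by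
      intro b a y hy
      obtain ⟨v, rfl⟩ := exists_totOf V a y hy
      rw [monomial_smul_totOf, totMapLin_totOf, totMapLin_totOf, monomial_smul_totOf]
      congr 1
      exact NatTrans.naturality_apply η _ v)
  map_id V := hom_ext_gr (by
    intro a y hy
    obtain ⟨v, rfl⟩ := exists_totOf V a y hy
    rw [homMk_lin_apply, totMapLin_totOf]
    rfl)
  map_comp η θ := hom_ext_gr (by
    intro a y hy
    obtain ⟨v, rfl⟩ := exists_totOf _ a y hy
    rw [homMk_lin_apply, totMapLin_totOf, comp_lin, LinearMap.comp_apply, homMk_lin_apply,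
      homMk_lin_apply, totMapLin_totOf, totMapLin_totOf]
    rfl)

lemma tot_map_totOf {V W : Deg n ⥤ ModuleCat.{u} k} (η : V ⟶ W) (a : Deg n) (v : V.obj a) :
    ((tot k n).map η).lin (totOf V a v) = totOf W a (η.app a v) := totMapLin_totOf η a v

/-- The graded components of `⨁ₐ V_a` are the `V_a`. -/
def totCompsIso (k : Type u) [Field k] (n : ℕ) : tot k n ⋙ comps k n ≅ 𝟭 _ :=
  Iso.symm <| NatIso.ofComponents (fun V => NatIso.ofComponents (fun a =>
    (LinearEquiv.ofInjective (totOf V a) (totOf_injective V a)).toModuleIso)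
    (by
      intro a b h
      ext v
      apply Subtype.ext
      exact (mon_smul_totOf V h.le v).symm))
    (by
      intro V W η
      ext a v
      apply Subtype.ext
      exact (tot_map_totOf η a v).symm)

instance : (comps k n).Faithful where
  map_injective {M N f g} h := hom_ext_gr fun a y hy => by
    have := congrArg (fun η => (η.app a).hom (⟨y, hy⟩ : M.gr a)) h
    exact congrArg Subtype.val this

instance : (comps k n).EssSurj where
  mem_essImage V := ⟨(tot k n).obj V, ⟨(totCompsIso k n).app V⟩⟩

/-- The decomposition of a graded module into its components. -/
def dec (M : GrMod k n) : (⨁ a, M.gr a) ≃ₗ[k] M.carrier :=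
  LinearEquiv.ofBijective (DirectSum.coeLinearMap M.gr) M.isInternal

lemma dec_symm_apply (M : GrMod k n) (a : Deg n) (y : M.carrier) (hy : y ∈ M.gr a) :
    M.dec.symm y = DirectSum.lof k (Deg n) (fun a => M.gr a) a ⟨y, hy⟩ := by
  rw [LinearEquiv.symm_apply_eq]
  exact (DirectSum.coeLinearMap_lof M.gr a (⟨y, hy⟩ : M.gr a)).symm

/-- The components of a morphism of diagrams, as linear maps `M_a → N_a`. -/
def appLin {M N : GrMod k n} (η : (comps k n).obj M ⟶ (comps k n).obj N) (a : Deg n) :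
    M.gr a →ₗ[k] N.gr a := (η.app a).hom

lemma appLin_mulMap {M N : GrMod k n} (η : (comps k n).obj M ⟶ (comps k n).obj N) {a b : Deg n}
    (h : a ≤ b) (y : M.gr a) : appLin η b (M.mulMap h y) = N.mulMap h (appLin η a y) :=
  NatTrans.naturality_apply η (homOfLE h) y

instance : (comps k n).Full where
  map_surjective {M N} η := by
    let g : M.carrier →ₗ[k] N.carrier :=
      DirectSum.coeLinearMap N.gr ∘ₗ DirectSum.lmap (appLin η) ∘ₗ M.dec.symm.toLinearMap
    have hg (a : Deg n) (y : M.carrier) (hy : y ∈ M.gr a) :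
        g y = (appLin η a ⟨y, hy⟩).val := by
      simp only [g, LinearMap.comp_apply, LinearEquiv.coe_coe]
      rw [dec_symm_apply M a y hy, DirectSum.lmap_lof, DirectSum.coeLinearMap_lof]
    refine ⟨homMk g (fun a y hy => ?_) (fun b a y hy => ?_), ?_⟩
    · rw [hg a y hy]
      exact Subtype.property _
    · have h1 := M.monomial_smul_mem b a y hy
      have h2 := congrArg Subtype.val (appLin_mulMap η (Deg.le_ofNat_add b a) ⟨y, hy⟩)
      rw [coe_mulMap, mon_ofNat_add b a] at h2
      rw [hg a y hy, hg _ _ h1, ← h2]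
      congr 2
      apply Subtype.ext
      exact congrArg (· • y) (mon_ofNat_add b a).symm
    · ext a y
      exact Subtype.ext (hg a _ _)

/-- A graded module and the diagram of its components determine each other. -/
instance : (comps k n).IsEquivalence where

instance : HasFiniteProducts (GrMod k n) where
  out _ := Adjunction.hasLimitsOfShape_of_equivalence (comps k n)

instance : Abelian (GrMod k n) := abelianOfEquivalence (comps k n)

instance : HasFiniteBiproducts (GrMod k n) := HasFiniteBiproducts.of_hasFiniteProducts

instance : (comps k n).Additive where

instance : (tot k n).Additive where
  map_add {V W η θ} := hom_ext_gr (by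
    intro a y hy
    obtain ⟨v, rfl⟩ := exists_totOf _ a y hy
    refine (tot_map_totOf _ a v).trans ?_
    refine Eq.trans ?_ (congrArg₂ (· + ·) (tot_map_totOf η a v) (tot_map_totOf θ a v)).symm
    exact map_add (totOf W a) (η.app a v) (θ.app a v))

/-! ### Shifts, the polynomial ring, graded Hom -/

/-- The shifted module `M(a)`, with `M(a)_b = M_{a+b}`. -/
def shift (M : GrMod k n) (a : Deg n) : GrMod k n where
  carrier := M.carrier
  gr b := M.gr (a + b)
  isInternal := by
    have h := M.isInternal
    rw [DirectSum.isInternal_submodule_iff_iSupIndep_and_iSup_eq_top] at h ⊢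
    exact ⟨h.1.comp (add_right_injective a),
      ((Equiv.addLeft a).surjective.iSup_comp M.gr).trans h.2⟩
  monomial_smul_mem b c y hy := by
    have := M.monomial_smul_mem b (a + c) y hy
    rwa [add_left_comm] at this

/-- The shifts `M(a)`, with the multiplications `x^(b - a) : M(a) ⟶ M(b)` for `a ≤ b`. -/
def shifts (k : Type u) [Field k] (n : ℕ) : GrMod k n ⥤ Deg n ⥤ GrMod k n where
  obj M :=
    { obj a := M.shift a
      map {a b} h :=
        { lin := LinearMap.lsmul (MvPolynomial (Fin n) k) M.carrier (mon k a b)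
          map_mem c y hy := by
            have := M.monomial_smul_mem (expo (b - a)) (a + c) y hy
            rwa [← add_assoc, coe_expo_sub h.le] at this }
      map_id a := by
        ext y
        exact (congrArg (· • y) (mon_self a)).trans (one_smul _ y)
      map_comp {a b c} h h' := by
        ext y
        exact (congrArg (· • y) (mon_mul (k := k) h.le h'.le).symm).trans (mul_smul _ _ y) }
  map f :=
    { app a := ⟨f.lin, fun b y hy => f.map_mem (a + b) y hy⟩
      naturality a b h := by
        ext y
        exact f.lin.map_smul (mon k a b) y }

/-- The polynomial ring `S` with its `ℤⁿ`-grading, `deg x_i` the `i`-th unit vector. -/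
def poly (k : Type u) [Field k] (n : ℕ) : GrMod k n where
  carrier := MvPolynomial (Fin n) k
  gr a := MvPolynomial.weightedHomogeneousSubmodule k (fun i => Deg.ofFinset {i}) a
  isInternal :=
    letI := MvPolynomial.weightedDecomposition k (fun i : Fin n => Deg.ofFinset {i})
    DirectSum.Decomposition.isInternal _
  monomial_smul_mem b _ _ hy :=
    (MvPolynomial.isWeightedHomogeneous_monomial _ b 1 (Deg.weight_eq b)).mul hy

/-- `S(-F)`, the free module with one generator in the squarefree degree `F`. -/
def free (k : Type u) [Field k] {n : ℕ} (F : Finset (Fin n)) : GrMod k n :=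
  (poly k n).shift (-Deg.ofFinset F)

/-- The canonical module `ω_S = S(-(1, …, 1))`. -/
def canonical (k : Type u) [Field k] (n : ℕ) : GrMod k n := free k Finset.univ

/-- The graded Hom: `gHom(M, N)_a = Hom(M, N(a))`, the space of degree-preserving maps `M ⟶ N(a)`,
with `x^b` acting by composition with `x^b : N(a) ⟶ N(a + b)`. -/
def gHom (k : Type u) [Field k] (n : ℕ) : (GrMod k n)ᵒᵖ ⥤ GrMod k n ⥤ GrMod k n where
  obj M :=
    { obj N := (tot k n).obj ((shifts k n).obj N ⋙ (linearCoyoneda k (GrMod k n)).obj M)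
      map f := (tot k n).map
        (Functor.whiskerRight ((shifts k n).map f) ((linearCoyoneda k (GrMod k n)).obj M)) }
  map g :=
    { app N := (tot k n).map
        (Functor.whiskerLeft ((shifts k n).obj N) ((linearCoyoneda k (GrMod k n)).map g))
      naturality N N' f := by
        dsimp only
        rw [← Functor.map_comp, ← Functor.map_comp]
        congr 1 }

instance (M : (GrMod k n)ᵒᵖ) : ((gHom k n).obj M).PreservesZeroMorphisms where
  map_zero N N' := by
    refine Eq.trans (congrArg (tot k n).map ?_) ((tot k n).map_zero _ _)
    ext a f
    rfl

instance (N : GrMod k n) : ((gHom k n).flip.obj N).PreservesZeroMorphisms where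
  map_zero M M' := by
    refine Eq.trans (congrArg (tot k n).map ?_) ((tot k n).map_zero _ _)
    ext a f
    exact zero_comp (C := GrMod k n) (f := f)

/-- The functor `G` applied termwise to a complex, for a contravariant functor `G`: the complex
with `G(K^{-j})` in cohomological degree `j`. (No signs are put on the differentials; they would
change neither the cohomology nor the isomorphism class of the complex.) -/
def _root_.contraComplex {C D : Type*} [Category* C] [Category* D] [HasZeroMorphisms C]
    [HasZeroMorphisms D] (G : Cᵒᵖ ⥤ D) [G.PreservesZeroMorphisms] (K : CochainComplex C ℤ) :
    CochainComplex D ℤ where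
  X j := G.obj (op (K.X (-j)))
  d i j := G.map (K.d (-j) (-i)).op
  shape i j h := by
    rw [K.shape _ _ (fun h' => h (by simp only [ComplexShape.up_Rel] at h' ⊢; omega)), op_zero,
      G.map_zero]
  d_comp_d' i j l _ _ := by
    rw [← G.map_comp, ← op_comp, K.d_comp_d, op_zero, G.map_zero]

/-! ### Squarefree modules and Alexander duality -/

/-- Squarefree modules: `ℕⁿ`-graded, with finite dimensional components, and such that
`x^(b - a) : M_a → M_b` is bijective whenever `a ≤ b` in `ℕⁿ` have the same support. -/
structure IsSquarefree (M : GrMod k n) : Prop where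
  gr_eq_bot : ∀ a : Deg n, ¬ 0 ≤ a → M.gr a = ⊥
  finite : ∀ a : Deg n, 0 ≤ a → Module.Finite k (M.gr a)
  bijective : ∀ (a b : Deg n) (h : a ≤ b), 0 ≤ a → Deg.supp b = Deg.supp a →
    Function.Bijective (M.mulMap h)

/-- The elements of `V_a` if `a ∈ ℕⁿ`, and `0` otherwise. -/
def nonnegSub (V : Deg n ⥤ ModuleCat.{u} k) (a : Deg n) : Submodule k (V.obj a) where
  carrier := {v | ¬ 0 ≤ a → v = 0}
  zero_mem' _ := rfl
  add_mem' hv hw h := by rw [hv h, hw h, add_zero]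
  smul_mem' c v hv h := by rw [hv h, smul_zero]

lemma map_mem_nonnegSub (V : Deg n ⥤ ModuleCat.{u} k) {a b : Deg n} (h : a ⟶ b) (v : V.obj a)
    (hv : v ∈ nonnegSub V a) : V.map h v ∈ nonnegSub V b := fun hb => by
  rw [hv fun ha => hb (ha.trans h.le), map_zero]

lemma app_mem_nonnegSub {V W : Deg n ⥤ ModuleCat.{u} k} (η : V ⟶ W) (a : Deg n) (v : V.obj a)
    (hv : v ∈ nonnegSub V a) : η.app a v ∈ nonnegSub W a := fun ha => by
  rw [hv ha, map_zero]

/-- The part of a diagram in the degrees of `ℕⁿ`. -/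
def nonnegDiag (k : Type u) [Field k] (n : ℕ) :
    (Deg n ⥤ ModuleCat.{u} k) ⥤ Deg n ⥤ ModuleCat.{u} k where
  obj V :=
    { obj a := ModuleCat.of k (nonnegSub V a)
      map h := ModuleCat.ofHom ((V.map h).hom.restrict (map_mem_nonnegSub V h))
      map_id a := by
        ext v
        exact ConcreteCategory.congr_hom (V.map_id a) v.1
      map_comp h h' := by
        ext v
        exact ConcreteCategory.congr_hom (V.map_comp h h') v.1 }
  map η :=
    { app a := ModuleCat.ofHom ((η.app a).hom.restrict (app_mem_nonnegSub η a))
      naturality a b h := by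
        ext v
        exact NatTrans.naturality_apply η h v.1 }

/-- The `ℕⁿ`-graded part `𝒩(M) = ⨁_{a ∈ ℕⁿ} M_a`. -/
def nonnegPart (k : Type u) [Field k] (n : ℕ) : GrMod k n ⥤ GrMod k n :=
  comps k n ⋙ nonnegDiag k n ⋙ tot k n

instance : (nonnegPart k n).PreservesZeroMorphisms where
  map_zero M N := by
    refine Eq.trans (congrArg (tot k n).map ?_) ((tot k n).map_zero _ _)
    ext a v
    rfl

/-- The squarefree components `M_F`, `F ⊆ [n]`, with the multiplications `x^(G \ F) : M_F → M_G`
for `F ⊆ G`: the representation of the Boolean lattice associated with `M`. -/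
def sqComps (k : Type u) [Field k] (n : ℕ) :
    GrMod k n ⥤ Finset (Fin n) ⥤ ModuleCat.{u} k :=
  comps k n ⋙ (Functor.whiskeringLeft _ _ _).obj
    (Monotone.functor (f := Deg.ofFinset) fun _ _ h => Deg.ofFinset_mono h)

/-- The squarefree module with the squarefree components `W_F`: its component in degree `a ∈ ℕⁿ`
is `W_{supp a}`. -/
def ofSqComps (k : Type u) [Field k] (n : ℕ) :
    (Finset (Fin n) ⥤ ModuleCat.{u} k) ⥤ GrMod k n :=
  (Functor.whiskeringLeft _ _ _).obj
    (Monotone.functor (f := Deg.supp) fun _ _ h => Deg.supp_mono h) ⋙ nonnegDiag k n ⋙ tot k n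

/-- The dual of a representation `W` of the Boolean lattice: `F ↦ Hom_k(W_{Fᶜ}, k)`. -/
def dualRep (k : Type u) [Field k] (n : ℕ) :
    (Finset (Fin n) ⥤ ModuleCat.{u} k)ᵒᵖ ⥤ Finset (Fin n) ⥤ ModuleCat.{u} k where
  obj W :=
    { obj F := ModuleCat.of k (Module.Dual k (W.unop.obj Fᶜ))
      map {F G} h := ModuleCat.ofHom
        (Module.Dual.transpose (W.unop.map (homOfLE (compl_le_compl h.le))).hom)
      map_id F := by
        ext f w
        exact congrArg f (ConcreteCategory.congr_hom (W.unop.map_id Fᶜ) w)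
      map_comp {F G H} h h' := by
        ext f w
        exact congrArg f (ConcreteCategory.congr_hom (W.unop.map_comp
          (homOfLE (compl_le_compl h'.le)) (homOfLE (compl_le_compl h.le))) w) }
  map {W W'} η :=
    { app F := ModuleCat.ofHom (Module.Dual.transpose (η.unop.app Fᶜ).hom)
      naturality F G h := by
        ext f w
        exact congrArg f
          (NatTrans.naturality_apply η.unop (homOfLE (compl_le_compl h.le)) w).symm }

/-- The Alexander duality functor `𝐀` on squarefree modules (given by a formula that makes sense
for all graded modules): `𝐀(M)_F = Hom_k(M_{Fᶜ}, k)`, and `x_i : 𝐀(M)_F → 𝐀(M)_{F ∪ {i}}` is dual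
to `x_i : M_{Fᶜ \ {i}} → M_{Fᶜ}`. -/
def alexander (k : Type u) [Field k] (n : ℕ) : (GrMod k n)ᵒᵖ ⥤ GrMod k n :=
  (sqComps k n).op ⋙ dualRep k n ⋙ ofSqComps k n

instance : (alexander k n).PreservesZeroMorphisms where
  map_zero M N := by
    refine Eq.trans (congrArg (tot k n).map ?_) ((tot k n).map_zero _ _)
    ext a v
    apply Subtype.ext
    apply LinearMap.ext
    intro w
    exact (show Module.Dual k (((sqComps k n).obj M.unop).obj (Deg.supp a)ᶜ) from v.1).map_zero

/-- `𝐀(M^•)`, with `𝐀(M^{-j})` in cohomological degree `j`. -/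
def alexanderComplex (K : CochainComplex (GrMod k n) ℤ) : CochainComplex (GrMod k n) ℤ :=
  contraComplex (alexander k n) K

/-! ### The dualizing complex and the functors `𝐃` and `ℱ` -/

/-- `0` if `supp₊ a ⊆ F`, and all of `k` otherwise. -/
def hullSub (k : Type u) [Field k] {n : ℕ} (F : Finset (Fin n)) (a : Deg n) : Submodule k k where
  carrier := {c | Deg.supp a ⊆ F → c = 0}
  zero_mem' _ := rfl
  add_mem' hv hw h := by rw [hv h, hw h, add_zero]
  smul_mem' c v hv h := by rw [hv h, smul_zero]

lemma hullSub_mono {F G : Finset (Fin n)} {a b : Deg n} (hFG : G ⊆ F) (h : a ≤ b) :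
    hullSub k F a ≤ hullSub k G b := fun _ hc hb =>
  hc (((Deg.supp_mono h).trans hb).trans hFG)

/-- The diagram with `k` in the degrees `a` with `supp₊ a ⊆ F` and `0` in the other degrees, and
with the transition maps `1 : k → k` between its non-zero terms. -/
def hullDiag (k : Type u) [Field k] {n : ℕ} (F : Finset (Fin n)) : Deg n ⥤ ModuleCat.{u} k where
  obj a := ModuleCat.of k (k ⧸ hullSub k F a)
  map h := ModuleCat.ofHom (Submodule.factor (hullSub_mono (Finset.Subset.refl F) h.le))
  map_id a := by
    ext
    simp
  map_comp h h' := by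
    ext
    simp

/-- The injective envelope `*E(S/P_F)` of `S/P_F` in the category of graded modules, where
`P_F = (x_i | i ∉ F)`: the straight module with `k` in the degrees `a` with `supp₊ a ⊆ F`. -/
def injHull (k : Type u) [Field k] {n : ℕ} (F : Finset (Fin n)) : GrMod k n :=
  (tot k n).obj (hullDiag k F)

/-- The natural surjection between diagrams of type `hullDiag`, for `G ⊆ F`. -/
def hullNat (k : Type u) [Field k] {n : ℕ} {F G : Finset (Fin n)} (h : G ⊆ F) :
    hullDiag k F ⟶ hullDiag k G where
  app a := ModuleCat.ofHom (Submodule.factor (hullSub_mono h (le_refl a)))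
  naturality a b h := by
    ext
    simp [hullDiag]

/-- The natural surjection `*E(S/P_F) ⟶ *E(S/P_G)`, for `G ⊆ F`. -/
def hullMap (k : Type u) [Field k] {n : ℕ} {F G : Finset (Fin n)} (h : G ⊆ F) :
    injHull k F ⟶ injHull k G :=
  (tot k n).map (hullNat k h)

lemma hullMap_comp {F G H : Finset (Fin n)} (h : G ⊆ F) (h' : H ⊆ G) :
    hullMap k h ≫ hullMap k h' = hullMap k (h'.trans h) := by
  refine ((tot k n).map_comp _ _).symm.trans (congrArg (tot k n).map ?_)
  ext a x
  obtain ⟨c, rfl⟩ := Submodule.Quotient.mk_surjective _ x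
  rfl

/-- `α(j, F) = #{i ∈ F | i < j}`. -/
def alpha (j : Fin n) (F : Finset (Fin n)) : ℕ := (F.filter (· < j)).card

/-- The incidence number of `F` and `G`: it is `(-1)^α(j, F)` if `G = F \ {j}` with `j ∈ F`, and
`0` if `G` is not of this form. -/
def incidence (F G : Finset (Fin n)) : ℤ :=
  ∑ j ∈ F, if F.erase j = G then (-1) ^ alpha j F else 0

lemma incidence_eq_zero {F G : Finset (Fin n)} (h : ∀ j ∈ F, F.erase j ≠ G) :
    incidence F G = 0 :=
  Finset.sum_eq_zero fun j hj => if_neg (h j hj)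

lemma alpha_erase_add {F : Finset (Fin n)} {j l : Fin n} (hj : j ∈ F) (hl : l ∈ F) (h : j ≠ l) :
    (-1 : ℤ) ^ alpha j F * (-1) ^ alpha l (F.erase j) +
      (-1) ^ alpha l F * (-1) ^ alpha j (F.erase l) = 0 := by
  wlog hlt : j < l generalizing j l
  · rw [add_comm]
    exact this hl hj h.symm (lt_of_le_of_ne (not_lt.1 hlt) h.symm)
  have h1 : alpha l F = alpha l (F.erase j) + 1 := by
    have hmem : j ∈ F.filter (· < l) := Finset.mem_filter.2 ⟨hj, hlt⟩
    rw [alpha, alpha, Finset.filter_erase, Finset.card_erase_add_one hmem]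
  have h2 : alpha j (F.erase l) = alpha j F := by
    rw [alpha, alpha, Finset.filter_erase, Finset.erase_eq_of_notMem]
    simp [hlt.le]
  rw [h1, h2]
  ring

lemma sum_incidence_mul (F H : Finset (Fin n)) :
    ∑ G, incidence F G * incidence G H = 0 := by
  have h1 : ∑ G, incidence F G * incidence G H =
      ∑ j ∈ F, (-1) ^ alpha j F * incidence (F.erase j) H := by
    simp only [incidence, Finset.sum_mul]
    rw [Finset.sum_comm]
    simp
  rw [h1]
  simp only [incidence, Finset.mul_sum]
  rw [Finset.sum_sigma']
  refine Finset.sum_involution (fun x _ => ⟨x.2, x.1⟩) ?_ ?_ ?_ ?_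
  · rintro ⟨j, l⟩ hx
    simp only [Finset.mem_sigma, Finset.mem_erase] at hx
    have hc : (F.erase j).erase l = (F.erase l).erase j := Finset.erase_right_comm
    simp only [hc]
    split_ifs
    · exact alpha_erase_add hx.1 hx.2.2 hx.2.1.symm
    · simp
  · rintro ⟨j, l⟩ hx _ h
    simp only [Finset.mem_sigma, Finset.mem_erase] at hx
    exact hx.2.1 (congrArg Sigma.fst h)
  · rintro ⟨j, l⟩ hx
    simp only [Finset.mem_sigma, Finset.mem_erase] at hx ⊢
    exact ⟨hx.2.2, hx.2.1.symm, hx.1⟩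
  · rintro ⟨j, l⟩ hx
    rfl

/-- The component `*E(S/P_F) ⟶ *E(S/P_G)` of the differential of the dualizing complex:
`(-1)^α(j, F)` times the natural surjection if `G = F \ {j}`, `j ∈ F`, and `0` otherwise. -/
def omegaComp (k : Type u) [Field k] {n : ℕ} (F G : Finset (Fin n)) :
    injHull k F ⟶ injHull k G :=
  if h : G ⊆ F then incidence F G • hullMap k h else 0

lemma omegaComp_eq_zero {F G : Finset (Fin n)} (h : incidence F G = 0) : omegaComp k F G = 0 := by
  rw [omegaComp]
  split_ifs
  · rw [h, zero_smul]
  · rfl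

lemma omegaComp_comp {F G H : Finset (Fin n)} (hFH : H ⊆ F) :
    omegaComp k F G ≫ omegaComp k G H = (incidence F G * incidence G H) • hullMap k hFH := by
  by_cases h : G ⊆ F
  · by_cases h' : H ⊆ G
    · rw [omegaComp, omegaComp, dif_pos h, dif_pos h', Preadditive.zsmul_comp,
        Preadditive.comp_zsmul, hullMap_comp, mul_smul]
    · rw [incidence_eq_zero (F := G) (G := H)
        (fun j _ hj => h' (hj ▸ Finset.erase_subset j G)), mul_zero, zero_smul]
      simp [omegaComp, h']
  · rw [incidence_eq_zero (F := F) (G := G)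
      (fun j _ hj => h (hj ▸ Finset.erase_subset j F)), zero_mul, zero_smul]
    simp [omegaComp, h]

lemma incidence_card {F G : Finset (Fin n)} (h : incidence F G ≠ 0) : G.card + 1 = F.card := by
  by_contra hc
  exact h (incidence_eq_zero fun j hj hG => hc (hG ▸ Finset.card_erase_add_one hj))

lemma sum_omegaComp_comp (i : ℤ) {F H : Finset (Fin n)} (hF : (F.card : ℤ) = -i) :
    ∑ G : {G : Finset (Fin n) // (G.card : ℤ) = -(i + 1)},
      omegaComp k F G.1 ≫ omegaComp k G.1 H = 0 := by
  by_cases hFH : H ⊆ F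
  · simp only [omegaComp_comp hFH]
    rw [← Finset.sum_smul]
    have : ∑ G : {G : Finset (Fin n) // (G.card : ℤ) = -(i + 1)},
        incidence F G.1 * incidence G.1 H = ∑ G, incidence F G * incidence G H := by
      rw [← Finset.sum_subtype (Finset.univ.filter fun G => (G.card : ℤ) = -(i + 1))
        (by simp) (fun G => incidence F G * incidence G H)]
      refine Finset.sum_subset (Finset.subset_univ _) fun G _ hG => ?_
      by_contra h
      have := incidence_card (left_ne_zero_of_mul h)
      exact hG (by simp only [Finset.mem_filter, Finset.mem_univ, true_and]; omega)
    rw [this, sum_incidence_mul, zero_smul]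
  · refine Finset.sum_eq_zero fun G _ => ?_
    by_cases h : G.1 ⊆ F
    · rw [omegaComp, omegaComp, dif_neg (fun h' : H ⊆ G.1 => hFH (Finset.Subset.trans h' h)), comp_zero]
    · rw [omegaComp, dif_neg h, zero_comp]

/-- The minimal injective resolution `ω^•` of `ω_S[n]` (the dualizing complex):
`ω^i = ⨁_{|F| = -i} *E(S/P_F)`. -/
def dualizingComplex (k : Type u) [Field k] (n : ℕ) : CochainComplex (GrMod k n) ℤ where
  X i := ⨁ fun F : {F : Finset (Fin n) // (F.card : ℤ) = -i} => injHull k F.1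
  d i j := biproduct.matrix fun F G => omegaComp k F.1 G.1
  shape i j h := by
    refine biproduct.hom_ext' _ _ fun F => biproduct.hom_ext _ _ fun G => ?_
    rw [biproduct.ι_matrix, biproduct.lift_π, comp_zero, zero_comp]
    refine omegaComp_eq_zero (by_contra fun h' => h ?_)
    have := incidence_card h'
    have := F.2
    have := G.2
    simp only [ComplexShape.up_Rel]
    omega
  d_comp_d' i j l hij hjl := by
    obtain rfl : i + 1 = j := hij
    refine biproduct.hom_ext' _ _ fun F => biproduct.hom_ext _ _ fun H => ?_
    rw [Category.assoc, Category.assoc, biproduct.matrix_π, biproduct.ι_matrix_assoc,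
      biproduct.lift_desc, comp_zero, zero_comp]
    exact sum_omegaComp_comp i F.2

/-- `𝐃(M) = 𝒩(Hom_S(M, ω^•))` for a module `M`. -/
def dualizing (M : GrMod k n) : CochainComplex (GrMod k n) ℤ :=
  (((gHom k n).obj (op M) ⋙ nonnegPart k n).mapHomologicalComplex _).obj (dualizingComplex k n)

/-- `ℱ(M) = 𝐀(𝐃(M))`. -/
def calF (M : GrMod k n) : CochainComplex (GrMod k n) ℤ := alexanderComplex (dualizing M)

/-! ### Resolutions, Ext and linear strands -/

/-- A bounded complex of squarefree modules; these are the objects of `D^b(Sq)`. -/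
structure IsBoundedSquarefree (M : CochainComplex (GrMod k n) ℤ) : Prop where
  squarefree : ∀ j, (M.X j).IsSquarefree
  bounded : ∃ a b : ℤ, ∀ j, j < a ∨ b < j → IsZero (M.X j)

/-- A projective resolution of a complex in the category of graded `S`-modules. -/
structure ProjRes (K : CochainComplex (GrMod k n) ℤ) where
  Q : CochainComplex (GrMod k n) ℤ
  projective : ∀ j, Projective (Q.X j)
  boundedAbove : ∃ b : ℤ, ∀ j, b < j → IsZero (Q.X j)
  π : Q ⟶ K
  quasiIso : QuasiIso π

/-- The graded module `Ext^i_S(K^•, N) = H^i(Hom_S(Q^•, N))`, computed by a projective resolution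
`Q^• → K^•`. -/
def ProjRes.extMod {K : CochainComplex (GrMod k n) ℤ} (R : ProjRes K) (i : ℤ) (N : GrMod k n) :
    GrMod k n :=
  (contraComplex ((gHom k n).flip.obj N) R.Q).homology i

/-- The graded maximal ideal `𝔪 = (x₁, …, xₙ)`. -/
def maxIdeal (k : Type u) [Field k] (n : ℕ) : Ideal (MvPolynomial (Fin n) k) :=
  Ideal.span (Set.range MvPolynomial.X)

/-- The submodule `𝔪 M`. -/
def maxSub (M : GrMod k n) : Submodule (MvPolynomial (Fin n) k) M.carrier :=
  maxIdeal k n • ⊤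

/-- The family of modules consisting of `β F` copies of `S(-F)`, for all `F ⊆ [n]`. -/
def freeFamily (k : Type u) [Field k] {n : ℕ} (β : Finset (Fin n) → ℕ)
    (x : (F : Finset (Fin n)) × Fin (β F)) : GrMod k n := free k x.1

/-- A minimal graded free resolution of a complex `M^•` of squarefree modules, that is, a minimal
projective resolution in the category of squarefree modules, with a decomposition
`P^j ≅ ⨁_F S(-F)^{β j F}` of its terms. -/
structure MinRes (M : CochainComplex (GrMod k n) ℤ) where
  P : CochainComplex (GrMod k n) ℤ
  bounded : ∃ a b : ℤ, ∀ j, j < a ∨ b < j → IsZero (P.X j)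
  β : ℤ → Finset (Fin n) → ℕ
  iso : ∀ j, P.X j ≅ ⨁ freeFamily k (β j)
  π : P ⟶ M
  quasiIso : QuasiIso π
  minimal : ∀ j, LinearMap.range (P.d j (j + 1)).lin ≤ (P.X (j + 1)).maxSub

lemma lin_mem_maxSub {M N : GrMod k n} (f : M ⟶ N) {y : M.carrier} (hy : y ∈ M.maxSub) :
    f.lin y ∈ N.maxSub := by
  have := Submodule.mem_map_of_mem (f := f.lin) hy
  rw [maxSub, Submodule.map_smul''] at this
  exact Submodule.smul_mono le_rfl le_top this

lemma coeff_zero_of_mem_maxSub {G : Finset (Fin n)} (p : MvPolynomial (Fin n) k)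
    (hp : p ∈ (free k G).maxSub) : MvPolynomial.constantCoeff p = 0 := by
  have hle : maxIdeal k n ≤ RingHom.ker (MvPolynomial.constantCoeff (R := k) (σ := Fin n)) := by
    refine Ideal.span_le.2 ?_
    rintro _ ⟨i, rfl⟩
    exact MvPolynomial.constantCoeff_X k i
  have hp' : p ∈ (maxIdeal k n • ⊤ : Submodule (MvPolynomial (Fin n) k) (MvPolynomial (Fin n) k)) :=
    hp
  rw [smul_eq_mul, Ideal.mul_top] at hp'
  exact hle hp'

lemma sum_coord_ofFinset (F : Finset (Fin n)) : ∑ i, (Deg.ofFinset F).coord i = F.card := by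
  simp [Deg.ofFinset_apply]

/-- A map `S(-F) ⟶ S(-G)` with image in `𝔪 S(-G)` is zero unless `|G| < |F|`. -/
lemma free_hom_eq_zero {F G : Finset (Fin n)} (f : free k F ⟶ free k G)
    (hf : ∀ y, f.lin y ∈ (free k G).maxSub) (h : F.card ≤ G.card) : f = 0 := by
  let p : MvPolynomial (Fin n) k := f.lin (1 : MvPolynomial (Fin n) k)
  have hp : p.IsWeightedHomogeneous (fun i => Deg.ofFinset {i})
      (-Deg.ofFinset G + Deg.ofFinset F) := by
    refine f.map_mem (Deg.ofFinset F) (1 : MvPolynomial (Fin n) k) ?_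
    change MvPolynomial.IsWeightedHomogeneous (fun i : Fin n => Deg.ofFinset {i}) 1
      (-Deg.ofFinset F + Deg.ofFinset F)
    rw [neg_add_cancel]
    exact MvPolynomial.isWeightedHomogeneous_one k _
  have hp0 : p = 0 := by
    ext d
    rw [MvPolynomial.coeff_zero]
    by_contra hd
    have hw := hp hd
    rw [Deg.weight_eq] at hw
    have hsum : ∑ i, (d i : ℤ) = F.card - G.card := by
      rw [← sum_coord_ofFinset, ← sum_coord_ofFinset, ← Finset.sum_sub_distrib]
      refine Finset.sum_congr rfl fun i _ => ?_
      rw [← Deg.ofNat_apply, hw, Deg.add_apply, Deg.neg_apply]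
      ring
    have hd0 : d = 0 := by
      ext i
      have h1 : (d i : ℤ) ≤ ∑ i, (d i : ℤ) :=
        Finset.single_le_sum (f := fun i => (d i : ℤ)) (fun _ _ => by positivity)
          (Finset.mem_univ i)
      simp only [Finsupp.coe_zero, Pi.zero_apply]
      omega
    subst hd0
    exact hd (coeff_zero_of_mem_maxSub p (hf _))
  refine hom_ext (LinearMap.ext fun (y : MvPolynomial (Fin n) k) => ?_)
  have h1 := f.lin.map_smul (y : MvPolynomial (Fin n) k) (1 : MvPolynomial (Fin n) k)
  have h2 : (y : MvPolynomial (Fin n) k) • (1 : MvPolynomial (Fin n) k) = y := mul_one _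
  have h3 : (y : MvPolynomial (Fin n) k) • p = 0 := by rw [hp0, smul_zero]
  exact ((congrArg f.lin h2).symm.trans h1).trans h3

namespace MinRes

variable {M : CochainComplex (GrMod k n) ℤ} (R : MinRes M)

/-- The differential of `P^•` in terms of the decompositions `P^j ≅ ⨁_F S(-F)^{β j F}`. -/
def dMat (i j : ℤ) : (⨁ freeFamily k (R.β i)) ⟶ ⨁ freeFamily k (R.β j) :=
  (R.iso i).inv ≫ R.P.d i j ≫ (R.iso j).hom

lemma dMat_comp (i j l : ℤ) : R.dMat i j ≫ R.dMat j l = 0 := by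
  simp [dMat]

/-- The component `S(-F) ⟶ S(-G)` of the differential of `P^•` between two of the summands. -/
def component (i j : ℤ) (x : (F : Finset (Fin n)) × Fin (R.β i F))
    (y : (F : Finset (Fin n)) × Fin (R.β j F)) :
    freeFamily k (R.β i) x ⟶ freeFamily k (R.β j) y :=
  biproduct.ι (freeFamily k (R.β i)) x ≫ R.dMat i j ≫ biproduct.π (freeFamily k (R.β j)) y

lemma component_eq_zero (j : ℤ) (x : (F : Finset (Fin n)) × Fin (R.β j F))
    (y : (F : Finset (Fin n)) × Fin (R.β (j + 1) F)) (h : x.1.card ≤ y.1.card) :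
    R.component j (j + 1) x y = 0 := by
  refine free_hom_eq_zero _ (fun z => ?_) h
  have := lin_mem_maxSub ((R.iso (j + 1)).hom ≫ biproduct.π (freeFamily k (R.β (j + 1))) y)
    (R.minimal j ⟨(biproduct.ι (freeFamily k (R.β j)) x ≫ (R.iso j).inv).lin z, rfl⟩)
  exact this

lemma sum_component_comp (j l m : ℤ) (x : (F : Finset (Fin n)) × Fin (R.β j F))
    (z : (F : Finset (Fin n)) × Fin (R.β m F)) :
    ∑ y, R.component j l x y ≫ R.component l m y z = 0 := by
  have : biproduct.ι (freeFamily k (R.β j)) x ≫ (R.dMat j l ≫ 𝟙 _ ≫ R.dMat l m) ≫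
      biproduct.π (freeFamily k (R.β m)) z = 0 := by
    rw [Category.id_comp, dMat_comp, zero_comp, comp_zero]
  rw [← biproduct.total] at this
  simpa only [Preadditive.sum_comp, Preadditive.comp_sum, Category.assoc, component] using this

lemma sum_strand_comp (i j : ℤ) (x : (F : Finset (Fin n)) × Fin (R.β j F))
    (hx : (x.1.card : ℤ) = i - j) (z : (F : Finset (Fin n)) × Fin (R.β (j + 1 + 1) F))
    (hz : (z.1.card : ℤ) = i - (j + 1 + 1)) :
    ∑ y : {y : (F : Finset (Fin n)) × Fin (R.β (j + 1) F) // (y.1.card : ℤ) = i - (j + 1)},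
      R.component j (j + 1) x y.1 ≫ R.component (j + 1) (j + 1 + 1) y.1 z = 0 := by
  rw [← Finset.sum_subtype
    (Finset.univ.filter fun y : (F : Finset (Fin n)) × Fin (R.β (j + 1) F) =>
      (y.1.card : ℤ) = i - (j + 1)) (by simp)
    (fun y => R.component j (j + 1) x y ≫ R.component (j + 1) (j + 1 + 1) y z),
    ← R.sum_component_comp j (j + 1) (j + 1 + 1) x z]
  refine Finset.sum_subset (Finset.subset_univ _) fun y _ hy => ?_
  simp only [Finset.mem_filter, Finset.mem_univ, true_and] at hy
  by_cases h : x.1.card ≤ y.1.card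
  · rw [R.component_eq_zero j x y h, zero_comp]
  · rw [R.component_eq_zero (j + 1) y z (by omega), comp_zero]

/-- The `i`-linear strand of the minimal resolution: its term in degree `j` is the summand
`⨁_{|F| = i - j} S(-F)^{β j F}` of `P^j`, and its differential consists of the corresponding
components of the differential of `P^•`. -/
def strand (i : ℤ) : CochainComplex (GrMod k n) ℤ where
  X j := ⨁ fun x : {x : (F : Finset (Fin n)) × Fin (R.β j F) // (x.1.card : ℤ) = i - j} =>
    freeFamily k (R.β j) x.1
  d j l := biproduct.matrix fun x y => R.component j l x.1 y.1
  shape j l h := by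
    refine biproduct.hom_ext' _ _ fun x => biproduct.hom_ext _ _ fun y => ?_
    rw [biproduct.ι_matrix, biproduct.lift_π, comp_zero, zero_comp, component, dMat,
      R.P.shape j l h, zero_comp, comp_zero, zero_comp, comp_zero]
  d_comp_d' j l m hjl hlm := by
    obtain rfl : j + 1 = l := hjl
    obtain rfl : j + 1 + 1 = m := hlm
    refine biproduct.hom_ext' _ _ fun x => biproduct.hom_ext _ _ fun z => ?_
    rw [Category.assoc, Category.assoc, biproduct.matrix_π, biproduct.ι_matrix_assoc,
      biproduct.lift_desc, comp_zero, zero_comp]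
    exact R.sum_strand_comp i j x.1 x.2 z.1 z.2

end MinRes

end GrMod
end

/-! Alexander duality is exact, so `𝐀(M)` may be replaced by `𝐀(P)`. The module `𝐀(S(-F))` is
`S/(x_l : l ∈ F)`, which the Koszul complex on the variables of `F` resolves by the modules `S(-H)`,
`H ⊆ F`. Gluing these Koszul complexes along the differential of `P` gives a free complex `kComplex`
with one generator for each pair `(x, H)`, where `x` is a generator of `P` of degree `st x` and `H ⊆
st x`; it is quasi-isomorphic to `𝐀(P)` (`quasiIso_aug`). This complex and the given projective
resolution are K-projective, hence homotopy equivalent (`homotopyEquiv_of_isKProjective`), and they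
compute the same Ext.

In degree `Fᶜ`, maps to `ω_S` see exactly the pairs with `F ⊆ H ⊆ st x`. For fixed `x` these form a
Koszul-type complex on `st x \ F`, which is contractible unless `st x = F`. Minimality of `P` says
that the non-zero entries of its differential strictly shrink `st`, so a filtration by `|st x|`
leaves only the pairs `(x, F)` with `st x = F`, and no differential runs between those
(`exists_col_rep`, `col_rep_unique`). Hence `Ext^i` in degree `Fᶜ` has a basis indexed by the
generators `x` of `P` with `st x = F` and `dg x + |F| = i`, which are the generators of the
`i`-linear strand in degree `F`. Multiplication by `x_l` keeps the cocycle `(x, F)` but enlarges the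
complex to the pairs with `F \ {l} ⊆ H`; there a coboundary moves it to a signed sum of the pairs
`(y, F \ {l})`, weighted by the entries from `x` to `y` (`colD_single`). Thus the module structure
of `Ext^i` is the linear part of the differential of `P`.

Conversely, `ℱ` turns such a module structure back into a complex. Maps from a squarefree `N` to
shifts of `*E(S/P_G)` are linear forms on `N_G` (`exists_hom_injHull`, `hom_injHull_eq_zero`), so
`ℱ(N)^m` is the sum over `|G| = m` of the modules `N_G ⊗ S(-Gᶜ)`, with differential made of
multiplications by variables. For `N = Ext^i` its generators are those of the strand, and its
differential is the linear part of the matrix (`homForm_d`). The Koszul signs are incidence numbers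
of complements, so they cancel against the signs of `ω^•`. A generator `x` of the strand sits in
degree `|(st x)ᶜ| = dg x + (n - i)` of `ℱ(N)`, which explains the shift.

All this is done in coordinates: a degree of `S(-F)` contains at most one monomial, so setting all
variables to `1` turns maps between these free modules into matrices over `k`. -/

noncomputable section

namespace GrMod

variable {k : Type u} [Field k] {n : ℕ}

/-! ### Graded components of kernels, cokernels and homology -/

/-- The component in degree `a`, as a functor to vector spaces. -/
def compAt (k : Type u) [Field k] {n : ℕ} (a : Deg n) : GrMod k n ⥤ ModuleCat.{u} k :=
  comps k n ⋙ (evaluation _ _).obj a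

instance (a : Deg n) : (compAt k a).Additive where

instance (a : Deg n) : PreservesFiniteLimits (compAt k a) :=
  inferInstanceAs (PreservesFiniteLimits (comps k n ⋙ (evaluation _ _).obj a))

instance (a : Deg n) : PreservesFiniteColimits (compAt k a) :=
  inferInstanceAs (PreservesFiniteColimits (comps k n ⋙ (evaluation _ _).obj a))

lemma isZero_iff_gr {M : GrMod k n} : IsZero M ↔ ∀ (a : Deg n), ∀ y ∈ M.gr a, y = 0 := by
  rw [IsZero.iff_id_eq_zero]
  constructor
  · intro h a y _
    exact congrArg (fun f : M ⟶ M => f.lin y) h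
  · intro h
    exact hom_ext_gr fun a y hy => h a y hy

lemma isIso_of_gr_bijective {M N : GrMod k n} (f : M ⟶ N)
    (inj : ∀ (a : Deg n), ∀ y ∈ M.gr a, f.lin y = 0 → y = 0)
    (surj : ∀ (a : Deg n), ∀ z ∈ N.gr a, ∃ y ∈ M.gr a, f.lin y = z) : IsIso f := by
  have : IsIso ((comps k n).map f) := by
    rw [NatTrans.isIso_iff_isIso_app]
    intro a
    rw [ConcreteCategory.isIso_iff_bijective]
    constructor
    · refine (injective_iff_map_eq_zero ((((comps k n).map f).app a).hom)).2 fun y hy => ?_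
      exact Subtype.ext (inj a y.1 y.2 (congrArg Subtype.val hy))
    · intro z
      obtain ⟨y, hy, h⟩ := surj a z.1 z.2
      exact ⟨⟨y, hy⟩, Subtype.ext h⟩
  exact isIso_of_reflects_iso f (comps k n)

lemma lin_injective_of_isIso {M N : GrMod k n} (f : M ⟶ N) [IsIso f] :
    Function.Injective f.lin := fun y z h => by
  have h' : ∀ w, (inv f).lin (f.lin w) = w := fun w =>
    congrArg (fun g : M ⟶ M => g.lin w) (IsIso.hom_inv_id f)
  rw [← h' y, h, h']

/-- Taking a graded component is exact, and a graded module vanishes as soon as its components do.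
This lets every later exactness argument be carried out with homogeneous elements. -/
lemma exact_iff_gr (S : ShortComplex (GrMod k n)) :
    S.Exact ↔ ∀ (a : Deg n), ∀ y ∈ S.X₂.gr a, S.g.lin y = 0 → ∃ x ∈ S.X₁.gr a, S.f.lin x = y := by
  have key (a : Deg n) : (S.map (compAt k a)).Exact ↔
      ∀ y ∈ S.X₂.gr a, S.g.lin y = 0 → ∃ x ∈ S.X₁.gr a, S.f.lin x = y := by
    rw [ShortComplex.moduleCat_exact_iff]
    constructor
    · intro h y hy h0
      obtain ⟨x, hx⟩ := h (⟨y, hy⟩ : S.X₂.gr a) (Subtype.ext h0)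
      exact ⟨x.1, x.2, congrArg Subtype.val hx⟩
    · intro h y hy
      obtain ⟨x, hx, h'⟩ := h y.1 y.2 (congrArg Subtype.val hy)
      exact ⟨(⟨x, hx⟩ : S.X₁.gr a), Subtype.ext h'⟩
  constructor
  · intro h a
    exact (key a).1 (h.map (compAt k a))
  · intro h
    rw [ShortComplex.exact_iff_isZero_homology, isZero_iff_gr]
    intro a y hy
    have h1 := ((key a).2 (h a))
    rw [ShortComplex.exact_iff_isZero_homology] at h1
    have h2 := h1.of_iso (S.mapHomologyIso (compAt k a)).symm
    have h3 := ModuleCat.subsingleton_of_isZero h2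
    exact congrArg Subtype.val (@Subsingleton.elim (S.homology.gr a) h3 ⟨y, hy⟩ 0)

lemma exists_of_epi {M N : GrMod k n} (f : M ⟶ N) [Epi f] (a : Deg n) (z : N.carrier)
    (hz : z ∈ N.gr a) : ∃ y ∈ M.gr a, f.lin y = z :=
  (exact_iff_gr (ShortComplex.mk f (0 : N ⟶ N) (by simp))).1
    ((ShortComplex.exact_iff_epi _ rfl).2 inferInstance) a z hz rfl

lemma eq_zero_of_mono {M N : GrMod k n} (f : M ⟶ N) [Mono f] (a : Deg n) (y : M.carrier)
    (hy : y ∈ M.gr a) (h : f.lin y = 0) : y = 0 := by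
  obtain ⟨x, -, rfl⟩ := (exact_iff_gr (ShortComplex.mk (0 : M ⟶ M) f (by simp))).1
    ((ShortComplex.exact_iff_mono _ rfl).2 inferInstance) a y hy h
  rfl

/-! ### Cycles and boundaries in terms of homogeneous elements. -/

section Homology

variable (C : CochainComplex (GrMod k n) ℤ) (i : ℤ)

lemma exists_cycle (a : Deg n) (y : (C.X i).carrier) (hy : y ∈ (C.X i).gr a)
    (h : (C.d i (i + 1)).lin y = 0) : ∃ z ∈ (C.cycles i).gr a, (C.iCycles i).lin z = y := by
  have hex : (ShortComplex.mk (C.iCycles i) (C.d i (i + 1)) (by simp)).Exact :=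
    ShortComplex.exact_of_f_is_kernel _ (C.cyclesIsKernel i (i + 1) (by simp))
  exact (exact_iff_gr _).1 hex a y hy h

lemma d_iCycles (z : (C.cycles i).carrier) : (C.d i (i + 1)).lin ((C.iCycles i).lin z) = 0 :=
  congrArg (fun f : C.cycles i ⟶ C.X (i + 1) => f.lin z) (C.iCycles_d i (i + 1))

lemma exists_cycle_of_homology (a : Deg n) (y : (C.homology i).carrier)
    (hy : y ∈ (C.homology i).gr a) : ∃ z ∈ (C.cycles i).gr a, (C.homologyπ i).lin z = y :=
  exists_of_epi _ a y hy

lemma homologyπ_eq_zero_iff (a : Deg n) (z : (C.cycles i).carrier) (hz : z ∈ (C.cycles i).gr a) :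
    (C.homologyπ i).lin z = 0 ↔
      ∃ w ∈ (C.X (i - 1)).gr a, (C.d (i - 1) i).lin w = (C.iCycles i).lin z := by
  have hex : (ShortComplex.mk (C.toCycles (i - 1) i) (C.homologyπ i) (by simp)).Exact :=
    ShortComplex.exact_of_g_is_cokernel _ (C.homologyIsCokernel (i - 1) i (by simp))
  have hc (w : (C.X (i - 1)).carrier) :
      (C.iCycles i).lin ((C.toCycles (i - 1) i).lin w) = (C.d (i - 1) i).lin w :=
    congrArg (fun f : C.X (i - 1) ⟶ C.X i => f.lin w) (C.toCycles_i (i - 1) i)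
  constructor
  · intro h
    obtain ⟨w, hw, h'⟩ := (exact_iff_gr _).1 hex a z hz h
    exact ⟨w, hw, (hc w).symm.trans (congrArg _ h')⟩
  · rintro ⟨w, hw, h⟩
    have h1 : (C.toCycles (i - 1) i).lin w = z := by
      refine sub_eq_zero.1 (eq_zero_of_mono (C.iCycles i) a _
        (Submodule.sub_mem _ ((C.toCycles (i - 1) i).map_mem a w hw) hz) ?_)
      rw [map_sub, hc, h, sub_self]
    rw [← h1]
    exact congrArg (fun f : C.X (i - 1) ⟶ C.homology i => f.lin w)
      (C.toCycles_comp_homologyπ (i - 1) i)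

end Homology

/-- A morphism of complexes that is surjective with acyclic kernel, in terms of homogeneous
elements, is a quasi-isomorphism. -/
lemma quasiIso_of_gr {C D : CochainComplex (GrMod k n) ℤ} (f : C ⟶ D)
    (surj : ∀ (i : ℤ) (a : Deg n), ∀ z ∈ (D.X i).gr a, ∃ y ∈ (C.X i).gr a, (f.f i).lin y = z)
    (acyclic : ∀ (i : ℤ) (a : Deg n), ∀ y ∈ (C.X (i + 1)).gr a,
      (C.d (i + 1) (i + 1 + 1)).lin y = 0 → (f.f (i + 1)).lin y = 0 →
      ∃ w ∈ (C.X i).gr a, (f.f i).lin w = 0 ∧ (C.d i (i + 1)).lin w = y) : QuasiIso f := by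
  have comm (i j : ℤ) (y : (C.X i).carrier) :
      (f.f j).lin ((C.d i j).lin y) = (D.d i j).lin ((f.f i).lin y) :=
    congrArg (fun g : C.X i ⟶ D.X j => g.lin y) (f.comm i j).symm
  have dd {X : CochainComplex (GrMod k n) ℤ} (i j l : ℤ) (y : (X.X i).carrier) :
      (X.d j l).lin ((X.d i j).lin y) = 0 :=
    congrArg (fun g : X.X i ⟶ X.X l => g.lin y) (X.d_comp_d i j l)
  have hcyc (i : ℤ) (z : (C.cycles i).carrier) : (D.iCycles i).lin
      ((HomologicalComplex.cyclesMap f i).lin z) = (f.f i).lin ((C.iCycles i).lin z) :=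
    congrArg (fun g : C.cycles i ⟶ D.X i => g.lin z) (HomologicalComplex.cyclesMap_i f i)
  have hhom (i : ℤ) (z : (C.cycles i).carrier) : (HomologicalComplex.homologyMap f i).lin
      ((C.homologyπ i).lin z) = (D.homologyπ i).lin ((HomologicalComplex.cyclesMap f i).lin z) :=
    congrArg (fun g : C.cycles i ⟶ D.homology i => g.lin z)
      (HomologicalComplex.homologyπ_naturality f i)
  rw [quasiIso_iff]
  intro i
  rw [quasiIsoAt_iff_isIso_homologyMap]
  refine isIso_of_gr_bijective _ (fun a y hy h0 => ?_) (fun a z hz => ?_)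
  · obtain ⟨z, hz, rfl⟩ := exists_cycle_of_homology C i a y hy
    rw [hhom, homologyπ_eq_zero_iff D i a _ ((HomologicalComplex.cyclesMap f i).map_mem a z hz)] at h0
    obtain ⟨w, hw, hw'⟩ := h0
    rw [hcyc] at hw'
    obtain ⟨v, hv, rfl⟩ := surj (i - 1) a w hw
    rw [homologyπ_eq_zero_iff C i a z hz]
    obtain ⟨j, rfl⟩ : ∃ j, i = j + 1 := ⟨i - 1, by ring⟩
    -- If the image of the cycle bounds `w`, a lift `v` of `w` corrects the cycle by a boundary so
    -- that it lands in the kernel of `f`, which is acyclic.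
    obtain ⟨t, ht, ht1, ht2⟩ := acyclic j a
      ((C.iCycles (j + 1)).lin z - (C.d (j + 1 - 1) (j + 1)).lin v)
      (Submodule.sub_mem _ ((C.iCycles _).map_mem a z hz) ((C.d _ _).map_mem a v hv))
      (by rw [map_sub, d_iCycles, dd, sub_zero])
      (by rw [map_sub, comm, hw', sub_self])
    have hj : j + 1 - 1 = j := by ring
    clear hw' hw
    revert v hv ht2
    rw [hj]
    intro v hv ht2
    refine ⟨t + v, Submodule.add_mem _ ht hv, ?_⟩
    rw [map_add, ht2, sub_add_cancel]
  · obtain ⟨y, hy, rfl⟩ := exists_cycle_of_homology D i a z hz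
    obtain ⟨v, hv, hv'⟩ := surj i a _ ((D.iCycles i).map_mem a y hy)
    -- A lift `v` of a cycle need not be a cycle, but its differential is a cycle of the acyclic
    -- kernel; subtracting `t` repairs `v` without changing its image.
    obtain ⟨t, ht, ht1, ht2⟩ := acyclic i a ((C.d i (i + 1)).lin v) ((C.d _ _).map_mem a v hv)
      (dd _ _ _ _) (by rw [comm, hv', d_iCycles])
    obtain ⟨x, hx, hx'⟩ := exists_cycle C i a (v - t) (Submodule.sub_mem _ hv ht)
      (by rw [map_sub, ht2, sub_self])
    refine ⟨(C.homologyπ i).lin x, (C.homologyπ i).map_mem a x hx, ?_⟩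
    rw [hhom]
    congr 1
    refine sub_eq_zero.1 (eq_zero_of_mono (D.iCycles i) a _ (Submodule.sub_mem _
      ((HomologicalComplex.cyclesMap f i).map_mem a x hx) hy) ?_)
    rw [map_sub, hcyc, hx', map_sub, ht1, hv', sub_zero, sub_self]

/-! ### Homogeneous elements of graded Hom modules and of Alexander duals -/

section GHom

variable (M N : GrMod k n)

/-- The diagram of the components `Hom(M, N(a))` of the graded Hom. -/
def gHomDiag : Deg n ⥤ ModuleCat.{u} k :=
  (shifts k n).obj N ⋙ (linearCoyoneda k (GrMod k n)).obj (op M)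

/-- A morphism `M ⟶ N(a)`, as an element of degree `a` of the graded Hom. -/
def gHomOf (a : Deg n) : (M ⟶ N.shift a) →ₗ[k] (((gHom k n).obj (op M)).obj N).carrier :=
  totOf (gHomDiag M N) a

variable {M N}

lemma gHomOf_mem {a : Deg n} (φ : M ⟶ N.shift a) :
    gHomOf M N a φ ∈ (((gHom k n).obj (op M)).obj N).gr a :=
  totOf_mem (gHomDiag M N) a φ

lemma exists_gHomOf {a : Deg n} (y : (((gHom k n).obj (op M)).obj N).carrier)
    (hy : y ∈ (((gHom k n).obj (op M)).obj N).gr a) : ∃ φ, gHomOf M N a φ = y :=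
  exists_totOf (gHomDiag M N) a y hy

lemma gHomOf_injective (a : Deg n) : Function.Injective (gHomOf M N a) :=
  totOf_injective (gHomDiag M N) a

/-- Multiplication by `x^(b - a)`, as a morphism `N(a) ⟶ N(b)`. -/
def shiftMul (N : GrMod k n) {a b : Deg n} (h : a ≤ b) : N.shift a ⟶ N.shift b :=
  ((shifts k n).obj N).map (homOfLE h)

/-- The morphism `N(a) ⟶ N'(a)` given by a morphism `N ⟶ N'`. -/
def shiftMap {N N' : GrMod k n} (f : N ⟶ N') (a : Deg n) : N.shift a ⟶ N'.shift a :=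
  ((shifts k n).map f).app a

lemma mon_smul_gHomOf {a b : Deg n} (h : a ≤ b) (φ : M ⟶ N.shift a) :
    mon k a b • gHomOf M N a φ = gHomOf M N b (φ ≫ shiftMul N h) :=
  mon_smul_totOf (gHomDiag M N) h φ

lemma gHom_map_gHomOf {M' : GrMod k n} (g : M' ⟶ M) {a : Deg n} (φ : M ⟶ N.shift a) :
    (((gHom k n).map g.op).app N).lin (gHomOf M N a φ) = gHomOf M' N a (g ≫ φ) :=
  tot_map_totOf (V := gHomDiag M N) (W := gHomDiag M' N)
    (Functor.whiskerLeft ((shifts k n).obj N) ((linearCoyoneda k (GrMod k n)).map g.op)) a φ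

lemma gHom_obj_map_gHomOf {N' : GrMod k n} (f : N ⟶ N') {a : Deg n} (φ : M ⟶ N.shift a) :
    (((gHom k n).obj (op M)).map f).lin (gHomOf M N a φ) = gHomOf M N' a (φ ≫ shiftMap f a) :=
  tot_map_totOf (V := gHomDiag M N) (W := gHomDiag M N')
    (Functor.whiskerRight ((shifts k n).map f) ((linearCoyoneda k (GrMod k n)).obj (op M))) a φ

end GHom

section Nonneg

variable (M : GrMod k n)

/-- An element of degree `a ≥ 0`, as an element of the `ℕⁿ`-graded part. -/
def nonnegOf {a : Deg n} (ha : 0 ≤ a) : M.gr a →ₗ[k] ((nonnegPart k n).obj M).carrier :=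
  totOf ((nonnegDiag k n).obj ((comps k n).obj M)) a ∘ₗ
    LinearMap.codRestrict (nonnegSub ((comps k n).obj M) a) (LinearMap.id : M.gr a →ₗ[k] M.gr a)
      (fun _ h => absurd ha h)

variable {M}

lemma nonnegOf_mem {a : Deg n} (ha : 0 ≤ a) (y : M.gr a) :
    nonnegOf M ha y ∈ ((nonnegPart k n).obj M).gr a :=
  totOf_mem ((nonnegDiag k n).obj ((comps k n).obj M)) a _

lemma exists_nonnegOf {a : Deg n} (ha : 0 ≤ a) (y : ((nonnegPart k n).obj M).carrier)
    (hy : y ∈ ((nonnegPart k n).obj M).gr a) : ∃ z, nonnegOf M ha z = y := by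
  obtain ⟨v, rfl⟩ := exists_totOf ((nonnegDiag k n).obj ((comps k n).obj M)) a y hy
  exact ⟨v.1, rfl⟩

lemma nonnegOf_injective {a : Deg n} (ha : 0 ≤ a) : Function.Injective (nonnegOf M ha) :=
  (totOf_injective ((nonnegDiag k n).obj ((comps k n).obj M)) a).comp
    fun _ _ h => congrArg Subtype.val h

lemma mon_smul_nonnegOf {a b : Deg n} (ha : 0 ≤ a) (h : a ≤ b) (y : M.gr a) :
    mon k a b • nonnegOf M ha y = nonnegOf M (ha.trans h) (M.mulMap h y) :=
  mon_smul_totOf ((nonnegDiag k n).obj ((comps k n).obj M)) h _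

lemma nonnegPart_map_nonnegOf {N : GrMod k n} (f : M ⟶ N) {a : Deg n} (ha : 0 ≤ a) (y : M.gr a) :
    ((nonnegPart k n).map f).lin (nonnegOf M ha y) =
      nonnegOf N ha ⟨f.lin y, f.map_mem a y y.2⟩ :=
  tot_map_totOf _ a _

end Nonneg

section Alexander

variable (X : GrMod k n)

/-- The diagram of the components of the Alexander dual of `X`, before restriction to degrees
in `ℕⁿ`. -/
def alexDiag : Deg n ⥤ ModuleCat.{u} k :=
  Monotone.functor (f := Deg.supp) (fun _ _ h => Deg.supp_mono h) ⋙
    (dualRep k n).obj (op ((sqComps k n).obj X))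

/-- A linear form on `X_F`, where `F` is the complement of the support of `a ≥ 0`, as an element
of degree `a` of the Alexander dual. -/
def alexOf {a : Deg n} (ha : 0 ≤ a) :
    Module.Dual k (X.gr (Deg.ofFinset (Deg.supp a)ᶜ)) →ₗ[k] ((alexander k n).obj (op X)).carrier :=
  totOf ((nonnegDiag k n).obj (alexDiag X)) a ∘ₗ
    LinearMap.codRestrict (nonnegSub (alexDiag X) a)
      (LinearMap.id : Module.Dual k (X.gr (Deg.ofFinset (Deg.supp a)ᶜ)) →ₗ[k] _)
      (fun _ h => absurd ha h)

variable {X}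

lemma alexOf_mem {a : Deg n} (ha : 0 ≤ a) (y) :
    alexOf X ha y ∈ ((alexander k n).obj (op X)).gr a :=
  totOf_mem ((nonnegDiag k n).obj (alexDiag X)) a _

lemma exists_alexOf {a : Deg n} (ha : 0 ≤ a) (y : ((alexander k n).obj (op X)).carrier)
    (hy : y ∈ ((alexander k n).obj (op X)).gr a) : ∃ z, alexOf X ha z = y := by
  obtain ⟨v, rfl⟩ := exists_totOf ((nonnegDiag k n).obj (alexDiag X)) a y hy
  exact ⟨v.1, rfl⟩

lemma alexander_eq_zero {a : Deg n} (ha : ¬ 0 ≤ a) (y : ((alexander k n).obj (op X)).carrier)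
    (hy : y ∈ ((alexander k n).obj (op X)).gr a) : y = 0 := by
  obtain ⟨v, rfl⟩ := exists_totOf ((nonnegDiag k n).obj (alexDiag X)) a y hy
  have : v = 0 := Subtype.ext (v.2 ha)
  rw [this]
  exact map_zero _

lemma alexOf_injective {a : Deg n} (ha : 0 ≤ a) : Function.Injective (alexOf X ha) :=
  (totOf_injective ((nonnegDiag k n).obj (alexDiag X)) a).comp
    fun _ _ h => congrArg Subtype.val h

lemma compl_supp_mono {a b : Deg n} (h : a ≤ b) :
    Deg.ofFinset (Deg.supp b)ᶜ ≤ Deg.ofFinset (Deg.supp a)ᶜ :=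
  Deg.ofFinset_mono (Finset.compl_subset_compl.2 (Deg.supp_mono h))

lemma mon_smul_alexOf {a b : Deg n} (ha : 0 ≤ a) (h : a ≤ b)
    (y : Module.Dual k (X.gr (Deg.ofFinset (Deg.supp a)ᶜ))) :
    mon k a b • alexOf X ha y = alexOf X (ha.trans h) (y ∘ₗ X.mulMap (compl_supp_mono h)) :=
  mon_smul_totOf ((nonnegDiag k n).obj (alexDiag X)) h _

/-- The component of a morphism in degree `a`. -/
def Hom.at {X Y : GrMod k n} (f : X ⟶ Y) (a : Deg n) : X.gr a →ₗ[k] Y.gr a :=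
  (f.lin.restrictScalars k).restrict (f.map_mem a)

lemma alexander_map_alexOf {Y : GrMod k n} (f : X ⟶ Y) {a : Deg n} (ha : 0 ≤ a)
    (y : Module.Dual k (Y.gr (Deg.ofFinset (Deg.supp a)ᶜ))) :
    ((alexander k n).map f.op).lin (alexOf Y ha y) = alexOf X ha (y ∘ₗ Hom.at f _) :=
  tot_map_totOf _ a _

/-- In each degree of `ℕⁿ` the functor takes the `k`-dual of a graded component, and duality of
vector spaces is exact; in the other degrees everything vanishes. -/
instance : (alexander k n).PreservesHomology := by
  apply Functor.preservesHomology_of_map_exact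
  intro S hS
  have hS' := (exact_iff_gr _).1 hS.unop
  rw [exact_iff_gr]
  intro a y hy h0
  by_cases ha : 0 ≤ a
  swap
  · refine ⟨0, Submodule.zero_mem _, ?_⟩
    rw [map_zero]
    exact (alexander_eq_zero ha y hy).symm
  obtain ⟨v, rfl⟩ := exists_alexOf (X := S.X₂.unop) ha y hy
  have h1 : v ∘ₗ Hom.at S.g.unop _ = 0 := by
    apply alexOf_injective (X := S.X₃.unop) ha
    rw [map_zero, ← alexander_map_alexOf S.g.unop ha v]
    exact h0
  -- By exactness this kernel is an image on which `v` vanishes, and a form that vanishes on the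
  -- kernel of a linear map factors through that map.
  have h2 : LinearMap.ker (Hom.at S.f.unop (Deg.ofFinset (Deg.supp a)ᶜ)) ≤ LinearMap.ker v := by
    intro z hz
    obtain ⟨x, hx, hx'⟩ := hS' _ z.1 z.2 (congrArg Subtype.val (LinearMap.mem_ker.1 hz))
    have h3 := LinearMap.congr_fun h1 ⟨x, hx⟩
    rw [LinearMap.mem_ker]
    exact (congrArg v (Subtype.ext hx'.symm)).trans h3
  have h3 : v ∈ LinearMap.range
      (Hom.at S.f.unop (Deg.ofFinset (Deg.supp a)ᶜ)).dualMap := by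
    rw [LinearMap.range_dualMap_eq_dualAnnihilator_ker, Submodule.mem_dualAnnihilator]
    exact h2
  obtain ⟨w, hw⟩ := h3
  refine ⟨alexOf S.X₁.unop ha w, alexOf_mem (X := S.X₁.unop) ha w, ?_⟩
  exact (alexander_map_alexOf S.f.unop ha w).trans (congrArg (alexOf _ ha) hw)

end Alexander

section Dualizing

variable (N : GrMod k n) (p : ℤ)

/-- A morphism `N ⟶ ω^p(b)`, `b ≥ 0`, as an element of degree `b` of `𝐃(N)^p`. -/
def dualOf {b : Deg n} (hb : 0 ≤ b) :
    (N ⟶ ((dualizingComplex k n).X p).shift b) →ₗ[k] ((dualizing N).X p).gr b :=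
  LinearMap.codRestrict _ (nonnegOf (((gHom k n).obj (op N)).obj ((dualizingComplex k n).X p)) hb ∘ₗ
    LinearMap.codRestrict _ (gHomOf N ((dualizingComplex k n).X p) b) gHomOf_mem)
    (fun _ => nonnegOf_mem hb _)

variable {N p}

/-- The functor `𝒩` leaves the components in degrees `b ≥ 0` unchanged, so they can be handled as
honest morphisms to `ω^p(b)`. -/
lemma dualOf_bijective {b : Deg n} (hb : 0 ≤ b) : Function.Bijective (dualOf N p hb) := by
  constructor
  · intro φ ψ h
    have h1 := nonnegOf_injective hb (congrArg Subtype.val h)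
    exact gHomOf_injective b (congrArg Subtype.val h1)
  · intro y
    obtain ⟨z, hz⟩ := exists_nonnegOf hb y.1 y.2
    obtain ⟨φ, hφ⟩ := exists_gHomOf z.1 z.2
    refine ⟨φ, Subtype.ext (Eq.trans ?_ hz)⟩
    exact congrArg (nonnegOf _ hb) (Subtype.ext hφ)

lemma mulMap_dualOf {b c : Deg n} (hb : 0 ≤ b) (h : b ≤ c)
    (φ : N ⟶ ((dualizingComplex k n).X p).shift b) :
    ((dualizing N).X p).mulMap h (dualOf N p hb φ) =
      dualOf N p (hb.trans h) (φ ≫ shiftMul _ h) := by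
  refine Subtype.ext ((mon_smul_nonnegOf hb h _).trans ?_)
  refine congrArg (nonnegOf _ _) (Subtype.ext ?_)
  exact mon_smul_gHomOf h φ

lemma d_dualOf {b : Deg n} (hb : 0 ≤ b) (q : ℤ)
    (φ : N ⟶ ((dualizingComplex k n).X p).shift b) :
    Hom.at ((dualizing N).d p q) b (dualOf N p hb φ) =
      dualOf N q hb (φ ≫ shiftMap ((dualizingComplex k n).d p q) b) := by
  refine Subtype.ext ((nonnegPart_map_nonnegOf _ hb _).trans ?_)
  refine congrArg (nonnegOf _ _) (Subtype.ext ?_)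
  exact gHom_obj_map_gHomOf _ φ

end Dualizing

/-! ### Free modules with squarefree generators -/

/-- A morphism of graded modules given by its components. -/
def homOfComponents {M N : GrMod k n} (g : ∀ a : Deg n, M.gr a →ₗ[k] N.gr a)
    (hg : ∀ (a b : Deg n) (h : a ≤ b) (y : M.gr a), g b (M.mulMap h y) = N.mulMap h (g a y)) :
    M ⟶ N :=
  (comps k n).preimage
    { app a := ModuleCat.ofHom (g a)
      naturality a b h := by
        ext y
        exact hg a b h.le y }

lemma homOfComponents_lin {M N : GrMod k n} (g : ∀ a : Deg n, M.gr a →ₗ[k] N.gr a) (hg)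
    (a : Deg n) (y : M.gr a) : (homOfComponents g hg).lin y = (g a y : N.carrier) := by
  have h := (comps k n).map_preimage (X := M) (Y := N)
    { app a := ModuleCat.ofHom (g a)
      naturality a b h := by
        ext y
        exact hg a b h.le y }
  exact congrArg Subtype.val (congrArg (fun η => (η.app a).hom y) h)

/-- Evaluation of polynomials at `(1, …, 1)`. -/
def evalOne (k : Type u) [Field k] (n : ℕ) : MvPolynomial (Fin n) k →ₐ[k] k :=
  MvPolynomial.aeval fun _ => 1

lemma evalOne_monomial (b : Fin n →₀ ℕ) (c : k) :
    evalOne k n (MvPolynomial.monomial b c) = c := by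
  simp [evalOne, MvPolynomial.aeval_monomial]

lemma evalOne_mon (a b : Deg n) : evalOne k n (mon k a b) = 1 := evalOne_monomial _ _

lemma ofNat_injective : Function.Injective (Deg.ofNat (n := n)) := fun b c h => by
  ext i
  have := congrArg (fun a => a.coord i) h
  simpa [Deg.ofNat_apply] using this

/-- For the fine grading each degree contains at most one monomial, so the value at `(1, …, 1)` is
the only coefficient. -/
lemma homogeneous_eq {c : Deg n} {p : MvPolynomial (Fin n) k} (d : Fin n →₀ ℕ)
    (hp : p.IsWeightedHomogeneous (fun i => Deg.ofFinset {i}) c) (hd : Deg.ofNat d = c) :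
    p = MvPolynomial.monomial d (evalOne k n p) := by
  have h : p = MvPolynomial.monomial d (p.coeff d) := by
    ext e
    rw [MvPolynomial.coeff_monomial]
    split_ifs with he
    · rw [he]
    · by_contra h0
      have hw := hp h0
      rw [Deg.weight_eq, ← hd] at hw
      exact he (ofNat_injective hw).symm
  have h2 := congrArg (evalOne k n) h
  rw [evalOne_monomial] at h2
  rw [h2]
  exact h

lemma free_eq_zero {F : Finset (Fin n)} {a : Deg n} (h : ¬ Deg.ofFinset F ≤ a)
    (p : MvPolynomial (Fin n) k) (hp : p ∈ (free k F).gr a) : p = 0 := by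
  ext d
  rw [MvPolynomial.coeff_zero]
  by_contra h0
  have hp' : p.IsWeightedHomogeneous (fun i => Deg.ofFinset {i}) (-Deg.ofFinset F + a) := hp
  have hw := hp' h0
  rw [Deg.weight_eq] at hw
  refine h (Deg.le_def.2 fun i => ?_)
  have := congrArg (fun a => a.coord i) hw
  simp only [Deg.ofNat_apply, Deg.add_apply, Deg.neg_apply] at this
  omega

lemma free_eq_zero_of_evalOne {F : Finset (Fin n)} {a : Deg n}
    (p : MvPolynomial (Fin n) k) (hp : p ∈ (free k F).gr a) (h0 : evalOne k n p = 0) : p = 0 := by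
  by_cases h : Deg.ofFinset F ≤ a
  · have hp' : p.IsWeightedHomogeneous (fun i => Deg.ofFinset {i}) (-Deg.ofFinset F + a) := hp
    rw [homogeneous_eq (expo (a - Deg.ofFinset F)) hp', h0, map_zero]
    rw [eq_neg_add_iff_add_eq, add_comm]
    exact coe_expo_sub h
  · exact free_eq_zero h p hp

lemma one_mem_free (F : Finset (Fin n)) :
    (1 : MvPolynomial (Fin n) k) ∈ (free k F).gr (Deg.ofFinset F) := by
  change MvPolynomial.IsWeightedHomogeneous (fun i : Fin n => Deg.ofFinset {i}) 1
    (-Deg.ofFinset F + Deg.ofFinset F)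
  rw [neg_add_cancel]
  exact MvPolynomial.isWeightedHomogeneous_one k _

lemma ofFinset_le_ofFinset {F G : Finset (Fin n)} :
    Deg.ofFinset F ≤ Deg.ofFinset G ↔ F ⊆ G := by
  refine ⟨fun h i hi => ?_, Deg.ofFinset_mono⟩
  have := Deg.le_def.1 h i
  by_contra hG
  simp [Deg.ofFinset_apply, hi, hG] at this

/-- A basis of a graded module with generators in the squarefree degrees `s i`, together with the
maps to `k` obtained from the coordinates by setting all variables to `1`. -/
structure SqBasis (M : GrMod k n) {ι : Type} [Fintype ι] (s : ι → Finset (Fin n)) where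
  gen : ι → M.carrier
  gen_mem : ∀ i, gen i ∈ M.gr (Deg.ofFinset (s i))
  coef : ι → M.carrier →ₗ[k] k
  coef_monomial : ∀ (i : ι) (b : Fin n →₀ ℕ) (y : M.carrier),
    coef i (MvPolynomial.monomial b (1 : k) • y) = coef i y
  coef_gen_self : ∀ i, coef i (gen i) = 1
  coef_gen_ne : ∀ i j, i ≠ j → coef i (gen j) = 0
  coef_eq_zero : ∀ i (a : Deg n), ∀ y ∈ M.gr a, ¬ Deg.ofFinset (s i) ≤ a → coef i y = 0
  eq_zero : ∀ (a : Deg n), ∀ y ∈ M.gr a, (∀ i, coef i y = 0) → y = 0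

namespace SqBasis

open Classical in
/-- The standard basis of `⨁ S(-F)`. -/
def biproduct {ι : Type} [Fintype ι] (s : ι → Finset (Fin n)) :
    SqBasis (⨁ fun i => free k (s i)) s where
  gen i := (biproduct.ι (fun i => free k (s i)) i).lin (1 : MvPolynomial (Fin n) k)
  gen_mem i := (biproduct.ι (fun i => free k (s i)) i).map_mem _ _ (one_mem_free (s i))
  coef i := (evalOne k n).toLinearMap ∘ₗ
    ((biproduct.π (fun i => free k (s i)) i).lin.restrictScalars k :
      _ →ₗ[k] MvPolynomial (Fin n) k)
  coef_monomial i b y := by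
    have h := (biproduct.π (fun i => free k (s i)) i).lin.map_smul
      (MvPolynomial.monomial b (1 : k)) y
    refine (congrArg (evalOne k n) h).trans ?_
    refine (map_mul (evalOne k n) (MvPolynomial.monomial b (1 : k))
      ((biproduct.π (fun i => free k (s i)) i).lin y)).trans ?_
    rw [evalOne_monomial, one_mul]
    rfl
  coef_gen_self i := by
    have h := congrArg (fun f => Hom.lin f (1 : MvPolynomial (Fin n) k))
      (biproduct.ι_π_self (fun i => free k (s i)) i)
    exact (congrArg (evalOne k n) h).trans (map_one _)
  coef_gen_ne i j hij := by
    have h := congrArg (fun f => Hom.lin f (1 : MvPolynomial (Fin n) k))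
      (biproduct.ι_π_ne (fun i => free k (s i)) hij.symm)
    exact (congrArg (evalOne k n) h).trans (map_zero _)
  coef_eq_zero i a y hy h := by
    have h1 := free_eq_zero h _ ((biproduct.π (fun i => free k (s i)) i).map_mem a y hy)
    exact (congrArg (evalOne k n) h1).trans (map_zero _)
  eq_zero a y hy h := by
    have h1 (i : ι) : (biproduct.π (fun i => free k (s i)) i).lin y = 0 :=
      free_eq_zero_of_evalOne _ ((biproduct.π (fun i => free k (s i)) i).map_mem a y hy) (h i)
    have h2 := congrArg (fun f => linHom f y) (biproduct.total (f := fun i => free k (s i)))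
    rw [map_sum, LinearMap.sum_apply] at h2
    refine h2.symm.trans (Finset.sum_eq_zero fun i _ => ?_)
    refine (congrArg (biproduct.ι (fun i => free k (s i)) i).lin (h1 i)).trans (map_zero _)

variable {ι : Type} [Fintype ι] {s : ι → Finset (Fin n)}

/-- Transport of a basis along an isomorphism. -/
def ofIso {M N : GrMod k n} (B : SqBasis N s) (e : M ≅ N) : SqBasis M s where
  gen i := e.inv.lin (B.gen i)
  gen_mem i := e.inv.map_mem _ _ (B.gen_mem i)
  coef i := B.coef i ∘ₗ e.hom.lin.restrictScalars k
  coef_monomial i b y := by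
    simp only [LinearMap.comp_apply, LinearMap.restrictScalars_apply, map_smul, B.coef_monomial]
  coef_gen_self i := by
    have h := congrArg (fun f => Hom.lin f (B.gen i)) e.inv_hom_id
    exact (congrArg (B.coef i) h).trans (B.coef_gen_self i)
  coef_gen_ne i j hij := by
    have h := congrArg (fun f => Hom.lin f (B.gen j)) e.inv_hom_id
    exact (congrArg (B.coef i) h).trans (B.coef_gen_ne i j hij)
  coef_eq_zero i a y hy h := B.coef_eq_zero i a _ (e.hom.map_mem a y hy) h
  eq_zero a y hy h := by
    have h1 := B.eq_zero a _ (e.hom.map_mem a y hy) h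
    have h2 := congrArg (fun f => Hom.lin f y) e.hom_inv_id
    exact h2.symm.trans ((congrArg e.inv.lin h1).trans (map_zero _))

variable {M N : GrMod k n} (B : SqBasis M s)

lemma coef_mon (i : ι) (a b : Deg n) (y : M.carrier) : B.coef i (mon k a b • y) = B.coef i y :=
  B.coef_monomial i _ y

open Classical in
lemma coef_gen (i j : ι) : B.coef i (B.gen j) = if i = j then 1 else 0 := by
  split_ifs with h
  · rw [h, B.coef_gen_self]
  · exact B.coef_gen_ne i j h

open Classical in
-- In degree `a` the `i`-th coordinate of `y` can only be a scalar multiple of the monomial `x^(a -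
-- s i)`, and it is zero if there is no such monomial.
lemma eq_sum {a : Deg n} (y : M.carrier) (hy : y ∈ M.gr a) :
    y = ∑ i, if Deg.ofFinset (s i) ≤ a then
      B.coef i y • (mon k (Deg.ofFinset (s i)) a • B.gen i) else 0 := by
  rw [← sub_eq_zero]
  refine B.eq_zero a _ (Submodule.sub_mem _ hy (Submodule.sum_mem _ fun i _ => ?_)) fun j => ?_
  · split_ifs with h
    · exact Submodule.smul_mem _ _ (M.mon_smul_mem h (B.gen_mem i))
    · exact Submodule.zero_mem _
  · rw [map_sub, map_sum, sub_eq_zero]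
    have h1 (i : ι) : B.coef j (if Deg.ofFinset (s i) ≤ a then
        B.coef i y • (mon k (Deg.ofFinset (s i)) a • B.gen i) else 0) =
        if j = i then B.coef j y else 0 := by
      split_ifs with h h' h'
      · rw [map_smul, B.coef_mon, h', B.coef_gen_self, smul_eq_mul, mul_one]
      · rw [map_smul, B.coef_mon, B.coef_gen_ne j i h', smul_zero]
      · rw [map_zero, h', B.coef_eq_zero i a y hy h]
      · exact map_zero _
    rw [Finset.sum_congr rfl fun i _ => h1 i, Finset.sum_ite_eq]
    simp

lemma hom_ext {f g : M ⟶ N} (h : ∀ i, f.lin (B.gen i) = g.lin (B.gen i)) : f = g := by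
  classical
  refine hom_ext_gr fun a y hy => ?_
  have key (f : M ⟶ N) : f.lin y = ∑ i, if Deg.ofFinset (s i) ≤ a then
      B.coef i y • (mon k (Deg.ofFinset (s i)) a • f.lin (B.gen i)) else 0 := by
    conv_lhs => rw [B.eq_sum y hy]
    rw [map_sum]
    refine Finset.sum_congr rfl fun i _ => ?_
    split_ifs
    · rw [← map_smul]
      exact (f.lin.restrictScalars k).map_smul _ _
    · exact map_zero _
  rw [key f, key g]
  simp only [h]

open Classical in
/-- The linear map `M_a → N_a` sending the `i`-th generator to `v i`. -/
def liftAt (v : ι → N.carrier) (hv : ∀ i, v i ∈ N.gr (Deg.ofFinset (s i))) (a : Deg n) :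
    M.gr a →ₗ[k] N.gr a :=
  ∑ i, if h : Deg.ofFinset (s i) ≤ a then
    LinearMap.smulRight (B.coef i ∘ₗ (M.gr a).subtype)
      (⟨mon k (Deg.ofFinset (s i)) a • v i, N.mon_smul_mem h (hv i)⟩ : N.gr a) else 0

open Classical in
lemma coe_liftAt (v : ι → N.carrier) (hv : ∀ i, v i ∈ N.gr (Deg.ofFinset (s i))) (a : Deg n)
    (y : M.gr a) : (B.liftAt v hv a y : N.carrier) = ∑ i, if Deg.ofFinset (s i) ≤ a then
      B.coef i y • (mon k (Deg.ofFinset (s i)) a • v i) else 0 := by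
  rw [liftAt, LinearMap.sum_apply, AddSubmonoidClass.coe_finsetSum]
  refine Finset.sum_congr rfl fun i _ => ?_
  split_ifs <;> rfl

/-- The morphism sending the `i`-th generator to `v i`. -/
def lift (v : ι → N.carrier) (hv : ∀ i, v i ∈ N.gr (Deg.ofFinset (s i))) : M ⟶ N :=
  homOfComponents (B.liftAt v hv) (by
    classical
    intro a b h y
    apply Subtype.ext
    rw [coe_liftAt, coe_mulMap, coe_mulMap, coe_liftAt, Finset.smul_sum]
    refine Finset.sum_congr rfl fun i _ => ?_
    rw [B.coef_mon]
    by_cases h1 : Deg.ofFinset (s i) ≤ a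
    · rw [if_pos h1, if_pos (h1.trans h), smul_comm (mon k a b) (B.coef i y), ← mul_smul,
        mon_mul h1 h]
    · rw [if_neg h1, B.coef_eq_zero i a y y.2 h1, zero_smul, ite_self, smul_zero])

open Classical in
lemma lift_lin (v : ι → N.carrier) (hv : ∀ i, v i ∈ N.gr (Deg.ofFinset (s i))) {a : Deg n}
    (y : M.carrier) (hy : y ∈ M.gr a) : (B.lift v hv).lin y = ∑ i, if Deg.ofFinset (s i) ≤ a then
      B.coef i y • (mon k (Deg.ofFinset (s i)) a • v i) else 0 :=
  (homOfComponents_lin _ _ a ⟨y, hy⟩).trans (B.coe_liftAt v hv a ⟨y, hy⟩)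

lemma lift_gen (v : ι → N.carrier) (hv : ∀ i, v i ∈ N.gr (Deg.ofFinset (s i))) (i : ι) :
    (B.lift v hv).lin (B.gen i) = v i := by
  classical
  rw [B.lift_lin v hv _ (B.gen_mem i), Finset.sum_eq_single i]
  · rw [if_pos le_rfl, B.coef_gen_self, mon_self, one_smul, one_smul]
  · intro j _ hj
    rw [B.coef_gen_ne j i hj, zero_smul, ite_self]
  · simp

lemma projective (B : SqBasis M s) : Projective M where
  factors {X Y} f e _ := by
    choose v hv hv' using fun i => exists_of_epi e _ _ (f.map_mem _ _ (B.gen_mem i))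
    refine ⟨B.lift v hv, B.hom_ext fun i => ?_⟩
    rw [comp_lin, LinearMap.comp_apply, B.lift_gen, hv']

variable {κ : Type} [Fintype κ] {t : κ → Finset (Fin n)} (B' : SqBasis N t)

/-- Once all variables are set to `1`, a morphism acts on coordinates as a matrix over `k`; this
reduces all computations below to linear algebra. -/
lemma coef_lin (f : M ⟶ N) (y : M.carrier) (j : κ) :
    B'.coef j (f.lin y) = ∑ i, B.coef i y * B'.coef j (f.lin (B.gen i)) := by
  classical
  refine M.gr_induction (p := fun y => B'.coef j (f.lin y) =
    ∑ i, B.coef i y * B'.coef j (f.lin (B.gen i))) y ?_ (by simp) ?_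
  · intro a y hy
    have h : f = B.lift (fun i => f.lin (B.gen i)) (fun i => f.map_mem _ _ (B.gen_mem i)) :=
      B.hom_ext fun i => (B.lift_gen (fun i => f.lin (B.gen i)) _ i).symm
    conv_lhs => rw [h, B.lift_lin _ _ y hy, map_sum]
    refine Finset.sum_congr rfl fun i _ => ?_
    split_ifs with h1
    · rw [map_smul, B'.coef_mon, smul_eq_mul]
    · rw [B.coef_eq_zero i a y hy h1, zero_mul, map_zero]
  · intro y z hy hz
    rw [map_add, map_add, hy, hz, ← Finset.sum_add_distrib]
    simp only [map_add, add_mul]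

lemma hom_ext_coef {f g : M ⟶ N}
    (h : ∀ i j, B'.coef j (f.lin (B.gen i)) = B'.coef j (g.lin (B.gen i))) : f = g := by
  refine B.hom_ext fun i => sub_eq_zero.1 (B'.eq_zero (Deg.ofFinset (s i)) _
    (Submodule.sub_mem _ (f.map_mem _ _ (B.gen_mem i)) (g.map_mem _ _ (B.gen_mem i))) fun j => ?_)
  rw [map_sub, h, sub_self]

lemma exists_coef (q : κ → k) (a : Deg n) (hq : ∀ j, q j ≠ 0 → Deg.ofFinset (t j) ≤ a) :
    ∃ y ∈ N.gr a, ∀ j, B'.coef j y = q j := by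
  classical
  refine ⟨∑ j, q j • (mon k (Deg.ofFinset (t j)) a • B'.gen j), Submodule.sum_mem _ fun j _ => ?_,
    fun j => ?_⟩
  · by_cases h : q j = 0
    · rw [h, zero_smul]
      exact Submodule.zero_mem _
    · exact Submodule.smul_mem _ _ (N.mon_smul_mem (hq j h) (B'.gen_mem j))
  · simp only [map_sum, map_smul, B'.coef_mon, B'.coef_gen, smul_eq_mul, mul_ite, mul_one,
      mul_zero, Finset.sum_ite_eq, Finset.mem_univ, if_true]

/-- A matrix whose entries vanish where there is no non-zero map between the generators gives a
morphism. -/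
lemma exists_hom (B : SqBasis M s) (B' : SqBasis N t) (A : ι → κ → k)
    (hA : ∀ i j, A i j ≠ 0 → t j ⊆ s i) :
    ∃ f : M ⟶ N, ∀ i j, B'.coef j (f.lin (B.gen i)) = A i j := by
  choose v hv hv' using fun i => B'.exists_coef (A i) (Deg.ofFinset (s i))
    (fun j h => Deg.ofFinset_mono (hA i j h))
  refine ⟨B.lift v hv, fun i j => ?_⟩
  rw [B.lift_gen, hv']

end SqBasis

/-! ### Koszul signs and contractions -/

/-- The sign of the component `H → H \ {l}` of the Koszul differential. -/
def koszulSign (l : Fin n) (H : Finset (Fin n)) : ℤ := (-1) ^ alpha l (H.erase l)ᶜ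

lemma koszulSign_mul_self (l : Fin n) (H : Finset (Fin n)) :
    koszulSign l H * koszulSign l H = 1 := by
  rw [koszulSign, ← mul_pow]
  simp

/-- Inserting `l` and deleting `m` anticommute. On complements this is the rule for deleting `l` and
`m` from `(H \ {m})ᶜ` in the two possible orders, which is `alpha_erase_add`. -/
lemma koszulSign_anticomm {l m : Fin n} {H : Finset (Fin n)} (hl : l ∉ H) (hm : m ∈ H) :
    koszulSign l (insert l H) * koszulSign m (insert l H) +
      koszulSign m H * koszulSign l (insert l (H.erase m)) = 0 := by
  have hlm : l ≠ m := fun h => hl (h ▸ hm)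
  have h := alpha_erase_add (F := (H.erase m)ᶜ) (j := l) (l := m) (by simp [hl]) (by simp) hlm
  have e1 : ((H.erase m)ᶜ).erase l = ((insert l H).erase m)ᶜ := by
    ext i
    by_cases him : i = m
    · subst him; simp [hlm.symm]
    · simp [him]
  have e2 : ((H.erase m)ᶜ).erase m = ((insert l H).erase l)ᶜ := by
    rw [Finset.erase_insert hl]
    ext i; simp only [Finset.mem_erase, Finset.mem_compl]
    by_cases him : i = m
    · subst him; simp [hm]
    · simp [him]
  have e3 : (H.erase m) = (insert l (H.erase m)).erase l := by
    rw [Finset.erase_insert (by simp [hl])]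
  have ha : (-1 : ℤ) ^ alpha l (H.erase m)ᶜ = koszulSign l (insert l (H.erase m)) := by
    rw [koszulSign, ← e3]
  have hb : (-1 : ℤ) ^ alpha m (H.erase m)ᶜ = koszulSign m H := rfl
  rw [e1, e2, ha, hb] at h
  change koszulSign l (insert l (H.erase m)) * koszulSign m (insert l H) +
    koszulSign m H * koszulSign l (insert l H) = 0 at h
  have s1 := koszulSign_mul_self l (insert l (H.erase m))
  have s2 := koszulSign_mul_self l (insert l H)
  generalize koszulSign l (insert l (H.erase m)) = a at *
  generalize koszulSign m (insert l H) = b at *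
  generalize koszulSign m H = c at *
  generalize koszulSign l (insert l H) = d at *
  -- Multiplying the relation by the two signs that square to `1` exchanges their roles.
  linear_combination a * d * h - b * d * s1 - a * c * s2

/-- Deleting `j` from `H'ᶜ` gives `Hᶜ` exactly when deleting `j` from `H` gives `H'`. Taking the
Koszul signs from complements makes them the signs of the dualizing complex, so that they cancel in
`homForm_d`. -/
lemma incidence_compl (H H' : Finset (Fin n)) :
    incidence H'ᶜ Hᶜ = ∑ l ∈ H, if H.erase l = H' then koszulSign l H else 0 := by
  rw [incidence, ← Finset.sum_filter, ← Finset.sum_filter]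
  refine Finset.sum_congr ?_ ?_
  · ext j
    simp only [Finset.mem_filter, Finset.mem_compl]
    constructor
    · rintro ⟨h1, h2⟩
      have h3 : insert j H' = H := by
        rw [← compl_inj_iff, ← h2]
        ext i; simp only [Finset.mem_compl, Finset.mem_insert, Finset.mem_erase]; tauto
      subst h3
      simp [h1]
    · rintro ⟨h1, rfl⟩
      refine ⟨by simp, ?_⟩
      ext i
      simp only [Finset.mem_compl, Finset.mem_erase]
      by_cases hij : i = j
      · subst hij; simp [h1]
      · simp [hij]
  · intro j hj
    rw [Finset.mem_filter] at hj
    rw [koszulSign, hj.2]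

/-- The matrix of the Koszul differential. -/
def koszul (k : Type u) [Field k] {n : ℕ} (H H' : Finset (Fin n)) : k :=
  (-1) ^ H.card * ((incidence H'ᶜ Hᶜ : ℤ) : k)

lemma koszul_ne_zero {H H' : Finset (Fin n)} (h : koszul k H H' ≠ 0) :
    H' ⊆ H ∧ H'.card + 1 = H.card := by
  rw [koszul, incidence_compl] at h
  have : ∃ l ∈ H, H.erase l = H' := by
    by_contra hc
    push Not at hc
    apply h
    rw [Finset.sum_eq_zero fun l hl => if_neg (hc l hl)]
    simp
  obtain ⟨l, hl, rfl⟩ := this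
  exact ⟨Finset.erase_subset l H, Finset.card_erase_add_one hl⟩

lemma incidence_compl_erase {H : Finset (Fin n)} {l : Fin n} (hl : l ∈ H) :
    incidence (H.erase l)ᶜ Hᶜ = koszulSign l H := by
  rw [incidence_compl, Finset.sum_eq_single l]
  · rw [if_pos rfl]
  · intro m hm hml
    refine if_neg fun h => hml ?_
    by_contra
    have : m ∈ H.erase l := Finset.mem_erase.2 ⟨hml, hm⟩
    rw [← h] at this
    simp at this
  · exact fun h => absurd hl h

lemma koszul_erase {H : Finset (Fin n)} {l : Fin n} (hl : l ∈ H) :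
    koszul k H (H.erase l) = (-1) ^ H.card * ((koszulSign l H : ℤ) : k) := by
  rw [koszul, incidence_compl_erase hl]

lemma sum_koszul_mul (H : Finset (Fin n)) (f : Finset (Fin n) → k) :
    ∑ H', koszul k H H' * f H' =
      (-1) ^ H.card * ∑ l ∈ H, ((koszulSign l H : ℤ) : k) * f (H.erase l) := by
  have h (H' : Finset (Fin n)) : koszul k H H' * f H' = ∑ l ∈ H, if H.erase l = H' then
      (-1) ^ H.card * (((koszulSign l H : ℤ) : k) * f H') else 0 := by
    rw [koszul, incidence_compl, Int.cast_sum, Finset.mul_sum, Finset.sum_mul]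
    refine Finset.sum_congr rfl fun l _ => ?_
    split_ifs
    · rw [mul_assoc]
    · simp
  rw [Finset.sum_congr rfl fun H' _ => h H', Finset.sum_comm, Finset.mul_sum]
  refine Finset.sum_congr rfl fun l _ => ?_
  rw [Finset.sum_ite_eq, if_pos (Finset.mem_univ _)]

/-- Up to complements this is `sum_incidence_mul`: the factors `(-1)^|H|` and `(-1)^|H'|` with `|H|
= |H'| + 1` contribute only a global sign. -/
lemma sum_koszul_mul_koszul (H H'' : Finset (Fin n)) :
    ∑ H', koszul k H H' * koszul k H' H'' = 0 := by
  have h (H' : Finset (Fin n)) : koszul k H H' * koszul k H' H'' =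
      - ((incidence H''ᶜ H'ᶜ * incidence H'ᶜ Hᶜ : ℤ) : k) := by
    by_cases h0 : koszul k H H' = 0
    · have : ((incidence H'ᶜ Hᶜ : ℤ) : k) = 0 := by
        rw [koszul, mul_eq_zero] at h0
        exact h0.resolve_left (by simp)
      rw [h0, Int.cast_mul, this, mul_zero, neg_zero, zero_mul]
    · have h1 := (koszul_ne_zero h0).2
      rw [koszul, koszul, ← h1, pow_succ, Int.cast_mul]
      have h2 : (-1 : k) ^ H'.card * (-1) ^ H'.card = 1 := by rw [← mul_pow]; simp
      linear_combination (-((incidence H'ᶜ Hᶜ : ℤ) : k) * ((incidence H''ᶜ H'ᶜ : ℤ) : k)) * h2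
  have hs : ∑ H' : Finset (Fin n), incidence H''ᶜ H'ᶜ * incidence H'ᶜ Hᶜ = 0 :=
    (Equiv.sum_comp (compl_involutive.toPerm (α := Finset (Fin n)))
      (fun G => incidence H''ᶜ G * incidence G Hᶜ)).trans (sum_incidence_mul _ _)
  rw [Finset.sum_congr rfl fun H' _ => h H', Finset.sum_neg_distrib, ← Int.cast_sum, hs,
    Int.cast_zero, neg_zero]

/-- The matrix of the contraction of the Koszul complex adding or removing `l`. -/
def contr (k : Type u) [Field k] {n : ℕ} (l : Fin n) (H H' : Finset (Fin n)) : k :=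
  if l ∉ H ∧ H' = insert l H then (-1) ^ H'.card * ((koszulSign l H' : ℤ) : k) else 0

lemma sum_contr_mul (l : Fin n) (H : Finset (Fin n)) (f : Finset (Fin n) → k) :
    ∑ H', contr k l H H' * f H' = if l ∉ H then
      (-1) ^ (insert l H).card * ((koszulSign l (insert l H) : ℤ) : k) * f (insert l H) else 0 := by
  by_cases h : l ∈ H
  · simp [contr, h]
  · simp [contr, h]

lemma neg_one_pow_mul_self (m : ℕ) : (-1 : k) ^ m * (-1) ^ m = 1 := by
  rw [← mul_pow]; simp

/-- This is the standard null-homotopy of a Koszul complex with a unit coefficient at `l`: inserting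
`l` is a contraction for the differential that deletes elements. -/
lemma contr_koszul_apply (l : Fin n) (H : Finset (Fin n)) (f : Finset (Fin n) → k) :
    ∑ H', koszul k H H' * ∑ H'', contr k l H' H'' * f H'' +
      ∑ H', contr k l H H' * ∑ H'', koszul k H' H'' * f H'' = f H := by
  rw [sum_contr_mul, sum_koszul_mul]
  simp only [sum_contr_mul, sum_koszul_mul]
  have sq (l : Fin n) (H : Finset (Fin n)) :
      ((koszulSign l H : ℤ) : k) * ((koszulSign l H : ℤ) : k) = 1 := by
    rw [← Int.cast_mul, koszulSign_mul_self, Int.cast_one]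
  by_cases hl : l ∈ H
  -- For `l ∈ H` the second sum is empty, and in the first one `l` must be deleted before it can be
  -- inserted again.
  · rw [if_neg (by simpa using hl), add_zero, Finset.sum_eq_single l]
    · rw [if_pos (by simp), Finset.insert_erase hl]
      linear_combination f H * (-1) ^ H.card * (-1) ^ H.card * sq l H +
        f H * neg_one_pow_mul_self (k := k) H.card
    · intro m hm hml
      rw [if_neg (by simp [hl, hml.symm]), mul_zero]
    · exact fun h => absurd hl h
  -- For `l ∉ H` inserting and deleting `l` returns `f H`; the terms that delete another `m` occur
  -- in both orders and cancel by `koszulSign_anticomm`.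
  · rw [if_pos hl, Finset.sum_insert hl, Finset.erase_insert hl, mul_add, mul_add, Finset.mul_sum,
      Finset.mul_sum, Finset.mul_sum, ← add_assoc, add_right_comm, ← Finset.sum_add_distrib,
      Finset.sum_eq_zero, zero_add]
    · linear_combination f H * (-1) ^ (insert l H).card * (-1) ^ (insert l H).card *
        sq l (insert l H) + f H * neg_one_pow_mul_self (k := k) (insert l H).card
    · intro m hm
      have hlm : l ≠ m := fun h => hl (h ▸ hm)
      have hc : (insert l (H.erase m)).card = H.card := by
        rw [Finset.card_insert_of_notMem (by simp [hl]), Finset.card_erase_add_one hm]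
      rw [if_pos (by simp [hl]), hc, Finset.erase_insert_of_ne hlm]
      have ha : ((koszulSign l (insert l H) : ℤ) : k) * ((koszulSign m (insert l H) : ℤ) : k) +
          ((koszulSign m H : ℤ) : k) * ((koszulSign l (insert l (H.erase m)) : ℤ) : k) = 0 := by
        exact_mod_cast congrArg (Int.cast (R := k)) (koszulSign_anticomm hl hm)
      have h1 := neg_one_pow_mul_self (k := k) H.card
      have h2 := neg_one_pow_mul_self (k := k) (insert l H).card
      generalize (-1 : k) ^ (insert l H).card = s at *
      generalize (-1 : k) ^ H.card = t at *
      linear_combination f (insert l (H.erase m)) * ha +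
        (((koszulSign m H : ℤ) : k) * ((koszulSign l (insert l (H.erase m)) : ℤ) : k)) *
          f (insert l (H.erase m)) * h1 +
        ((koszulSign l (insert l H) : ℤ) : k) * ((koszulSign m (insert l H) : ℤ) : k) *
          f (insert l (H.erase m)) * h2

lemma contr_koszul (l : Fin n) (H H'' : Finset (Fin n)) :
    ∑ H', koszul k H H' * contr k l H' H'' + ∑ H', contr k l H H' * koszul k H' H'' =
      if H = H'' then 1 else 0 := by
  have h := contr_koszul_apply l H (fun G => if G = H'' then (1 : k) else 0)
  simpa using h

open Classical in
/-- The contraction with respect to the least element of `A`. -/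
def contrMin (k : Type u) [Field k] {n : ℕ} (A H H' : Finset (Fin n)) : k :=
  if h : A.Nonempty then contr k (A.min' h) H H' else 0

/-- Any element of `A` gives a contraction; the minimum is only a definite choice. Below, `A` is `st
x \ F` for columns and `st x ∩ G` for rows, and an empty `A` marks the places where cohomology
survives. -/
lemma contrMin_koszul {A : Finset (Fin n)} (hA : A.Nonempty) (H H'' : Finset (Fin n)) :
    ∑ H', koszul k H H' * contrMin k A H' H'' + ∑ H', contrMin k A H H' * koszul k H' H'' =
      if H = H'' then 1 else 0 := by
  simp only [contrMin, dif_pos hA]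
  exact contr_koszul _ H H''

lemma contrMin_koszul_apply {A : Finset (Fin n)} (hA : A.Nonempty) (H : Finset (Fin n))
    (f : Finset (Fin n) → k) :
    ∑ H', koszul k H H' * ∑ H'', contrMin k A H' H'' * f H'' +
      ∑ H', contrMin k A H H' * ∑ H'', koszul k H' H'' * f H'' = f H := by
  simp only [contrMin, dif_pos hA]
  exact contr_koszul_apply _ H f

lemma apply_contrMin_koszul {A : Finset (Fin n)} (hA : A.Nonempty) (H'' : Finset (Fin n))
    (f : Finset (Fin n) → k) :
    ∑ H', (∑ H, f H * contrMin k A H H') * koszul k H' H'' +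
      ∑ H', (∑ H, f H * koszul k H H') * contrMin k A H' H'' = f H'' := by
  simp only [Finset.sum_mul, mul_assoc]
  rw [Finset.sum_comm, Finset.sum_comm (γ := Finset (Fin n)) (f := fun H' H =>
    f H * (koszul k H H' * contrMin k A H' H'')), ← Finset.sum_add_distrib]
  simp only [← Finset.mul_sum, ← mul_add]
  have h (H : Finset (Fin n)) : ∑ H', contrMin k A H H' * koszul k H' H'' +
      ∑ H', koszul k H H' * contrMin k A H' H'' = if H = H'' then 1 else 0 := by
    rw [add_comm, contrMin_koszul hA]
  simp [h]

lemma contrMin_ne_zero {A H H' : Finset (Fin n)} (h : contrMin k A H H' ≠ 0) :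
    ∃ l ∈ A, l ∉ H ∧ H' = insert l H := by
  rw [contrMin] at h
  split_ifs at h with hA
  · rw [contr] at h
    split_ifs at h with h'
    · exact ⟨_, A.min'_mem hA, h'⟩
    · exact absurd rfl h
  · exact absurd rfl h

/-! ### Acyclicity by filtrations -/

section Filtration

variable {V : Type*} [AddCommGroup V] [Module k V] {D h : V →ₗ[k] V} {W : ℕ → Submodule k V}

/-- Here `h` is a homotopy from the identity to zero up to terms of lower filtration. A cocycle `u`
therefore equals `D (h u)` modulo the next step, and the error is again a cocycle; iteration pushes
it down to `W 0`. The submodule `S` keeps control of the support of the cochain `w`. -/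
lemma exists_of_filtration {S : Submodule k V} (hD : ∀ u, D (D u) = 0)
    (hW : ∀ p, ∀ u ∈ W (p + 1), u - D (h u) - h (D u) ∈ W p) (hS : ∀ p, W p ≤ S)
    (hh : ∀ u ∈ S, h u ∈ S) (p : ℕ) (u : V) (hu : u ∈ W p) (h0 : D u = 0) :
    ∃ w ∈ S, u - D w ∈ W 0 := by
  induction p generalizing u with
  | zero => exact ⟨0, S.zero_mem, by simpa using hu⟩
  | succ p ih =>
    have h1 := hW p u hu
    rw [h0, map_zero, sub_zero] at h1
    obtain ⟨w, hwS, hw⟩ := ih _ h1 (by rw [map_sub, h0, hD, sub_zero])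
    refine ⟨h u + w, S.add_mem (hh u (hS _ hu)) hwS, ?_⟩
    rwa [map_add, ← sub_sub]

/-- Replacing `w` by `w - D (h w)` does not change `D w`, and it lowers the filtration because `h`
kills `D w ∈ W 0`. At the bottom `D` vanishes. -/
lemma eq_zero_of_filtration (hD : ∀ u, D (D u) = 0)
    (hW : ∀ p, ∀ u ∈ W (p + 1), u - D (h u) - h (D u) ∈ W p)
    (hD0 : ∀ u ∈ W 0, D u = 0) (hh0 : ∀ u ∈ W 0, h u = 0) (p : ℕ) (w : V)
    (hw : w ∈ W p) (h0 : D w ∈ W 0) : D w = 0 := by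
  induction p generalizing w with
  | zero => exact hD0 w hw
  | succ p ih =>
    have h1 := hW p w hw
    rw [hh0 _ h0, sub_zero] at h1
    have h2 : D (w - D (h w)) = D w := by rw [map_sub, hD, sub_zero]
    rw [← h2]
    exact ih _ h1 (by rwa [h2])

end Filtration

/-! ### Minimal matrices and the associated Koszul double complex -/

/-- The matrix of the differential of a bounded minimal complex of free modules with squarefree
generators: the generator `x` has cohomological degree `dg x` and internal degree `st x`. -/
structure MinMatrix (k : Type u) [Field k] (n : ℕ) where
  B : Type
  [fintype : Fintype B]
  [decEq : DecidableEq B]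
  dg : B → ℤ
  st : B → Finset (Fin n)
  c : B → B → k
  st_ssubset : ∀ x y, c x y ≠ 0 → st y ⊂ st x
  dg_eq : ∀ x y, c x y ≠ 0 → dg y = dg x + 1
  sum_c : ∀ x z, ∑ y, c x y * c y z = 0

namespace MinMatrix

attribute [instance] fintype decEq

variable (T : MinMatrix k n)

/-- Pairs of a generator and a set of variables. -/
abbrev J : Type := T.B × Finset (Fin n)

/-- The total degree of a pair. -/
def tdeg (p : T.J) : ℤ := T.dg p.1 + p.2.card

/-- The matrix of the differential of the Koszul double complex. -/
def dmat (p p' : T.J) : k :=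
  (if p.1 = p'.1 then koszul k p.2 p'.2 else 0) +
    if p.2 = p'.2 then (-1) ^ p.2.card * T.c p'.1 p.1 else 0

/-- A non-zero entry either deletes an element of `H` or follows an entry of `c` backwards, since
Alexander duality reverses arrows; the second kind enlarges `st`. Both preserve `H ⊆ st x`. -/
lemma dmat_ne_zero {p p' : T.J} (h : T.dmat p p' ≠ 0) :
    p'.2 ⊆ p.2 ∧ T.st p.1 ⊆ T.st p'.1 ∧ T.tdeg p' + 1 = T.tdeg p := by
  by_cases h1 : p.1 = p'.1 ∧ koszul k p.2 p'.2 ≠ 0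
  · obtain ⟨h2, h3⟩ := h1
    have h4 := koszul_ne_zero h3
    refine ⟨h4.1, by rw [h2], ?_⟩
    rw [tdeg, tdeg, h2]
    have := h4.2
    omega
  · by_cases h2 : p.2 = p'.2 ∧ T.c p'.1 p.1 ≠ 0
    · obtain ⟨h3, h4⟩ := h2
      refine ⟨by rw [h3], (T.st_ssubset _ _ h4).1, ?_⟩
      rw [tdeg, tdeg, h3, T.dg_eq _ _ h4]
      ring
    · exfalso
      apply h
      rw [dmat]
      have e1 : (if p.1 = p'.1 then koszul k p.2 p'.2 else 0) = 0 := by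
        split_ifs with h5
        · by_contra h6
          exact h1 ⟨h5, h6⟩
        · rfl
      have e2 : (if p.2 = p'.2 then (-1) ^ p.2.card * T.c p'.1 p.1 else 0) = 0 := by
        split_ifs with h5
        · by_contra h6
          exact h2 ⟨h5, right_ne_zero_of_mul h6⟩
        · rfl
      rw [e1, e2, add_zero]

lemma sum_dmat_mul (p : T.J) (u : T.J → k) :
    ∑ p', T.dmat p p' * u p' = ∑ H', koszul k p.2 H' * u (p.1, H') +
      (-1) ^ p.2.card * ∑ y, T.c y p.1 * u (y, p.2) := by
  simp only [dmat, add_mul, Finset.sum_add_distrib, Fintype.sum_prod_type, ite_mul, zero_mul]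
  congr 1
  · rw [Finset.sum_comm]
    simp
  · simp [Finset.mul_sum, mul_assoc]

lemma sum_mul_dmat (p' : T.J) (q : T.J → k) :
    ∑ p, q p * T.dmat p p' = ∑ H, q (p'.1, H) * koszul k H p'.2 +
      (-1) ^ p'.2.card * ∑ y, T.c p'.1 y * q (y, p'.2) := by
  simp only [dmat, mul_add, Finset.sum_add_distrib, Fintype.sum_prod_type, mul_ite, mul_zero]
  congr 1
  · rw [Finset.sum_comm]
    simp
  · simp [Finset.mul_sum, mul_left_comm, mul_comm]

/-- The two squares vanish separately, and the mixed terms cancel because the sign `(-1)^|H|` in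
front of `c` changes when a Koszul step lowers `|H|` by one. -/
lemma dmat_sq (p p'' : T.J) : ∑ p', T.dmat p p' * T.dmat p' p'' = 0 := by
  rw [sum_dmat_mul]
  simp only [dmat, mul_add, Finset.sum_add_distrib, mul_ite, mul_zero]
  have e1 : ∑ H', (if p.1 = p''.1 then koszul k p.2 H' * koszul k H' p''.2 else 0) = 0 := by
    split_ifs
    · exact sum_koszul_mul_koszul _ _
    · simp
  have e2 : ∑ y, (if p.2 = p''.2 then
      T.c y p.1 * ((-1) ^ p.2.card * T.c p''.1 y) else 0) = 0 := by
    split_ifs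
    · have := T.sum_c p''.1 p.1
      calc _ = (-1) ^ p.2.card * ∑ y, T.c p''.1 y * T.c y p.1 := by
            rw [Finset.mul_sum]
            exact Finset.sum_congr rfl fun y _ => by ring
        _ = 0 := by rw [this, mul_zero]
    · simp
  rw [e1, e2]
  simp only [Finset.sum_ite_eq', Finset.mem_univ, if_true, zero_add, mul_zero,
    add_zero]
  by_cases h : koszul k p.2 p''.2 = 0
  · simp [h]
  · have h1 := (koszul_ne_zero h).2
    rw [← h1, pow_succ]
    ring

/-- The transpose of the differential, on functions on the pairs `(x, H)` with `H ⊆ st x`. -/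
def colD : (T.J → k) →ₗ[k] (T.J → k) where
  toFun u p := if p.2 ⊆ T.st p.1 then ∑ p', T.dmat p p' * u p' else 0
  map_add' u v := by
    ext p
    simp only [Pi.add_apply, mul_add, Finset.sum_add_distrib]
    split_ifs <;> simp
  map_smul' r u := by
    ext p
    simp only [Pi.smul_apply, smul_eq_mul, RingHom.id_apply, mul_ite, mul_zero, Finset.mul_sum,
      mul_left_comm]

lemma colD_apply {p : T.J} (hp : p.2 ⊆ T.st p.1) (u : T.J → k) :
    T.colD u p = ∑ p', T.dmat p p' * u p' := if_pos hp

/-- The differential, on functions on pairs. -/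
def rowD : (T.J → k) →ₗ[k] (T.J → k) where
  toFun q p' := ∑ p, q p * T.dmat p p'
  map_add' u v := by
    ext p
    simp only [Pi.add_apply, add_mul, Finset.sum_add_distrib]
  map_smul' r u := by
    ext p
    simp only [Pi.smul_apply, smul_eq_mul, RingHom.id_apply, Finset.mul_sum, mul_assoc]

lemma rowD_apply (q : T.J → k) (p' : T.J) : T.rowD q p' = ∑ p, q p * T.dmat p p' := rfl

/-- The truncation to `H ⊆ st x` is harmless: an arrow that starts at such a pair ends at such a
pair, so `dmat_sq` applies. -/
lemma colD_colD (u : T.J → k) : T.colD (T.colD u) = 0 := by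
  ext p
  by_cases hp : p.2 ⊆ T.st p.1
  · rw [T.colD_apply hp]
    have h (p' : T.J) : T.dmat p p' * T.colD u p' =
        ∑ p'', T.dmat p p' * T.dmat p' p'' * u p'' := by
      by_cases h0 : T.dmat p p' = 0
      · simp [h0]
      · have h1 := T.dmat_ne_zero h0
        rw [T.colD_apply (h1.1.trans (hp.trans h1.2.1)), Finset.mul_sum]
        exact Finset.sum_congr rfl fun _ _ => by ring
    rw [Finset.sum_congr rfl fun p' _ => h p', Finset.sum_comm]
    simp only [← Finset.sum_mul, T.dmat_sq, zero_mul, Finset.sum_const_zero, Pi.zero_apply]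
  · exact if_neg hp

lemma rowD_rowD (q : T.J → k) : T.rowD (T.rowD q) = 0 := by
  ext p
  simp only [rowD_apply, Finset.sum_mul, mul_assoc]
  rw [Finset.sum_comm]
  simp only [← Finset.mul_sum, T.dmat_sq, mul_zero, Finset.sum_const_zero, Pi.zero_apply]

/-- The functions supported on pairs with a given property. -/
def supported (P : T.J → Prop) : Submodule k (T.J → k) where
  carrier := {u | ∀ p, u p ≠ 0 → P p}
  zero_mem' p h := absurd rfl h
  add_mem' {u v} hu hv p h := by
    by_cases h1 : u p = 0
    · exact hv p fun h2 => h (by rw [Pi.add_apply, h1, h2, add_zero])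
    · exact hu p h1
  smul_mem' c u hu p h := hu p fun h1 => h (by rw [Pi.smul_apply, h1, smul_zero])

variable {T}

lemma apply_eq_zero {P : T.J → Prop} {u : T.J → k} (hu : u ∈ T.supported P) {p : T.J}
    (hp : ¬ P p) : u p = 0 := by_contra fun h => hp (hu p h)

lemma supported_mono {P P' : T.J → Prop} (h : ∀ p, P p → P' p) :
    T.supported P ≤ T.supported P' := fun _ hu p hp => h p (hu p hp)

open Classical in
/-- Restriction of a function to the pairs of total degree `i`. -/
def restr (T : MinMatrix k n) (i : ℤ) (u : T.J → k) (p : T.J) : k := if T.tdeg p = i then u p else 0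

/-- The filtration arguments ignore the total degree. Since the differential shifts it by one, their
output can be cut down to a single degree afterwards. -/
lemma colD_restr (i : ℤ) (u : T.J → k) : T.colD (T.restr (i - 1) u) = T.restr i (T.colD u) := by
  ext p
  by_cases hp : p.2 ⊆ T.st p.1
  · rw [T.colD_apply hp, restr, T.colD_apply hp]
    by_cases hi : T.tdeg p = i
    · rw [if_pos hi]
      refine Finset.sum_congr rfl fun p' _ => ?_
      by_cases h0 : T.dmat p p' = 0
      · simp [h0]
      · have := (T.dmat_ne_zero h0).2.2
        rw [restr, if_pos (by omega)]
    · rw [if_neg hi]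
      refine Finset.sum_eq_zero fun p' _ => ?_
      by_cases h0 : T.dmat p p' = 0
      · simp [h0]
      · have := (T.dmat_ne_zero h0).2.2
        rw [restr, if_neg (by omega), mul_zero]
  · have e (v) : T.colD v p = 0 := if_neg hp
    rw [restr, e, e, ite_self]

lemma rowD_restr (i : ℤ) (u : T.J → k) : T.rowD (T.restr (i + 1) u) = T.restr i (T.rowD u) := by
  ext p
  rw [rowD_apply, restr, rowD_apply]
  by_cases hi : T.tdeg p = i
  · rw [if_pos hi]
    refine Finset.sum_congr rfl fun p' _ => ?_
    by_cases h0 : T.dmat p' p = 0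
    · simp [h0]
    · have := (T.dmat_ne_zero h0).2.2
      rw [restr, if_pos (by omega)]
  · rw [if_neg hi]
    refine Finset.sum_eq_zero fun p' _ => ?_
    by_cases h0 : T.dmat p' p = 0
    · simp [h0]
    · have := (T.dmat_ne_zero h0).2.2
      rw [restr, if_neg (by omega), zero_mul]

lemma restr_mem {P : T.J → Prop} (i : ℤ) {u : T.J → k} (hu : u ∈ T.supported P) :
    T.restr i u ∈ T.supported fun p => P p ∧ T.tdeg p = i := by
  intro p hp
  rw [restr] at hp
  split_ifs at hp with h
  · exact ⟨hu p hp, h⟩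
  · exact absurd rfl hp

lemma restr_eq_self {P : T.J → Prop} (i : ℤ) {u : T.J → k}
    (hu : u ∈ T.supported fun p => P p ∧ T.tdeg p = i) : T.restr i u = u := by
  ext p
  rw [restr]
  split_ifs with h
  · rfl
  · exact (apply_eq_zero hu fun h' => h h'.2).symm

/-! #### Cohomology of the columns -/

section Column

variable (T) (F : Finset (Fin n))

/-- The contraction of the column complex. -/
def colH : (T.J → k) →ₗ[k] (T.J → k) where
  toFun u p := ∑ H', contrMin k (T.st p.1 \ F) p.2 H' * u (p.1, H')
  map_add' u v := by
    ext p
    simp only [Pi.add_apply, mul_add, Finset.sum_add_distrib]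
  map_smul' r u := by
    ext p
    simp only [Pi.smul_apply, smul_eq_mul, RingHom.id_apply, Finset.mul_sum, mul_left_comm]

lemma colH_apply (u : T.J → k) (p : T.J) :
    T.colH F u p = ∑ H', contrMin k (T.st p.1 \ F) p.2 H' * u (p.1, H') := rfl

/-- The filtration of the column complex. -/
def colW (m : ℕ) : Submodule k (T.J → k) :=
  T.supported fun p => (F ⊆ p.2 ∧ p.2 ⊆ T.st p.1) ∧ (T.st p.1).card ≤ F.card + m

variable {T F}

lemma colD_mem {u : T.J → k} (hu : u ∈ T.supported fun p => F ⊆ p.2 ∧ p.2 ⊆ T.st p.1) :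
    T.colD u ∈ T.supported fun p => F ⊆ p.2 ∧ p.2 ⊆ T.st p.1 := by
  intro p hp
  by_cases h : p.2 ⊆ T.st p.1
  · rw [T.colD_apply h] at hp
    obtain ⟨p', _, hp'⟩ := Finset.exists_ne_zero_of_sum_ne_zero hp
    exact ⟨(hu p' (right_ne_zero_of_mul hp')).1.trans
      (T.dmat_ne_zero (left_ne_zero_of_mul hp')).1, h⟩
  · exact absurd (if_neg h) hp

lemma colH_mem {u : T.J → k} (hu : u ∈ T.supported fun p => F ⊆ p.2 ∧ p.2 ⊆ T.st p.1) :
    T.colH F u ∈ T.supported fun p => F ⊆ p.2 ∧ p.2 ⊆ T.st p.1 := by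
  intro p hp
  rw [colH_apply] at hp
  obtain ⟨H', _, hp'⟩ := Finset.exists_ne_zero_of_sum_ne_zero hp
  obtain ⟨l, hl, -, rfl⟩ := contrMin_ne_zero (left_ne_zero_of_mul hp')
  have h1 := hu _ (right_ne_zero_of_mul hp')
  refine ⟨fun i hi => ?_, (Finset.subset_insert _ _).trans h1.2⟩
  -- The inserted element lies in `st x \ F`, so `F ⊆ insert l H` already forces `F ⊆ H`.
  rcases Finset.mem_insert.1 (h1.1 hi) with rfl | h
  · exact absurd hi (Finset.mem_sdiff.1 hl).2
  · exact h

/-- At the top level `|st x| = |F| + m + 1` only the Koszul part of the differential acts: an entry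
of `c` into `x` would start at a generator with strictly larger `st`, where `u` vanishes. The Koszul
part is contracted by an element of `st x \ F`, which is non-empty at this level. -/
lemma colW_step (m : ℕ) (u : T.J → k) (hu : u ∈ T.colW F (m + 1)) :
    u - T.colD (T.colH F u) - T.colH F (T.colD u) ∈ T.colW F m := by
  have hu' : u ∈ T.supported fun p => F ⊆ p.2 ∧ p.2 ⊆ T.st p.1 :=
    supported_mono (fun _ h => h.1) hu
  have h1 : u - T.colD (T.colH F u) - T.colH F (T.colD u) ∈
      T.supported fun p => F ⊆ p.2 ∧ p.2 ⊆ T.st p.1 :=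
    Submodule.sub_mem _ (Submodule.sub_mem _ hu' (colD_mem (colH_mem hu')))
      (colH_mem (colD_mem hu'))
  intro p hp
  refine ⟨h1 p hp, ?_⟩
  by_contra hc
  apply hp
  have hst := (h1 p hp).2
  have hne : (T.st p.1 \ F).Nonempty := by
    rw [Finset.nonempty_iff_ne_empty]
    intro h0
    have := Finset.card_le_card (Finset.sdiff_eq_empty_iff_subset.1 h0)
    omega
  have hc0 (H : Finset (Fin n)) (y : T.B) (hy : T.c y p.1 ≠ 0) : u (y, H) = 0 := by
    refine apply_eq_zero hu fun h => ?_
    have h2 := Finset.card_lt_card (T.st_ssubset _ _ hy)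
    have := h.2
    simp only at this
    omega
  have e1 : T.colD (T.colH F u) p = ∑ H', koszul k p.2 H' *
      ∑ H'', contrMin k (T.st p.1 \ F) H' H'' * u (p.1, H'') := by
    rw [T.colD_apply hst, sum_dmat_mul]
    rw [Finset.sum_eq_zero (s := Finset.univ) (f := fun y => T.c y p.1 * T.colH F u (y, p.2)),
      mul_zero, add_zero]
    · rfl
    · intro y _
      by_cases hy : T.c y p.1 = 0
      · rw [hy, zero_mul]
      · rw [colH_apply, Finset.sum_eq_zero, mul_zero]
        intro H' _
        rw [hc0 H' y hy, mul_zero]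
  have e2 : T.colH F (T.colD u) p = ∑ H', contrMin k (T.st p.1 \ F) p.2 H' *
      ∑ H'', koszul k H' H'' * u (p.1, H'') := by
    rw [colH_apply]
    refine Finset.sum_congr rfl fun H' _ => ?_
    by_cases h0 : contrMin k (T.st p.1 \ F) p.2 H' = 0
    · rw [h0, zero_mul, zero_mul]
    · obtain ⟨l, hl, -, rfl⟩ := contrMin_ne_zero h0
      rw [T.colD_apply (p := (p.1, insert l p.2))
        (Finset.insert_subset (Finset.mem_sdiff.1 hl).1 hst), sum_dmat_mul,
        Finset.sum_eq_zero (s := Finset.univ)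
          (f := fun y => T.c y p.1 * u (y, insert l p.2)), mul_zero, add_zero]
      intro y _
      by_cases hy : T.c y p.1 = 0
      · rw [hy, zero_mul]
      · rw [hc0 _ y hy, mul_zero]
  have e3 := contrMin_koszul_apply hne p.2 (fun H => u (p.1, H))
  rw [Pi.sub_apply, Pi.sub_apply, e1, e2]
  linear_combination -e3

lemma mem_colW_zero {u : T.J → k} :
    u ∈ T.colW F 0 ↔ u ∈ T.supported fun p => p.2 = F ∧ T.st p.1 = F := by
  constructor
  · refine fun h => supported_mono (fun p hp => ?_) h
    have h1 := hp.1.1.trans hp.1.2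
    have h2 : F = T.st p.1 := Finset.eq_of_subset_of_card_le h1 hp.2
    exact ⟨(hp.1.2.trans h2.symm.subset).antisymm hp.1.1, h2.symm⟩
  · refine fun h => supported_mono (fun p hp => ?_) h
    rw [hp.1, hp.2]
    simp

/-- This is where minimality enters: between pairs `(x, F)` with `st x = F` the Koszul part has
nothing to delete, and `c` has no entries between generators of the same degree. -/
lemma colD_eq_zero {u : T.J → k} (hu : u ∈ T.colW F 0) : T.colD u = 0 := by
  rw [mem_colW_zero] at hu
  ext p
  by_cases hp : p.2 ⊆ T.st p.1
  · rw [T.colD_apply hp]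
    refine Finset.sum_eq_zero fun p' _ => ?_
    by_contra h
    have h1 := hu p' (right_ne_zero_of_mul h)
    have h2 := T.dmat_ne_zero (left_ne_zero_of_mul h)
    rw [h1.1, h1.2] at h2
    have h3 : T.st p.1 = F := h2.2.1.antisymm (h2.1.trans hp)
    have h4 : p.2 = F := (hp.trans h3.subset).antisymm h2.1
    have h5 : T.dmat p p' = 0 := by
      by_contra h0
      rw [dmat, h4, h1.1, if_pos rfl] at h0
      have hk : koszul k F F = 0 := by
        by_contra h6
        have := (koszul_ne_zero h6).2
        omega
      have hc : T.c p'.1 p.1 = 0 := by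
        by_contra h6
        have := T.st_ssubset _ _ h6
        rw [h1.2, h3] at this
        exact this.2 (Finset.Subset.refl _)
      rw [hk, hc, ite_self, mul_zero, add_zero] at h0
      exact h0 rfl
    exact h (by rw [h5, zero_mul])
  · exact if_neg hp

lemma colH_eq_zero {u : T.J → k} (hu : u ∈ T.colW F 0) : T.colH F u = 0 := by
  rw [mem_colW_zero] at hu
  ext p
  rw [colH_apply]
  refine Finset.sum_eq_zero fun H' _ => ?_
  by_contra h
  have h1 := hu _ (right_ne_zero_of_mul h)
  obtain ⟨l, hl, -⟩ := contrMin_ne_zero (left_ne_zero_of_mul h)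
  rw [h1.2, Finset.sdiff_self] at hl
  simp at hl

lemma mem_colW_top {u : T.J → k} (hu : u ∈ T.supported fun p => F ⊆ p.2 ∧ p.2 ⊆ T.st p.1) :
    u ∈ T.colW F n :=
  supported_mono (fun p hp => ⟨hp, (Finset.card_le_univ _).trans (by simp)⟩) hu

/-- Every cocycle of a column is cohomologous to one supported on the generators with `st x = F`. -/
lemma exists_col_rep (i : ℤ) {u : T.J → k}
    (hu : u ∈ T.supported fun p => (F ⊆ p.2 ∧ p.2 ⊆ T.st p.1) ∧ T.tdeg p = i)
    (h0 : T.colD u = 0) :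
    ∃ w ∈ T.supported fun p => (F ⊆ p.2 ∧ p.2 ⊆ T.st p.1) ∧ T.tdeg p = i - 1,
      u - T.colD w ∈ T.supported fun p => (p.2 = F ∧ T.st p.1 = F) ∧ T.tdeg p = i := by
  obtain ⟨w, hw, hw'⟩ := exists_of_filtration T.colD_colD (colW_step (F := F))
    (fun m => supported_mono fun _ h => h.1) (fun _ h => colH_mem h) n u
    (mem_colW_top (supported_mono (fun _ h => h.1) hu)) h0
  -- The cochain produced by the filtration may be inhomogeneous; only its part of total degree `i -
  -- 1` matters for `u`.
  refine ⟨T.restr (i - 1) w, restr_mem _ hw, ?_⟩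
  have h1 := restr_mem i (mem_colW_zero.1 hw')
  have h2 : T.restr i (u - T.colD w) = u - T.colD (T.restr (i - 1) w) := by
    rw [colD_restr]
    conv_rhs => rw [← restr_eq_self i hu]
    ext p
    simp only [restr, Pi.sub_apply]
    split_ifs <;> simp
  rwa [h2] at h1

/-- A coboundary supported on the pairs `(x, F)` with `st x = F` is zero, so these pairs give
independent cohomology classes. -/
lemma col_rep_unique {w : T.J → k}
    (hw : w ∈ T.supported fun p => F ⊆ p.2 ∧ p.2 ⊆ T.st p.1)
    (h : T.colD w ∈ T.supported fun p => p.2 = F ∧ T.st p.1 = F) : T.colD w = 0 :=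
  eq_zero_of_filtration T.colD_colD (colW_step (F := F)) (fun _ h => colD_eq_zero h)
    (fun _ h => colH_eq_zero h) n w (mem_colW_top hw) (mem_colW_zero.2 h)

end Column

/-! #### Acyclicity of the rows -/

section Row

variable (T) (G : Finset (Fin n))

/-- The contraction of the row complex. -/
def rowH : (T.J → k) →ₗ[k] (T.J → k) where
  toFun q p := ∑ H, q (p.1, H) * contrMin k (T.st p.1 ∩ G) H p.2
  map_add' u v := by
    ext p
    simp only [Pi.add_apply, add_mul, Finset.sum_add_distrib]
  map_smul' r u := by
    ext p
    simp only [Pi.smul_apply, smul_eq_mul, RingHom.id_apply, Finset.mul_sum, mul_assoc]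

lemma rowH_apply (q : T.J → k) (p : T.J) :
    T.rowH G q p = ∑ H, q (p.1, H) * contrMin k (T.st p.1 ∩ G) H p.2 := rfl

/-- The condition on pairs that defines the row complex. -/
def rowP (p : T.J) : Prop := p.2 ⊆ T.st p.1 ∧ p.2 ⊆ G ∧ (T.st p.1 ∩ G).Nonempty

/-- The filtration of the row complex. -/
def rowW (m : ℕ) : Submodule k (T.J → k) :=
  T.supported fun p => T.rowP G p ∧ n + 1 ≤ (T.st p.1).card + m

variable {T G}

lemma rowD_mem {q : T.J → k} (hq : q ∈ T.supported (T.rowP G)) :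
    T.rowD q ∈ T.supported (T.rowP G) := by
  intro p hp
  obtain ⟨p', _, hp'⟩ := Finset.exists_ne_zero_of_sum_ne_zero hp
  have h1 := hq p' (left_ne_zero_of_mul hp')
  have h2 := T.dmat_ne_zero (right_ne_zero_of_mul hp')
  exact ⟨h2.1.trans (h1.1.trans h2.2.1), h2.1.trans h1.2.1,
    h1.2.2.mono (Finset.inter_subset_inter_right h2.2.1)⟩

lemma rowH_mem {q : T.J → k} (hq : q ∈ T.supported (T.rowP G)) :
    T.rowH G q ∈ T.supported (T.rowP G) := by
  intro p hp
  rw [rowH_apply] at hp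
  obtain ⟨H, _, hp'⟩ := Finset.exists_ne_zero_of_sum_ne_zero hp
  have h1 := hq _ (left_ne_zero_of_mul hp')
  obtain ⟨l, hl, -, h⟩ := contrMin_ne_zero (right_ne_zero_of_mul hp')
  rw [Finset.mem_inter] at hl
  refine ⟨?_, ?_, h1.2.2⟩
  · rw [h]
    exact Finset.insert_subset hl.1 h1.1
  · rw [h]
    exact Finset.insert_subset hl.2 h1.2.1

/-- The order is opposite to that of the columns: contributions of `c` to `x` come from generators
with smaller `st`, so the extremal level is the one where `|st x|` is least. There the Koszul part
is contracted by an element of `st x ∩ G`. -/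
lemma rowW_step (m : ℕ) (q : T.J → k) (hq : q ∈ T.rowW G (m + 1)) :
    q - T.rowD (T.rowH G q) - T.rowH G (T.rowD q) ∈ T.rowW G m := by
  have hq' : q ∈ T.supported (T.rowP G) := supported_mono (fun _ h => h.1) hq
  have h1 : q - T.rowD (T.rowH G q) - T.rowH G (T.rowD q) ∈ T.supported (T.rowP G) :=
    Submodule.sub_mem _ (Submodule.sub_mem _ hq' (rowD_mem (rowH_mem hq')))
      (rowH_mem (rowD_mem hq'))
  intro p hp
  refine ⟨h1 p hp, ?_⟩
  by_contra hc
  apply hp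
  have hne := (h1 p hp).2.2
  have hc0 (H : Finset (Fin n)) (y : T.B) (hy : T.c p.1 y ≠ 0) : q (y, H) = 0 := by
    refine apply_eq_zero hq fun h => ?_
    have h2 := Finset.card_lt_card (T.st_ssubset _ _ hy)
    have := h.2
    simp only at this
    omega
  have e1 : T.rowD (T.rowH G q) p = ∑ H', (∑ H, q (p.1, H) * contrMin k (T.st p.1 ∩ G) H H') *
      koszul k H' p.2 := by
    rw [T.rowD_apply, sum_mul_dmat]
    rw [Finset.sum_eq_zero (s := Finset.univ) (f := fun y => T.c p.1 y * T.rowH G q (y, p.2)),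
      mul_zero, add_zero]
    · rfl
    · intro y _
      by_cases hy : T.c p.1 y = 0
      · rw [hy, zero_mul]
      · rw [rowH_apply, Finset.sum_eq_zero, mul_zero]
        intro H' _
        rw [hc0 H' y hy, zero_mul]
  have e2 : T.rowH G (T.rowD q) p = ∑ H', (∑ H, q (p.1, H) * koszul k H H') *
      contrMin k (T.st p.1 ∩ G) H' p.2 := by
    rw [rowH_apply]
    refine Finset.sum_congr rfl fun H' _ => ?_
    rw [T.rowD_apply, sum_mul_dmat,
      Finset.sum_eq_zero (s := Finset.univ) (f := fun y => T.c p.1 y * q (y, H')), mul_zero,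
      add_zero]
    intro y _
    by_cases hy : T.c p.1 y = 0
    · rw [hy, zero_mul]
    · rw [hc0 _ y hy, mul_zero]
  have e3 := apply_contrMin_koszul hne p.2 (fun H => q (p.1, H))
  rw [Pi.sub_apply, Pi.sub_apply, e1, e2]
  linear_combination -e3

/-- The condition that `st x` meets `G` makes a contraction available at every level, so nothing
survives: the last filtration step would require `|st x| ≥ n + 1`. -/
lemma row_acyclic (i : ℤ) {q : T.J → k}
    (hq : q ∈ T.supported fun p => T.rowP G p ∧ T.tdeg p = i) (h0 : T.rowD q = 0) :
    ∃ w ∈ T.supported fun p => T.rowP G p ∧ T.tdeg p = i + 1, T.rowD w = q := by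
  obtain ⟨w, hw, hw'⟩ := exists_of_filtration T.rowD_rowD (rowW_step (G := G))
    (fun m => supported_mono fun _ h => h.1) (fun _ h => rowH_mem h) (n + 1) q
    (supported_mono (fun _ h => ⟨h.1, by omega⟩) hq) h0
  have h1 : q - T.rowD w = 0 := by
    ext p
    refine apply_eq_zero hw' fun h => ?_
    have h2 := h.2
    have h3 : (T.st p.1).card ≤ n := (Finset.card_le_univ _).trans (by simp)
    omega
  refine ⟨T.restr (i + 1) w, restr_mem _ hw, ?_⟩
  rw [rowD_restr, ← sub_eq_zero.1 h1, restr_eq_self i hq]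

end Row

end MinMatrix

lemma ofFinset_le_iff {H : Finset (Fin n)} {a : Deg n} (ha : 0 ≤ a) :
    Deg.ofFinset H ≤ a ↔ H ⊆ Deg.supp a := by
  rw [Deg.le_def]
  constructor
  · intro h i hi
    have := h i
    rw [Deg.ofFinset_apply, if_pos hi] at this
    rw [Deg.mem_supp]
    omega
  · intro h i
    rw [Deg.ofFinset_apply]
    split_ifs with hi
    · have := Deg.mem_supp.1 (h hi)
      omega
    · exact Deg.le_def.1 ha i

lemma ofFinset_nonneg (H : Finset (Fin n)) : 0 ≤ Deg.ofFinset H := Deg.le_def.2 fun i => by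
  rw [Deg.ofFinset_apply, Deg.zero_apply]
  split_ifs <;> simp

lemma supp_ofFinset (H : Finset (Fin n)) : Deg.supp (Deg.ofFinset H) = H := by
  ext i
  rw [Deg.mem_supp, Deg.ofFinset_apply]
  split_ifs with h <;> simp [h]

namespace MinMatrix

variable (T : MinMatrix k n)

/-! ### The Koszul resolution -/

/-- The generators of the term of degree `m` of the Koszul resolution. -/
abbrev KIdx (m : ℤ) : Type := {p : T.J // p.2 ⊆ T.st p.1 ∧ T.tdeg p = -m}

/-- The term of degree `m` of the Koszul resolution. -/
def kX (m : ℤ) : GrMod k n := ⨁ fun p : T.KIdx m => free k p.1.2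

/-- The basis of the term of degree `m` of the Koszul resolution. -/
def kB (m : ℤ) : SqBasis (T.kX m) (fun p : T.KIdx m => p.1.2) := SqBasis.biproduct _

lemma exists_kd (m m' : ℤ) : ∃ f : T.kX m ⟶ T.kX m', ∀ p p',
    (T.kB m').coef p' (f.lin ((T.kB m).gen p)) = T.dmat p.1 p'.1 :=
  (T.kB m).exists_hom (T.kB m') _ fun _ _ h => (T.dmat_ne_zero h).1

/-- The differential of the Koszul resolution. -/
def kd (m m' : ℤ) : T.kX m ⟶ T.kX m' := (T.exists_kd m m').choose

lemma coef_kd_gen (m m' : ℤ) (p : T.KIdx m) (p' : T.KIdx m') :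
    (T.kB m').coef p' ((T.kd m m').lin ((T.kB m).gen p)) = T.dmat p.1 p'.1 :=
  (T.exists_kd m m').choose_spec p p'

lemma sum_kIdx (m : ℤ) (f : T.J → k) (hf : ∀ p, f p ≠ 0 → p.2 ⊆ T.st p.1 ∧ T.tdeg p = -m) :
    ∑ p : T.KIdx m, f p.1 = ∑ p, f p :=
  Fintype.sum_of_injective (fun p : T.KIdx m => p.1) Subtype.val_injective _ _
    (fun p hp => by_contra fun h => hp ⟨⟨p, hf p h⟩, rfl⟩) (fun _ => rfl)

/-- The Koszul resolution of the Alexander dual of the complex with matrix `T`. -/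
def kComplex : CochainComplex (GrMod k n) ℤ where
  X := T.kX
  d := T.kd
  shape m m' h := (T.kB m).hom_ext_coef (T.kB m') fun p p' => by
    rw [coef_kd_gen, zero_lin, LinearMap.zero_apply, map_zero]
    by_contra h0
    have h1 := (T.dmat_ne_zero h0).2.2
    have h2 := p.2.2
    have h3 := p'.2.2
    exact h (by simp only [ComplexShape.up_Rel]; omega)
  d_comp_d' m m' m'' h h' := (T.kB m).hom_ext_coef (T.kB m'') fun p p'' => by
    rw [comp_lin, LinearMap.comp_apply, zero_lin, LinearMap.zero_apply, map_zero,
      (T.kB m').coef_lin (T.kB m'')]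
    simp only [coef_kd_gen]
    refine (T.sum_kIdx m' (fun p' => T.dmat p.1 p' * T.dmat p' p''.1) fun p' hp' => ?_).trans
      (T.dmat_sq _ _)
    have h1 := T.dmat_ne_zero (left_ne_zero_of_mul hp')
    refine ⟨h1.1.trans (p.2.1.trans h1.2.1), ?_⟩
    have h2 := p.2.2
    simp only [ComplexShape.up_Rel] at h
    omega

variable {T}

open Classical in
/-- The coordinates of an element of the Koszul resolution, as a function on all pairs. -/
def qf {m : ℤ} (y : (T.kX m).carrier) (p : T.J) : k :=
  if h : p.2 ⊆ T.st p.1 ∧ T.tdeg p = -m then (T.kB m).coef ⟨p, h⟩ y else 0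

lemma qf_val {m : ℤ} (y : (T.kX m).carrier) (p : T.KIdx m) : qf y p.1 = (T.kB m).coef p y :=
  dif_pos p.2

lemma qf_mem {m : ℤ} {a : Deg n} (y : (T.kX m).carrier) (hy : y ∈ (T.kX m).gr a) :
    qf y ∈ T.supported fun p => (p.2 ⊆ T.st p.1 ∧ T.tdeg p = -m) ∧ Deg.ofFinset p.2 ≤ a := by
  intro p hp
  rw [qf] at hp
  split_ifs at hp with h
  · refine ⟨h, ?_⟩
    by_contra h1
    exact hp ((T.kB m).coef_eq_zero ⟨p, h⟩ a y hy h1)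
  · exact absurd rfl hp

/-- On coordinates of elements the differential acts as a row vector times the matrix, while on
values of maps out of the complex it acts on columns (`uf_kd_comp`). -/
lemma qf_kd {m : ℤ} (y : (T.kX m).carrier) :
    qf ((T.kd m (m + 1)).lin y) = T.rowD (qf y) := by
  have key (p' : T.J) : ∑ p : T.KIdx m, (T.kB m).coef p y * T.dmat p.1 p' = T.rowD (qf y) p' := by
    rw [rowD_apply, ← T.sum_kIdx m]
    · simp only [qf_val]
    · intro p hp
      by_contra h
      exact left_ne_zero_of_mul hp (dif_neg h)
  ext p'
  rw [qf]
  split_ifs with h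
  · rw [(T.kB m).coef_lin (T.kB (m + 1))]
    simp only [coef_kd_gen]
    exact key p'
  · rw [← key p', Finset.sum_eq_zero]
    intro p _
    by_contra h0
    have h1 := T.dmat_ne_zero (right_ne_zero_of_mul h0)
    have h2 := p.2.2
    exact h ⟨h1.1.trans (p.2.1.trans h1.2.1), by omega⟩

lemma eq_of_qf {m : ℤ} {a : Deg n} {y z : (T.kX m).carrier} (hy : y ∈ (T.kX m).gr a)
    (hz : z ∈ (T.kX m).gr a) (h : qf y = qf z) : y = z := by
  refine sub_eq_zero.1 ((T.kB m).eq_zero a _ (Submodule.sub_mem _ hy hz) fun p => ?_)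
  rw [map_sub, ← qf_val, ← qf_val, h, sub_self]

lemma exists_qf {m : ℤ} {a : Deg n} (q : T.J → k)
    (hq : q ∈ T.supported fun p => (p.2 ⊆ T.st p.1 ∧ T.tdeg p = -m) ∧ Deg.ofFinset p.2 ≤ a) :
    ∃ y ∈ (T.kX m).gr a, qf y = q := by
  obtain ⟨y, hy, h⟩ := (T.kB m).exists_coef (fun p => q p.1) a fun p hp => (hq p.1 hp).2
  refine ⟨y, hy, ?_⟩
  ext p
  rw [qf]
  split_ifs with h1
  · exact h _
  · exact (apply_eq_zero hq fun h2 => h1 h2.1).symm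

/-! ### The augmentation -/

variable (T) in
/-- A complex with bases of its terms in which its differential has the matrix `T`. -/
structure Realization (P : CochainComplex (GrMod k n) ℤ) where
  basis : ∀ j, SqBasis (P.X j) (fun x : {x : T.B // T.dg x = j} => T.st x.1)
  coef_d : ∀ j j' x y,
    (basis j').coef y ((P.d j j').lin ((basis j).gen x)) = T.c x.1 y.1

namespace Realization

variable {P : CochainComplex (GrMod k n) ℤ} (R : T.Realization P)

/-- The coordinate at a generator, or zero if the generator does not belong to `P^j`. -/
def cf (j : ℤ) (x : T.B) : (P.X j).carrier →ₗ[k] k :=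
  if h : T.dg x = j then (R.basis j).coef ⟨x, h⟩ else 0

lemma cf_val {j : ℤ} (x : {x : T.B // T.dg x = j}) : R.cf j x.1 = (R.basis j).coef x := dif_pos x.2

lemma cf_eq_zero {j : ℤ} {x : T.B} (h : T.dg x ≠ j) : R.cf j x = 0 := dif_neg h

lemma sum_sub (j : ℤ) {V : Type*} [AddCommMonoid V] (f : T.B → V)
    (hf : ∀ x, T.dg x ≠ j → f x = 0) :
    ∑ x : {x : T.B // T.dg x = j}, f x.1 = ∑ x, f x :=
  Fintype.sum_of_injective (fun x : {x : T.B // T.dg x = j} => x.1) Subtype.val_injective _ _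
    (fun x hx => by_contra fun h => hx ⟨⟨x, by_contra fun h' => h (hf x h')⟩, rfl⟩) (fun _ => rfl)

lemma cf_d (j : ℤ) (y : T.B) (z : (P.X j).carrier) :
    R.cf (j + 1) y ((P.d j (j + 1)).lin z) = ∑ x, T.c x y * R.cf j x z := by
  rw [← sum_sub j]
  swap
  · intro x hx
    rw [R.cf_eq_zero hx, LinearMap.zero_apply, mul_zero]
  by_cases h : T.dg y = j + 1
  · rw [R.cf_val ⟨y, h⟩, (R.basis j).coef_lin (R.basis (j + 1))]
    simp only [R.coef_d, cf_val, mul_comm]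
  · rw [R.cf_eq_zero h, LinearMap.zero_apply, Finset.sum_eq_zero]
    intro x _
    by_contra h0
    have := T.dg_eq _ _ (left_ne_zero_of_mul h0)
    rw [x.2] at this
    exact h this

/-- The linear forms `cf j x`, as elements of the Alexander dual of `P^j`. -/
def alx (j : ℤ) {a : Deg n} (ha : 0 ≤ a) (x : T.B) : ((alexander k n).obj (op (P.X j))).carrier :=
  alexOf (P.X j) ha (R.cf j x ∘ₗ Submodule.subtype _)

lemma alx_mem (j : ℤ) {a : Deg n} (ha : 0 ≤ a) (x : T.B) :
    R.alx j ha x ∈ ((alexander k n).obj (op (P.X j))).gr a := alexOf_mem ha _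

lemma mon_smul_alx (j : ℤ) {a b : Deg n} (ha : 0 ≤ a) (h : a ≤ b) (x : T.B) :
    mon k a b • R.alx j ha x = R.alx j (ha.trans h) x := by
  rw [alx, mon_smul_alexOf ha h]
  congr 1
  ext z
  by_cases hx : T.dg x = j
  · rw [R.cf_val ⟨x, hx⟩]
    exact (R.basis j).coef_mon _ _ _ _
  · rw [R.cf_eq_zero hx]
    rfl

/-- The component of `S(-F)` in degree `(supp a)ᶜ` is zero when `F` meets `supp a`. This is the
identification of `𝐀(S(-F))` with `S/(x_l : l ∈ F)`. -/
lemma alx_eq_zero (j : ℤ) {a : Deg n} (ha : 0 ≤ a) (x : T.B)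
    (h : (T.st x ∩ Deg.supp a).Nonempty) : R.alx j ha x = 0 := by
  rw [alx]
  convert map_zero (alexOf (P.X j) ha)
  ext z
  by_cases hx : T.dg x = j
  · rw [R.cf_val ⟨x, hx⟩]
    refine (R.basis j).coef_eq_zero _ _ _ z.2 fun hle => ?_
    rw [ofFinset_le_ofFinset] at hle
    obtain ⟨i, hi⟩ := h
    rw [Finset.mem_inter] at hi
    exact (Finset.mem_compl.1 (hle hi.1)) hi.2
  · rw [R.cf_eq_zero hx]
    rfl

lemma map_d_alx (j : ℤ) {a : Deg n} (ha : 0 ≤ a) (y : T.B) :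
    ((alexander k n).map (P.d j (j + 1)).op).lin (R.alx (j + 1) ha y) =
      ∑ x, T.c x y • R.alx j ha x := by
  rw [alx, alexander_map_alexOf]
  simp only [alx, ← map_smul, ← map_sum]
  congr 1
  ext z
  rw [LinearMap.sum_apply]
  exact R.cf_d j y z

/-- The coordinate forms of the generators with `st x ⊆ (supp a)ᶜ` are a dual basis of the relevant
component of `P^j`; the coefficients are the values of the form on the corresponding monomial
multiples of generators. -/
lemma exists_eq_sum_alx (j : ℤ) {a : Deg n} (ha : 0 ≤ a)
    (z : ((alexander k n).obj (op (P.X j))).carrier)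
    (hz : z ∈ ((alexander k n).obj (op (P.X j))).gr a) :
    ∃ q : T.B → k, (∀ x, q x ≠ 0 → T.dg x = j) ∧ z = ∑ x, q x • R.alx j ha x := by
  classical
  obtain ⟨f, rfl⟩ := exists_alexOf ha z hz
  let b : Deg n := Deg.ofFinset (Deg.supp a)ᶜ
  let q (x : {x : T.B // T.dg x = j}) : k := if h : Deg.ofFinset (T.st x.1) ≤ b then
    f ⟨_, (P.X j).mon_smul_mem h ((R.basis j).gen_mem x)⟩ else 0
  refine ⟨fun x => if h : T.dg x = j then q ⟨x, h⟩ else 0, fun x hx => ?_, ?_⟩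
  · by_contra h
    exact hx (dif_neg h)
  · simp only [alx, ← map_smul, ← map_sum]
    congr 1
    ext z
    rw [LinearMap.sum_apply, ← sum_sub j _ (fun x hx => by rw [dif_neg hx, zero_smul]; rfl)]
    have hz : z = ∑ x, if h : Deg.ofFinset (T.st x.1) ≤ b then (R.basis j).coef x z.1 •
        (⟨_, (P.X j).mon_smul_mem h ((R.basis j).gen_mem x)⟩ : (P.X j).gr b) else 0 := by
      apply Subtype.ext
      conv_lhs => rw [(R.basis j).eq_sum z.1 z.2]
      rw [AddSubmonoidClass.coe_finsetSum]
      refine Finset.sum_congr rfl fun x _ => ?_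
      split_ifs <;> rfl
    conv_lhs => rw [hz, map_sum]
    refine Finset.sum_congr rfl fun x _ => ?_
    rw [dif_pos x.2]
    simp only [q]
    split_ifs with h
    · rw [map_smul, smul_eq_mul, LinearMap.smul_apply, smul_eq_mul, mul_comm, LinearMap.comp_apply,
        R.cf_val]
      rfl
    · rw [map_zero, zero_smul]
      rfl

lemma eq_zero_of_sum_alx (j : ℤ) {a : Deg n} (ha : 0 ≤ a) (q : T.B → k)
    (h : ∑ x, q x • R.alx j ha x = 0) (x : T.B) (hx : T.dg x = j) (hd : ¬ (T.st x ∩ Deg.supp a).Nonempty) :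
    q x = 0 := by
  classical
  simp only [alx, ← map_smul, ← map_sum] at h
  rw [← map_zero (alexOf (P.X j) ha)] at h
  have h1 := alexOf_injective ha h
  have hle : Deg.ofFinset (T.st x) ≤ Deg.ofFinset (Deg.supp a)ᶜ := by
    rw [ofFinset_le_ofFinset]
    intro i hi
    rw [Finset.mem_compl]
    exact fun hi' => hd ⟨i, Finset.mem_inter.2 ⟨hi, hi'⟩⟩
  have h2 := LinearMap.congr_fun h1
    ⟨_, (P.X j).mon_smul_mem hle ((R.basis j).gen_mem ⟨x, hx⟩)⟩
  rw [LinearMap.sum_apply, ← sum_sub j _ (fun x hx => by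
    rw [R.cf_eq_zero hx, LinearMap.zero_comp, smul_zero, LinearMap.zero_apply]),
    Finset.sum_eq_single ⟨x, hx⟩] at h2
  · rw [LinearMap.smul_apply, LinearMap.comp_apply, R.cf_val] at h2
    have h3 : (R.basis j).coef ⟨x, hx⟩ (mon k (Deg.ofFinset (T.st x))
        (Deg.ofFinset (Deg.supp a)ᶜ) • (R.basis j).gen ⟨x, hx⟩) = 1 := by
      rw [(R.basis j).coef_mon, (R.basis j).coef_gen_self]
    refine Eq.trans ?_ h2
    refine (mul_one (q x)).symm.trans (congrArg (q x * ·) h3.symm)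
  · intro y _ hy
    rw [LinearMap.smul_apply, LinearMap.comp_apply, R.cf_val]
    refine (congrArg (q y.1 * ·) ?_).trans (mul_zero _)
    refine ((R.basis j).coef_mon _ _ _ _).trans ?_
    exact (R.basis j).coef_gen_ne _ _ hy
  · simp

/-- The augmentation of the Koszul resolution in degree `m`. -/
def augF (m : ℤ) : T.kX m ⟶ (alexander k n).obj (op (P.X (-m))) :=
  (T.kB m).lift (fun p => if p.1.2 = ∅ then R.alx (-m) (ofFinset_nonneg p.1.2) p.1.1 else 0)
    (fun p => by
      split_ifs
      · exact R.alx_mem _ _ _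
      · exact Submodule.zero_mem _)

lemma augF_lin (m : ℤ) {a : Deg n} (ha : 0 ≤ a) (y : (T.kX m).carrier) (hy : y ∈ (T.kX m).gr a) :
    (R.augF m).lin y = ∑ x, qf y (x, ∅) • R.alx (-m) ha x := by
  classical
  rw [augF, (T.kB m).lift_lin _ _ y hy]
  refine Eq.trans (Fintype.sum_of_injective
    (fun x : {x : T.B // T.dg x = -m} => (⟨(x.1, ∅), by simp [tdeg, x.2]⟩ : T.KIdx m)) ?_
      (fun x => qf y (x.1, ∅) • R.alx (-m) ha x.1) _ ?_ ?_).symm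
    (sum_sub (-m) (fun x => qf y (x, ∅) • R.alx (-m) ha x) (fun x hx => by
      rw [qf, dif_neg (fun h => hx (by simpa [tdeg] using h.2)), zero_smul]))
  · intro x x' h
    exact Subtype.ext (congrArg (fun p : T.KIdx m => p.1.1) h)
  · intro p hp
    have : p.1.2 ≠ ∅ := by
      intro h0
      have h1 := p.2.2
      rw [tdeg, h0] at h1
      refine hp ⟨⟨p.1.1, by simpa using h1⟩, ?_⟩
      exact Subtype.ext (Prod.ext rfl h0.symm)
    rw [if_neg this, smul_zero, smul_zero, ite_self]
  · intro x
    have h0 : Deg.ofFinset (∅ : Finset (Fin n)) ≤ a := by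
      rw [ofFinset_le_iff ha]
      exact Finset.empty_subset _
    rw [if_pos rfl, if_pos h0, R.mon_smul_alx (-m) _ h0, ← qf_val]

/-- Only pairs with `H = ∅` are seen by the augmentation, and on them the `c`-part of the
differential is the dual of the differential of `P`. -/
lemma augF_comm (m : ℤ) (a : Deg n) (y : (T.kX m).carrier) (hy : y ∈ (T.kX m).gr a) :
    ((alexander k n).map (P.d (-(m + 1)) (-m)).op).lin ((R.augF m).lin y) =
      (R.augF (m + 1)).lin ((T.kd m (m + 1)).lin y) := by
  by_cases ha : 0 ≤ a
  swap
  · exact (alexander_eq_zero ha _ (Hom.map_mem _ a _ (Hom.map_mem _ a y hy))).trans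
      (alexander_eq_zero ha _ (Hom.map_mem _ a _ (Hom.map_mem _ a y hy))).symm
  rw [R.augF_lin m ha y hy, R.augF_lin (m + 1) ha _ ((T.kd m (m + 1)).map_mem a y hy), qf_kd]
  have hm : -m = -(m + 1) + 1 := by ring
  have key : ((alexander k n).map (P.d (-(m + 1)) (-m)).op).lin
      (∑ x, qf y (x, ∅) • R.alx (-m) ha x) =
      ∑ y', qf y (y', ∅) • ∑ x, T.c x y' • R.alx (-(m + 1)) ha x := by
    rw [map_sum]
    refine Finset.sum_congr rfl fun x _ => ?_
    refine ((((alexander k n).map (P.d (-(m + 1)) (-m)).op).lin.restrictScalars k).map_smul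
      _ _).trans (congrArg _ ?_)
    rw [← R.map_d_alx (-(m + 1)) ha x]
    generalize -m = j at hm
    subst hm
    rfl
  refine Eq.trans key ?_
  simp only [Finset.smul_sum, ← mul_smul]
  rw [Finset.sum_comm]
  refine Finset.sum_congr rfl fun x _ => ?_
  rw [← Finset.sum_smul]
  -- A Koszul arrow into `(x, ∅)` starts at a pair with a non-empty `H ⊆ st x ∩ supp a`, and then
  -- the form attached to `x` is zero.
  by_cases hx : (T.st x ∩ Deg.supp a).Nonempty
  · rw [R.alx_eq_zero _ ha x hx, smul_zero, smul_zero]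
  · congr 1
    rw [rowD_apply, sum_mul_dmat, Finset.sum_eq_zero (s := Finset.univ)
      (f := fun H => qf y (x, H) * koszul k H ∅)]
    · simp [mul_comm]
    · intro H _
      by_contra h0
      have h1 := qf_mem y hy _ (left_ne_zero_of_mul h0)
      have h2 := koszul_ne_zero (right_ne_zero_of_mul h0)
      have h3 := (ofFinset_le_iff ha).1 h1.2
      obtain ⟨i, hi⟩ : H.Nonempty := Finset.card_pos.1 (by omega)
      exact hx ⟨i, Finset.mem_inter.2 ⟨h1.1.1 hi, h3 hi⟩⟩

/-- The augmentation of the Koszul resolution. -/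
def aug : T.kComplex ⟶ alexanderComplex P where
  f := R.augF
  comm' m m' hm := by
    obtain rfl : m + 1 = m' := hm
    exact hom_ext_gr fun a y hy => R.augF_comm m a y hy

/-- In degree `a` the augmentation is onto, and its kernel is the row complex for `G = supp a`: if
`st x` misses `supp a`, only the pair `(x, ∅)` occurs and it maps to a basis vector. So
`row_acyclic` applies. -/
instance quasiIso_aug : QuasiIso R.aug := by
  refine quasiIso_of_gr _ (fun m a z hz => ?_)
    (fun m a (y : (T.kX (m + 1)).carrier) (hy : y ∈ (T.kX (m + 1)).gr a) h0 h1 => ?_)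
  · by_cases ha : 0 ≤ a
    swap
    · exact ⟨0, Submodule.zero_mem _, (map_zero _).trans (alexander_eq_zero ha z hz).symm⟩
    obtain ⟨q, hq, rfl⟩ := R.exists_eq_sum_alx (-m) ha z hz
    obtain ⟨y, hy, hy'⟩ := exists_qf (T := T) (m := m) (a := a)
      (fun p => if p.2 = ∅ then q p.1 else 0) (by
        intro p hp
        simp only at hp
        split_ifs at hp with h
        · rw [tdeg, h, ofFinset_le_iff ha]
          simp [hq _ hp]
        · exact absurd rfl hp)
    refine ⟨y, hy, (R.augF_lin m ha y hy).trans ?_⟩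
    rw [hy']
    simp
  · by_cases ha : 0 ≤ a
    swap
    · have hy0 : y = 0 := by
        refine (T.kB (m + 1)).eq_zero a y hy fun p => (T.kB (m + 1)).coef_eq_zero p a y hy ?_
        exact fun h => ha ((ofFinset_nonneg _).trans h)
      exact ⟨0, Submodule.zero_mem _, map_zero _, by rw [hy0]; exact map_zero _⟩
    have e1 : T.rowD (qf y) = 0 := by
      rw [← qf_kd]
      have : (T.kd (m + 1) (m + 1 + 1)).lin y = 0 := h0
      rw [this]
      ext p
      rw [qf]
      split_ifs
      · exact map_zero _
      · rfl
    have e2 := (R.augF_lin (m + 1) ha y hy).symm.trans h1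
    have e3 : qf y ∈ T.supported fun p => T.rowP (Deg.supp a) p ∧ T.tdeg p = -(m + 1) := by
      intro p hp
      obtain ⟨⟨h2, h3⟩, h4⟩ := qf_mem y hy p hp
      rw [ofFinset_le_iff ha] at h4
      refine ⟨⟨h2, h4, ?_⟩, h3⟩
      -- If `st x` misses `supp a`, then `H = ∅` and the coefficient is read off from the image
      -- under the augmentation, which is zero.
      by_contra h5
      have h6 : p.2 = ∅ := by
        rw [Finset.not_nonempty_iff_eq_empty] at h5
        rw [← Finset.subset_empty, ← h5]
        exact Finset.subset_inter h2 h4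
      have h7 : p = (p.1, ∅) := Prod.ext rfl h6
      rw [h7] at hp h3
      exact hp (R.eq_zero_of_sum_alx _ ha _ e2 p.1 (by simpa [tdeg] using h3) h5)
    obtain ⟨w, hw, hw'⟩ := row_acyclic _ e3 e1
    obtain ⟨z, hz, rfl⟩ := exists_qf (T := T) (m := m) (a := a) w (by
      refine supported_mono (fun p hp => ⟨⟨hp.1.1, ?_⟩, ?_⟩) hw
      · rw [hp.2]; ring
      · rw [ofFinset_le_iff ha]
        exact hp.1.2.1)
    refine ⟨z, hz, (R.augF_lin m ha z hz).trans ?_, ?_⟩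
    · refine Finset.sum_eq_zero fun x _ => ?_
      by_cases hx : qf z (x, ∅) = 0
      · rw [hx, zero_smul]
      · rw [R.alx_eq_zero _ ha x (hw _ hx).1.2.2, smul_zero]
    · exact eq_of_qf ((T.kd m (m + 1)).map_mem a z hz) hy ((qf_kd z).trans hw')

end Realization

end MinMatrix

end GrMod

/-! ### Contravariant functors applied to complexes -/

section ContraComplex

variable {C D : Type*} [Category* C] [Category* D]

/-- The morphism of complexes induced by a morphism, for a contravariant functor. -/
def contraMap [HasZeroMorphisms C] [HasZeroMorphisms D] (G : Cᵒᵖ ⥤ D) [G.PreservesZeroMorphisms]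
    {K L : CochainComplex C ℤ} (f : K ⟶ L) : contraComplex G L ⟶ contraComplex G K where
  f j := G.map (f.f (-j)).op
  comm' i j _ := by
    change G.map (f.f (-i)).op ≫ G.map (K.d (-j) (-i)).op =
      G.map (L.d (-j) (-i)).op ≫ G.map (f.f (-j)).op
    rw [← G.map_comp, ← G.map_comp, ← op_comp, ← op_comp, f.comm]

lemma contraMap_id [HasZeroMorphisms C] [HasZeroMorphisms D] (G : Cᵒᵖ ⥤ D)
    [G.PreservesZeroMorphisms] (K : CochainComplex C ℤ) :
    contraMap G (𝟙 K) = 𝟙 (contraComplex G K) := by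
  ext j
  exact G.map_id _

lemma contraMap_comp [HasZeroMorphisms C] [HasZeroMorphisms D] (G : Cᵒᵖ ⥤ D)
    [G.PreservesZeroMorphisms] {K L M : CochainComplex C ℤ} (f : K ⟶ L) (g : L ⟶ M) :
    contraMap G (f ≫ g) = contraMap G g ≫ contraMap G f := by
  ext j
  exact G.map_comp (g.f (-j)).op (f.f (-j)).op

/-- The homotopy induced by a homotopy, for an additive contravariant functor. -/
def contraHomotopy [Preadditive C] [Preadditive D] (G : Cᵒᵖ ⥤ D) [G.Additive]
    {K L : CochainComplex C ℤ} {f g : K ⟶ L} (h : Homotopy f g) :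
    Homotopy (contraMap G f) (contraMap G g) where
  hom i j := G.map (h.hom (-j) (-i)).op
  zero i j hij := (congrArg (fun φ => G.map φ.op) (h.zero (-j) (-i) fun h' =>
    hij (by simp only [ComplexShape.up_Rel] at h' ⊢; omega))).trans (G.map_zero _ _)
  comm j := by
    have h1 := h.comm (-j)
    rw [dNext_eq h.hom (show (ComplexShape.up ℤ).Rel (-j) (-(j - 1)) by simp; ring),
      prevD_eq h.hom (show (ComplexShape.up ℤ).Rel (-(j + 1)) (-j) by simp)] at h1
    let H (i j : ℤ) : (contraComplex G L).X i ⟶ (contraComplex G K).X j :=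
      G.map (h.hom (-j) (-i)).op
    refine Eq.trans ?_ (congrArg (· + (contraMap G g).f j) (congrArg₂ (· + ·)
      (dNext_eq H (show (ComplexShape.up ℤ).Rel j (j + 1) by simp))
      (prevD_eq H (show (ComplexShape.up ℤ).Rel (j - 1) j by simp))).symm)
    change G.map (f.f (-j)).op = G.map (L.d (-(j + 1)) (-j)).op ≫ G.map (h.hom (-j) (-(j + 1))).op +
      G.map (h.hom (-(j - 1)) (-j)).op ≫ G.map (K.d (-j) (-(j - 1))).op + G.map (g.f (-j)).op
    rw [h1, op_add, op_add, G.map_add, G.map_add, op_comp, op_comp, G.map_comp, G.map_comp]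
    abel

/-- Homotopy equivalent complexes have isomorphic cohomology after application of an additive
contravariant functor. -/
def contraHomologyIso [Preadditive C] [Preadditive D] [CategoryWithHomology D]
    (G : Cᵒᵖ ⥤ D) [G.Additive]
    {K L : CochainComplex C ℤ} (e : HomotopyEquiv K L) (i : ℤ) :
    (contraComplex G L).homology i ≅ (contraComplex G K).homology i where
  hom := HomologicalComplex.homologyMap (contraMap G e.hom) i
  inv := HomologicalComplex.homologyMap (contraMap G e.inv) i
  hom_inv_id := by
    rw [← HomologicalComplex.homologyMap_comp, ← contraMap_comp,
      (contraHomotopy G e.homotopyInvHomId).homologyMap_eq, contraMap_id,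
      HomologicalComplex.homologyMap_id]
  inv_hom_id := by
    rw [← HomologicalComplex.homologyMap_comp, ← contraMap_comp,
      (contraHomotopy G e.homotopyHomInvId).homologyMap_eq, contraMap_id,
      HomologicalComplex.homologyMap_id]

/-- Around degree `j` the new complex is the image under `G` of the opposite of the three-term piece
of the old one around `-j`, and `G` preserves its homology. -/
lemma quasiIso_contraMap [Abelian C] [Abelian D] (G : Cᵒᵖ ⥤ D) [G.PreservesZeroMorphisms]
    [G.PreservesHomology] {K L : CochainComplex C ℤ} (f : K ⟶ L) [QuasiIso f] :
    QuasiIso (contraMap G f) := by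
  rw [quasiIso_iff]
  intro j
  rw [quasiIsoAt_iff' (contraMap G f) (j - 1) j (j + 1) (by simp) (by simp)]
  have h1 : QuasiIsoAt f (-j) := inferInstance
  rw [quasiIsoAt_iff' f (-(j + 1)) (-j) (-(j - 1)) (by simp; omega)
    (by simp; omega)] at h1
  have h2 := (ShortComplex.quasiIso_opMap_iff _).2 h1
  exact ShortComplex.quasiIso_map_of_preservesLeftHomology G
    (ShortComplex.opMap ((HomologicalComplex.shortComplexFunctor' C (.up ℤ)
      (-(j + 1)) (-j) (-(j - 1))).map f))

/-- Out of a K-projective complex, derived morphisms are homotopy classes. So the derived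
isomorphism through `X` is represented by an actual map, which is then a quasi-isomorphism between
K-projective complexes. -/
lemma homotopyEquiv_of_isKProjective {C : Type*} [Category* C] [Abelian C]
    {K L X : CochainComplex C ℤ} [K.IsKProjective] [L.IsKProjective] (f : K ⟶ X) (g : L ⟶ X)
    [QuasiIso f] [QuasiIso g] : Nonempty (HomotopyEquiv K L) := by
  let := HasDerivedCategory.standard C
  obtain ⟨h, hh⟩ := (CochainComplex.IsKProjective.Qh_map_bijective K
    ((HomotopyCategory.quotient C (.up ℤ)).obj L)).surjective
      ((DerivedCategory.quotientCompQhIso C).hom.app K ≫ DerivedCategory.Q.map f ≫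
        inv (DerivedCategory.Q.map g) ≫ (DerivedCategory.quotientCompQhIso C).inv.app L)
  obtain ⟨h, rfl⟩ := (HomotopyCategory.quotient C (.up ℤ)).map_surjective h
  have : IsIso (DerivedCategory.Q.map h) := by
    have h1 : DerivedCategory.Q.map h = (DerivedCategory.quotientCompQhIso C).inv.app K ≫
        DerivedCategory.Qh.map ((HomotopyCategory.quotient C (.up ℤ)).map h) ≫
          (DerivedCategory.quotientCompQhIso C).hom.app L := by
      have := (DerivedCategory.quotientCompQhIso C).hom.naturality h
      dsimp at this
      rw [this]
      simp
    rw [h1, hh]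
    infer_instance
  have : QuasiIso h := by
    rwa [← DerivedCategory.isIso_Q_map_iff_quasiIso]
  obtain ⟨e, -⟩ := (CochainComplex.IsKProjective.quasiIso_iff h).1 this
  exact ⟨e⟩

end ContraComplex

namespace GrMod

variable {k : Type u} [Field k] {n : ℕ}

instance (N : GrMod k n) : ((gHom k n).flip.obj N).Additive where
  map_add {M M' f g} := hom_ext_gr fun a y hy => by
    obtain ⟨φ, rfl⟩ := exists_gHomOf (M := M.unop) y hy
    refine (gHom_map_gHomOf (f + g).unop φ).trans ?_
    refine Eq.trans ?_ (congrArg₂ (· + ·) (gHom_map_gHomOf f.unop φ) (gHom_map_gHomOf g.unop φ)).symm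
    rw [← map_add, unop_add, Preadditive.add_comp]

/-! ### K-projectivity of the Koszul resolution. -/

namespace MinMatrix

variable (T : MinMatrix k n)

instance (m : ℤ) : Projective (T.kComplex.X m) := (T.kB m).projective

lemma exists_isStrictlyLE : ∃ b : ℤ, T.kComplex.IsStrictlyLE b := by
  obtain ⟨b, hb⟩ := (Set.finite_range fun p : T.J => -T.tdeg p).bddAbove
  refine ⟨b, (CochainComplex.isStrictlyLE_iff _ _).2 fun m hm => ?_⟩
  refine isZero_iff_gr.2 fun a y hy => (T.kB m).eq_zero a y hy fun p => ?_
  have h1 : -T.tdeg p.1 ≤ b := hb ⟨p.1, rfl⟩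
  have h2 := p.2.2
  omega

instance : T.kComplex.IsKProjective := by
  obtain ⟨b, hb⟩ := T.exists_isStrictlyLE
  exact CochainComplex.isKProjective_of_projective _ b

variable {T}

/-! ### The cohomology of `Hom_S(Q, ω_S)` for the Koszul resolution `Q` -/

/-- Evaluation at `(1, …, 1)` forgets the monomial factors, so a map to a shift of `ω_S` becomes a
linear form in the coordinates. -/
lemma evalOne_lin {m : ℤ} {a : Deg n} (φ : T.kX m ⟶ (canonical k n).shift a)
    (y : (T.kX m).carrier) : evalOne k n (φ.lin y) =
      ∑ p, (T.kB m).coef p y * evalOne k n (φ.lin ((T.kB m).gen p)) := by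
  classical
  refine (T.kX m).gr_induction (p := fun y => evalOne k n (φ.lin y) =
      ∑ p, (T.kB m).coef p y * evalOne k n (φ.lin ((T.kB m).gen p))) y ?_ ?_ ?_
  · intro b y hy
    conv_lhs => rw [(T.kB m).eq_sum y hy, map_sum]
    refine (map_sum (evalOne k n) _ _).trans (Finset.sum_congr rfl fun p _ => ?_)
    split_ifs with h
    · refine (congrArg (evalOne k n) ((φ.lin.restrictScalars k).map_smul _ _)).trans ?_
      refine (map_smul (evalOne k n) _ _).trans (congrArg _ ?_)
      refine (congrArg (evalOne k n) (φ.lin.map_smul _ _)).trans ?_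
      refine (map_mul (evalOne k n) _ _).trans ?_
      rw [evalOne_mon, one_mul]
    · rw [(T.kB m).coef_eq_zero p b y hy h, zero_mul]
      exact (congrArg (evalOne k n) (map_zero φ.lin)).trans (map_zero _)
  · simp only [map_zero, zero_mul, Finset.sum_const_zero]
    exact map_zero (evalOne k n)
  · intro y z hy hz
    refine (congrArg (evalOne k n) (map_add φ.lin y z)).trans ?_
    refine (map_add (evalOne k n) _ _).trans ?_
    rw [hy, hz, ← Finset.sum_add_distrib]
    simp only [map_add, add_mul]

open Classical in
/-- The values of a morphism to a shift of `ω_S` on the generators of the Koszul resolution. -/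
def uf {m : ℤ} {a : Deg n} : (T.kX m ⟶ (canonical k n).shift a) →ₗ[k] (T.J → k) where
  toFun φ p := if h : p.2 ⊆ T.st p.1 ∧ T.tdeg p = -m then
    evalOne k n (φ.lin ((T.kB m).gen ⟨p, h⟩)) else 0
  map_add' φ ψ := by
    ext p
    rw [Pi.add_apply]
    split_ifs
    · exact map_add (evalOne k n) _ _
    · rw [add_zero]
  map_smul' r φ := by
    ext p
    simp only [Pi.smul_apply, RingHom.id_apply]
    split_ifs
    · exact map_smul (evalOne k n) _ _
    · rw [smul_zero]

lemma uf_val {m : ℤ} {a : Deg n} (φ : T.kX m ⟶ (canonical k n).shift a) (p : T.KIdx m) :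
    uf φ p.1 = evalOne k n (φ.lin ((T.kB m).gen p)) := dif_pos p.2

lemma uf_eq_zero {m : ℤ} {a : Deg n} (φ : T.kX m ⟶ (canonical k n).shift a) {p : T.J}
    (h : ¬ (p.2 ⊆ T.st p.1 ∧ T.tdeg p = -m)) : uf φ p = 0 := dif_neg h

variable (T) in
/-- The functions that are values of morphisms to `ω_S(a)` on generators of total degree `i`. -/
def colU (a : Deg n) (i : ℤ) : Submodule k (T.J → k) :=
  T.supported fun p => (p.2 ⊆ T.st p.1 ∧ T.tdeg p = i) ∧
    Deg.ofFinset Finset.univ ≤ a + Deg.ofFinset p.2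

/-- The generator `(x, H)` goes to the component of `ω_S` in degree `a + H`, which is non-zero only
above `(1, …, 1)`. Together with `uf_injective` and `exists_uf` this identifies the maps in degree
`a` with cochains of the column complex. -/
lemma uf_mem {i m : ℤ} (hm : m = -i) {a : Deg n} (φ : T.kX m ⟶ (canonical k n).shift a) :
    uf φ ∈ T.colU a i := by
  subst hm
  intro p hp
  by_cases h : p.2 ⊆ T.st p.1 ∧ T.tdeg p = - -i
  · rw [uf_val φ ⟨p, h⟩] at hp
    refine ⟨⟨h.1, by rw [h.2]; ring⟩, ?_⟩
    by_contra h1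
    have h2 := φ.map_mem _ _ ((T.kB (-i)).gen_mem ⟨p, h⟩)
    exact hp ((congrArg (evalOne k n) (free_eq_zero h1 _ h2)).trans (map_zero _))
  · exact absurd (uf_eq_zero φ h) hp

lemma uf_injective {m : ℤ} {a : Deg n} :
    Function.Injective (uf (T := T) (m := m) (a := a)) := by
  rw [injective_iff_map_eq_zero]
  intro φ h
  refine (T.kB m).hom_ext fun p => ?_
  have h1 := congrFun h p.1
  rw [uf_val] at h1
  exact free_eq_zero_of_evalOne _ (φ.map_mem _ _ ((T.kB m).gen_mem p)) h1

lemma exists_uf {i m : ℤ} (hm : m = -i) {a : Deg n} {u : T.J → k} (hu : u ∈ T.colU a i) :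
    ∃ φ : T.kX m ⟶ (canonical k n).shift a, uf φ = u := by
  subst hm
  have hmem (p : T.KIdx (-i)) : ∃ y ∈ ((canonical k n).shift a).gr (Deg.ofFinset p.1.2),
      evalOne k n y = u p.1 := by
    by_cases h : u p.1 = 0
    · exact ⟨0, Submodule.zero_mem _, (map_zero (evalOne k n)).trans h.symm⟩
    · have h1 := (hu p.1 h).2
      refine ⟨u p.1 • (mon k (Deg.ofFinset Finset.univ) (a + Deg.ofFinset p.1.2) •
        (1 : MvPolynomial (Fin n) k)), Submodule.smul_mem _ _ ?_, ?_⟩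
      · exact (free k Finset.univ).mon_smul_mem h1 (one_mem_free _)
      · refine (map_smul (evalOne k n) _ _).trans ?_
        rw [smul_eq_mul, smul_eq_mul, map_mul, evalOne_mon, map_one, one_mul, mul_one]
  choose v hv hv' using hmem
  refine ⟨(T.kB (-i)).lift v hv, ?_⟩
  ext p
  by_cases h : p.2 ⊆ T.st p.1 ∧ T.tdeg p = - -i
  · rw [uf_val _ ⟨p, h⟩, (T.kB (-i)).lift_gen, hv']
  · rw [uf_eq_zero _ h]
    exact (apply_eq_zero hu fun h' => h ⟨h'.1.1, by rw [h'.1.2]; ring⟩).symm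

lemma uf_kd_comp {m m' : ℤ} (hm : m + 1 = m') {a : Deg n}
    (φ : T.kX m' ⟶ (canonical k n).shift a) : uf (T.kd m m' ≫ φ) = T.colD (uf φ) := by
  ext p
  by_cases hp : p.2 ⊆ T.st p.1
  swap
  · rw [uf_eq_zero _ fun h => hp h.1]
    exact (if_neg hp).symm
  rw [T.colD_apply hp]
  by_cases h : T.tdeg p = -m
  · rw [uf_val _ ⟨p, hp, h⟩, comp_lin, LinearMap.comp_apply, evalOne_lin]
    simp only [coef_kd_gen, ← uf_val]
    refine T.sum_kIdx m' (fun p' => T.dmat p p' * uf φ p') fun p' h' => ?_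
    by_contra h1
    exact right_ne_zero_of_mul h' (uf_eq_zero φ h1)
  · rw [uf_eq_zero _ fun h' => h h'.2, Finset.sum_eq_zero]
    intro p' _
    by_contra h0
    have h1 := (T.dmat_ne_zero (left_ne_zero_of_mul h0)).2.2
    refine right_ne_zero_of_mul h0 (uf_eq_zero φ fun h2 => h ?_)
    have := h2.2
    omega

/-- Monomials evaluate to `1`, so multiplication is the inclusion of one column complex in another;
the whole `S`-structure of Ext comes from this. -/
lemma uf_shiftMul {m : ℤ} {a b : Deg n} (h : a ≤ b) (φ : T.kX m ⟶ (canonical k n).shift a) :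
    uf (φ ≫ shiftMul _ h) = uf φ := by
  ext p
  by_cases hp : p.2 ⊆ T.st p.1 ∧ T.tdeg p = -m
  · rw [uf_val _ ⟨p, hp⟩, uf_val _ ⟨p, hp⟩]
    refine (map_mul (evalOne k n) _ _).trans ?_
    rw [evalOne_mon, one_mul]
  · rw [uf_eq_zero _ hp, uf_eq_zero _ hp]

variable (T) in
/-- A description of a graded module as the cohomology of the column complexes: the pairs in
`rep a` consist of a cocycle and the element of degree `a` that it represents. -/
structure ExtModel (i : ℤ) (N : GrMod k n) where
  rep : Deg n → Submodule k ((T.J → k) × N.carrier)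
  mem_colU : ∀ {a u η}, (u, η) ∈ rep a → u ∈ T.colU a i
  colD_eq : ∀ {a u η}, (u, η) ∈ rep a → T.colD u = 0
  mem_gr : ∀ {a u η}, (u, η) ∈ rep a → η ∈ N.gr a
  exists_class : ∀ {a u}, u ∈ T.colU a i → T.colD u = 0 → ∃ η, (u, η) ∈ rep a
  exists_cocycle : ∀ {a η}, η ∈ N.gr a → ∃ u, (u, η) ∈ rep a
  eq_zero_iff : ∀ {a u η}, (u, η) ∈ rep a → (η = 0 ↔ ∃ w ∈ T.colU a (i - 1), T.colD w = u)
  mon_smul : ∀ {a b u η}, a ≤ b → (u, η) ∈ rep a → (u, (mon k a b • η : N.carrier)) ∈ rep b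

/-- Transport of a description along an isomorphism. -/
def ExtModel.ofIso {i : ℤ} {N N' : GrMod k n} (X : T.ExtModel i N) (e : N ≅ N') :
    T.ExtModel i N' where
  rep a := (X.rep a).comap (LinearMap.prodMap LinearMap.id (e.inv.lin.restrictScalars k))
  mem_colU h := X.mem_colU h
  colD_eq h := X.colD_eq h
  mem_gr {a u η} h := by
    have h1 := e.hom.map_mem a _ (X.mem_gr h)
    have h2 := congrArg (fun f => Hom.lin f η) e.inv_hom_id
    have h3 : e.hom.lin (e.inv.lin η) = η := h2
    rw [← h3]
    exact h1
  exists_class {a u} hu h0 := by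
    obtain ⟨η, hη⟩ := X.exists_class hu h0
    refine ⟨e.hom.lin η, ?_⟩
    have h3 : e.inv.lin (e.hom.lin η) = η := congrArg (fun f => Hom.lin f η) e.hom_inv_id
    change (u, e.inv.lin (e.hom.lin η)) ∈ X.rep a
    rwa [h3]
  exists_cocycle {a η} hη := X.exists_cocycle (e.inv.map_mem a η hη)
  eq_zero_iff {a u η} h := by
    have h1 : e.inv.lin η = 0 ↔ _ := X.eq_zero_iff h
    refine Iff.trans ?_ h1
    exact ((lin_injective_of_isIso e.inv).eq_iff' (map_zero _)).symm
  mon_smul {a b u η} hab h := by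
    have h1 := X.mon_smul hab h
    change (u, e.inv.lin (mon k a b • η)) ∈ X.rep b
    rw [map_smul]
    exact h1

variable (T) in
/-- The complex `Hom_S(Q, ω_S)`. -/
abbrev kHom : CochainComplex (GrMod k n) ℤ :=
  contraComplex ((gHom k n).flip.obj (canonical k n)) T.kComplex

lemma kHom_d (i j : ℤ) {a : Deg n} (φ : T.kX (-i) ⟶ (canonical k n).shift a) :
    ((kHom T).d i j).lin (gHomOf (T.kX (-i)) (canonical k n) a φ) =
      gHomOf (T.kX (-j)) (canonical k n) a (T.kd (-j) (-i) ≫ φ) :=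
  gHom_map_gHomOf (T.kd (-j) (-i)) φ

variable (T) in
/-- The cohomology of `Hom_S(Q, ω_S)` in terms of the column complexes. -/
def extModel (i : ℤ) : T.ExtModel i ((kHom T).homology i) where
  rep a :=
    { carrier := {x | ∃ z ∈ ((kHom T).cycles i).gr a, ((kHom T).homologyπ i).lin z = x.2 ∧
        ∃ φ : T.kX (-i) ⟶ (canonical k n).shift a,
          gHomOf (T.kX (-i)) (canonical k n) a φ = ((kHom T).iCycles i).lin z ∧ uf φ = x.1}
      zero_mem' := ⟨0, Submodule.zero_mem _, map_zero _, 0, by rw [map_zero, map_zero]; rfl, map_zero _⟩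
      add_mem' := by
        rintro ⟨u, η⟩ ⟨v, θ⟩ ⟨z, hz, rfl, φ, hφ, rfl⟩ ⟨z', hz', rfl, φ', hφ', rfl⟩
        refine ⟨z + z', Submodule.add_mem _ hz hz', map_add _ _ _, φ + φ', ?_, map_add _ _ _⟩
        rw [map_add, map_add, hφ, hφ']
        rfl
      smul_mem' := by
        rintro r ⟨u, η⟩ ⟨z, hz, rfl, φ, hφ, rfl⟩
        refine ⟨r • z, Submodule.smul_mem _ _ hz,
          (((kHom T).homologyπ i).lin.restrictScalars k).map_smul r z, r • φ, ?_, map_smul _ _ _⟩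
        rw [map_smul, hφ]
        exact ((((kHom T).iCycles i).lin.restrictScalars k).map_smul r z).symm }
  mem_colU := by
    rintro a u η ⟨z, hz, rfl, φ, hφ, rfl⟩
    exact uf_mem rfl φ
  colD_eq := by
    rintro a u η ⟨z, hz, rfl, φ, hφ, rfl⟩
    have h1 := d_iCycles (kHom T) i z
    have h2 := (congrArg ((kHom T).d i (i + 1)).lin hφ).trans h1
    have h3 := gHomOf_injective a (((kHom_d i (i + 1) φ).symm.trans h2).trans (map_zero (gHomOf _ _ a)).symm)
    rw [← uf_kd_comp (m := -(i + 1)) (by ring), h3]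
    exact map_zero _
  mem_gr := by
    rintro a u η ⟨z, hz, rfl, φ, hφ, rfl⟩
    exact Hom.map_mem _ a z hz
  exists_class := by
    intro a u hu h0
    obtain ⟨φ, rfl⟩ := exists_uf (m := -i) rfl hu
    have h1 : T.kd (-(i + 1)) (-i) ≫ φ = 0 := by
      apply uf_injective
      rw [uf_kd_comp (by ring), h0, map_zero]
    obtain ⟨z, hz, hz'⟩ := exists_cycle (kHom T) i a (gHomOf _ _ a φ) (gHomOf_mem φ)
      ((kHom_d i (i + 1) φ).trans (by rw [h1]; exact map_zero _))
    exact ⟨_, z, hz, rfl, φ, hz'.symm, rfl⟩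
  exists_cocycle := by
    intro a η hη
    obtain ⟨z, hz, rfl⟩ := exists_cycle_of_homology (kHom T) i a η hη
    obtain ⟨φ, hφ⟩ := exists_gHomOf (M := T.kX (-i)) (N := canonical k n)
      (((kHom T).iCycles i).lin z) (((kHom T).iCycles i).map_mem a z hz)
    exact ⟨_, z, hz, rfl, φ, hφ, rfl⟩
  eq_zero_iff := by
    rintro a u η ⟨z, hz, rfl, φ, hφ, rfl⟩
    rw [homologyπ_eq_zero_iff (kHom T) i a z hz]
    constructor
    · rintro ⟨w, hw, hw'⟩
      obtain ⟨ψ, rfl⟩ := exists_gHomOf (M := T.kX (-(i - 1))) (N := canonical k n) w hw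
      refine ⟨uf ψ, uf_mem rfl ψ, ?_⟩
      rw [← uf_kd_comp (m := -i) (by ring),
        gHomOf_injective a (((kHom_d (i - 1) i ψ).symm.trans hw').trans hφ.symm)]
    · rintro ⟨w, hw, hw'⟩
      obtain ⟨ψ, rfl⟩ := exists_uf (m := -(i - 1)) rfl hw
      refine ⟨gHomOf _ _ a ψ, gHomOf_mem ψ, ?_⟩
      refine (kHom_d (i - 1) i ψ).trans (Eq.trans (congrArg _ ?_) hφ)
      apply uf_injective
      rw [uf_kd_comp (by ring), hw']
  mon_smul := by
    rintro a b u η hab ⟨z, hz, rfl, φ, hφ, rfl⟩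
    refine ⟨mon k a b • z, mon_smul_mem _ hab hz, map_smul _ _ _, φ ≫ shiftMul _ hab, ?_,
      uf_shiftMul hab φ⟩
    rw [← mon_smul_gHomOf, hφ, map_smul]
    rfl

end MinMatrix

/-- For `a ≥ 0` the inequality can fail only at an index with `a_i = 0` and `i ∉ H`. -/
lemma univ_le_iff {a : Deg n} (ha : 0 ≤ a) (H : Finset (Fin n)) :
    Deg.ofFinset Finset.univ ≤ a + Deg.ofFinset H ↔ (Deg.supp a)ᶜ ⊆ H := by
  rw [Deg.le_def]
  constructor
  · intro h i hi
    have h1 := h i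
    rw [Deg.add_apply, Deg.ofFinset_apply, Deg.ofFinset_apply, if_pos (Finset.mem_univ i)] at h1
    rw [Finset.mem_compl, Deg.mem_supp] at hi
    by_contra h2
    rw [if_neg h2] at h1
    omega
  · intro h i
    rw [Deg.add_apply, Deg.ofFinset_apply, Deg.ofFinset_apply, if_pos (Finset.mem_univ i)]
    have h0 := Deg.le_def.1 ha i
    rw [Deg.zero_apply] at h0
    by_cases h2 : i ∈ H
    · rw [if_pos h2]
      omega
    · have h3 : i ∈ Deg.supp a := by
        by_contra h4
        exact h2 (h (Finset.mem_compl.2 h4))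
      rw [Deg.mem_supp] at h3
      rw [if_neg h2]
      omega

lemma nonneg_of_univ_le {a : Deg n} {H : Finset (Fin n)}
    (h : Deg.ofFinset Finset.univ ≤ a + Deg.ofFinset H) : 0 ≤ a := Deg.le_def.2 fun i => by
  have h1 := Deg.le_def.1 h i
  rw [Deg.add_apply, Deg.ofFinset_apply, Deg.ofFinset_apply, if_pos (Finset.mem_univ i)] at h1
  rw [Deg.zero_apply]
  split_ifs at h1 <;> omega

/-! ### Bases of Ext and the multiplication by variables. -/

namespace MinMatrix

variable (T : MinMatrix k n)

/-- A description of a squarefree module `N` by bases of its components: the generators `x` with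
`st x = F` and `dg x = i - |F|` give a basis of the component of degree `Fᶜ`, and the
multiplication by a variable is given by the linear part of the matrix `T`. -/
structure StrandModel (i : ℤ) (N : GrMod k n) where
  v : T.B → N.carrier
  eq_zero : ∀ a : Deg n, ¬ 0 ≤ a → ∀ y ∈ N.gr a, y = 0
  bijective : ∀ (a b : Deg n) (h : a ≤ b), 0 ≤ a → Deg.supp b = Deg.supp a →
    Function.Bijective (N.mulMap h)
  v_mem : ∀ x, v x ∈ N.gr (Deg.ofFinset (T.st x)ᶜ)
  span : ∀ F, ∀ y ∈ N.gr (Deg.ofFinset Fᶜ), ∃ t : T.B → k,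
    (∀ x, t x ≠ 0 → T.st x = F ∧ T.dg x + (T.st x).card = i) ∧ y = ∑ x, t x • v x
  indep : ∀ F, ∀ t : T.B → k, (∀ x, t x ≠ 0 → T.st x = F ∧ T.dg x + (T.st x).card = i) →
    ∑ x, t x • v x = 0 → t = 0
  mul : ∀ x, T.dg x + (T.st x).card = i → ∀ l ∈ T.st x,
    (mon k (Deg.ofFinset (T.st x)ᶜ) (Deg.ofFinset ((T.st x).erase l)ᶜ) • v x : N.carrier) =
      ((koszulSign l (T.st x) : ℤ) : k) •
        ∑ y, (if T.st y = (T.st x).erase l then T.c x y else 0) • v y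

variable {T}

/-- The cochains depend on `a` only through its support, which makes the multiplications between
degrees with the same support bijective on Ext. -/
lemma colU_eq {a : Deg n} (ha : 0 ≤ a) (i : ℤ) : T.colU a i = T.supported fun p =>
    ((Deg.supp a)ᶜ ⊆ p.2 ∧ p.2 ⊆ T.st p.1) ∧ T.tdeg p = i := by
  rw [colU]
  congr 1
  ext p
  rw [univ_le_iff ha]
  tauto

lemma colU_ofFinset (F : Finset (Fin n)) (i : ℤ) : T.colU (Deg.ofFinset Fᶜ) i =
    T.supported fun p => (F ⊆ p.2 ∧ p.2 ⊆ T.st p.1) ∧ T.tdeg p = i := by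
  rw [colU_eq (ofFinset_nonneg _), supp_ofFinset, compl_compl]

namespace ExtModel

variable {i : ℤ} {N : GrMod k n} (X : T.ExtModel i N)

lemma eq_of_rep {a : Deg n} {u u' : T.J → k} {η η' : N.carrier} (h : (u, η) ∈ X.rep a)
    (h' : (u', η') ∈ X.rep a) (hw : ∃ w ∈ T.colU a (i - 1), T.colD w = u - u') : η = η' :=
  sub_eq_zero.1 ((X.eq_zero_iff (Submodule.sub_mem _ h h')).2 hw)

/-- The pair `(x, st x)` lies in the bottom step of the filtration for `F = st x`, where every
cochain is a cocycle. -/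
lemma single_mem (x : T.B) (hx : T.dg x + (T.st x).card = i) :
    ∃ η, ((Pi.single (x, T.st x) 1 : T.J → k), η) ∈ X.rep (Deg.ofFinset (T.st x)ᶜ) := by
  have h1 : (Pi.single (x, T.st x) 1 : T.J → k) ∈
      T.supported fun p => (p.2 = T.st x ∧ T.st p.1 = T.st x) ∧ T.tdeg p = i := by
    intro p hp
    obtain rfl : p = (x, T.st x) := by
      by_contra h
      exact hp (Pi.single_eq_of_ne h 1)
    exact ⟨⟨rfl, rfl⟩, hx⟩
  refine X.exists_class ?_ (colD_eq_zero (mem_colW_zero.2 (supported_mono (fun _ h => h.1) h1)))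
  rw [colU_ofFinset]
  refine supported_mono (fun p hp => ⟨?_, hp.2⟩) h1
  rw [hp.1.1, hp.1.2]
  exact ⟨Finset.Subset.refl _, Finset.Subset.refl _⟩

/-- The class of the cocycle given by a generator. -/
def genClass (x : T.B) : N.carrier :=
  if hx : T.dg x + (T.st x).card = i then (X.single_mem x hx).choose else 0

lemma genClass_rep (x : T.B) (hx : T.dg x + (T.st x).card = i) :
    ((Pi.single (x, T.st x) 1 : T.J → k), X.genClass x) ∈ X.rep (Deg.ofFinset (T.st x)ᶜ) := by
  rw [genClass, dif_pos hx]
  exact (X.single_mem x hx).choose_spec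

lemma genClass_mem (x : T.B) : X.genClass x ∈ N.gr (Deg.ofFinset (T.st x)ᶜ) := by
  by_cases hx : T.dg x + (T.st x).card = i
  · exact X.mem_gr (X.genClass_rep x hx)
  · rw [genClass, dif_neg hx]
    exact Submodule.zero_mem _

lemma comb_rep (F : Finset (Fin n)) (t : T.B → k)
    (ht : ∀ x, t x ≠ 0 → T.st x = F ∧ T.dg x + (T.st x).card = i) :
    ((fun p => if p.2 = F then t p.1 else 0 : T.J → k), ∑ x, t x • X.genClass x) ∈
      X.rep (Deg.ofFinset Fᶜ) := by
  have h1 : ∀ x, t x • ((Pi.single (x, F) 1 : T.J → k), X.genClass x) ∈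
      X.rep (Deg.ofFinset Fᶜ) := by
    intro x
    by_cases h0 : t x = 0
    · rw [h0, zero_smul]
      exact Submodule.zero_mem _
    · obtain ⟨rfl, hd⟩ := ht x h0
      exact Submodule.smul_mem _ _ (X.genClass_rep x hd)
  have h2 := Submodule.sum_mem _ fun x (_ : x ∈ Finset.univ) => h1 x
  convert h2 using 1
  refine Prod.ext ?_ ?_
  · ext p
    rw [Prod.fst_sum, Finset.sum_apply]
    simp only [Prod.smul_mk, Pi.smul_apply, smul_eq_mul]
    obtain ⟨y, H⟩ := p
    simp only [Pi.single_apply, Prod.mk.injEq, mul_ite, mul_one, mul_zero]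
    by_cases hH : H = F
    · simp [hH]
    · simp [hH]
  · rw [Prod.snd_sum]
    rfl

/-- With `F = st x`, the coboundary of `(x, F \ {l})` has a Koszul component at `(x, F)` and
components at `(y, F \ {l})` given by `c x y`. The factors `(-1)^|H|` in both parts of the matrix
differ by `-1` here, so `(x, F)` becomes cohomologous to the second part with the Koszul sign alone.
-/
lemma colD_single (x : T.B) (l : Fin n) (hl : l ∈ T.st x) :
    T.colD (Pi.single (x, (T.st x).erase l) ((-1) ^ (T.st x).card * ((koszulSign l (T.st x) : ℤ) : k))) =
      Pi.single (x, T.st x) 1 - fun p : T.J => if p.2 = (T.st x).erase l then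
        ((koszulSign l (T.st x) : ℤ) : k) *
          (if T.st p.1 = (T.st x).erase l then T.c x p.1 else 0) else 0 := by
  set F := T.st x with hF
  set F' := F.erase l with hF'
  have hcard : F'.card + 1 = F.card := Finset.card_erase_add_one hl
  have hss : F' ⊆ F := Finset.erase_subset _ _
  have hne : F' ≠ F := fun h => by rw [h] at hcard; omega
  have sq : ((koszulSign l F : ℤ) : k) * ((koszulSign l F : ℤ) : k) = 1 := by
    rw [← Int.cast_mul, koszulSign_mul_self, Int.cast_one]
  have sq' := neg_one_pow_mul_self (k := k) F'.card
  have hs : (-1 : k) ^ F.card = -(-1) ^ F'.card := by rw [← hcard, pow_succ]; ring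
  ext ⟨y, H⟩
  rw [Pi.sub_apply]
  by_cases hp : H ⊆ T.st y
  · rw [T.colD_apply hp, Finset.sum_eq_single (x, F') (fun p _ h => by
      rw [Pi.single_eq_of_ne h, mul_zero]) (by simp), Pi.single_eq_same]
    simp only [dmat]
    by_cases hH : H = F'
    · rw [hH] at hp ⊢
      have hk : koszul k F' F' = 0 := by
        by_contra h6
        have := (koszul_ne_zero h6).2
        omega
      -- A non-zero entry needs `F \ {l} ⊆ st y ⊂ F`, which leaves only `st y = F \ {l}`: only the
      -- linear part of `c` contributes.
      have h3 : (if T.st y = F' then T.c x y else 0) = T.c x y := by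
        split_ifs with h4
        · rfl
        · by_contra h5
          have h6 := T.st_ssubset x y (Ne.symm h5)
          have h7 := Finset.card_lt_card h6
          rw [← hF] at h7
          exact h4 (Finset.eq_of_subset_of_card_le hp (by omega)).symm
      rw [hk, if_pos rfl, if_pos rfl, ite_self, Pi.single_eq_of_ne, h3, hs]
      · linear_combination (-(T.c x y) * ((koszulSign l F : ℤ) : k)) * sq'
      · exact fun h => hne (congrArg Prod.snd h)
    · rw [if_neg hH, if_neg hH]
      by_cases hy : y = x
      · subst hy
        rw [if_pos rfl]
        by_cases hHF : H = F
        · rw [hHF, hF', koszul_erase hl, Pi.single_eq_same]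
          have := neg_one_pow_mul_self (k := k) F.card
          linear_combination this + (-1) ^ F.card * (-1) ^ F.card * sq
        · have hk : koszul k H F' = 0 := by
            by_contra h6
            have h7 := koszul_ne_zero h6
            exact hHF (Finset.eq_of_subset_of_card_le hp (by omega))
          rw [hk, Pi.single_eq_of_ne (fun h => hHF (congrArg Prod.snd h))]
          ring
      · rw [if_neg hy, Pi.single_eq_of_ne (fun h => hy (congrArg Prod.fst h))]
        ring
  · have h1 : (y, H) ≠ (x, F) := by
      rintro h
      obtain ⟨rfl, rfl⟩ := Prod.mk.inj h
      exact hp (Finset.Subset.refl _)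
    rw [Pi.single_eq_of_ne h1]
    refine (if_neg hp).trans ?_
    split_ifs with h2 h3
    · exact absurd (show H ⊆ T.st y by rw [h3]; exact h2.subset) hp
    · ring
    · ring

/-- The bases of the components of the cohomology of the column complexes. -/
def strandModel : T.StrandModel i N where
  v := X.genClass
  eq_zero a ha y hy := by
    obtain ⟨u, hu⟩ := X.exists_cocycle hy
    refine (X.eq_zero_iff hu).2 ⟨0, Submodule.zero_mem _, ?_⟩
    rw [map_zero]
    ext p
    by_contra h
    exact ha (nonneg_of_univ_le (X.mem_colU hu p (Ne.symm h)).2)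
  bijective a b h ha hs := by
    -- Cocycles and coboundaries in degrees `a` and `b` are literally the same functions, so
    -- multiplication is a bijection of classes.
    have hU (j : ℤ) : T.colU a j = T.colU b j := by
      rw [colU_eq ha, colU_eq (ha.trans h), hs]
    constructor
    · refine (injective_iff_map_eq_zero _).2 fun y hy => ?_
      obtain ⟨u, hu⟩ := X.exists_cocycle y.2
      have h1 := (X.eq_zero_iff (X.mon_smul h hu)).1 (congrArg Subtype.val hy)
      rw [← hU] at h1
      exact Subtype.ext ((X.eq_zero_iff hu).2 h1)
    · intro z
      obtain ⟨u, hu⟩ := X.exists_cocycle z.2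
      have h1 := X.mem_colU hu
      rw [← hU] at h1
      obtain ⟨η, hη⟩ := X.exists_class h1 (X.colD_eq hu)
      refine ⟨⟨η, X.mem_gr hη⟩, Subtype.ext ?_⟩
      exact X.eq_of_rep (X.mon_smul h hη) hu
        ⟨0, Submodule.zero_mem _, by rw [map_zero, sub_self]⟩
  v_mem := X.genClass_mem
  span F y hy := by
    obtain ⟨u, hu⟩ := X.exists_cocycle hy
    have h1 := X.mem_colU hu
    rw [colU_ofFinset] at h1
    obtain ⟨w, hw, hw'⟩ := exists_col_rep i h1 (X.colD_eq hu)
    let t (x : T.B) : k := (u - T.colD w) (x, F)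
    have ht (x : T.B) (hx : t x ≠ 0) : T.st x = F ∧ T.dg x + (T.st x).card = i := by
      obtain ⟨⟨-, h2⟩, h3⟩ := hw' _ hx
      refine ⟨h2, ?_⟩
      have h4 : T.st x = F := h2
      rw [h4]
      exact h3
    refine ⟨t, ht, X.eq_of_rep hu (X.comb_rep F t ht) ⟨w, ?_, ?_⟩⟩
    · rwa [colU_ofFinset]
    · ext p
      rw [Pi.sub_apply]
      split_ifs with hp
      · have : p = (p.1, F) := Prod.ext rfl hp
        simp only [t, Pi.sub_apply, ← this, sub_sub_cancel]
      · have h2 := apply_eq_zero hw' (p := p) fun h => hp h.1.1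
        rw [Pi.sub_apply] at h2
        rw [sub_zero, sub_eq_zero.1 h2]
  indep F t ht h0 := by
    obtain ⟨w, hw, hw'⟩ := (X.eq_zero_iff (X.comb_rep F t ht)).1 h0
    rw [colU_ofFinset] at hw
    -- A vanishing combination of the classes is a coboundary supported on pairs with `H = F = st
    -- x`, hence zero as a function.
    have h1 := col_rep_unique (F := F) (supported_mono (fun _ h => h.1) hw) (by
      rw [hw']
      intro p hp
      simp only at hp
      split_ifs at hp with h
      · exact ⟨h, (ht _ hp).1⟩
      · exact absurd rfl hp)
    rw [hw'] at h1
    ext x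
    have h2 := congrFun h1 (x, F)
    simpa using h2
  mul x hx l hl := by
    have hle : Deg.ofFinset (T.st x)ᶜ ≤ Deg.ofFinset ((T.st x).erase l)ᶜ :=
      Deg.ofFinset_mono (Finset.compl_subset_compl.2 (Finset.erase_subset _ _))
    have h1 := X.mon_smul hle (X.genClass_rep x hx)
    have h2 := X.comb_rep ((T.st x).erase l) (fun y => ((koszulSign l (T.st x) : ℤ) : k) *
      (if T.st y = (T.st x).erase l then T.c x y else 0)) (by
        intro y hy
        have h3 := right_ne_zero_of_mul hy
        split_ifs at h3 with h4
        · refine ⟨h4, ?_⟩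
          have h5 := T.dg_eq _ _ h3
          have h6 := Finset.card_erase_add_one hl
          rw [← h4] at h6
          omega
        · exact absurd rfl h3)
    -- The bounding cochain sits at `(x, st x \ {l})`, which becomes admissible only after
    -- multiplication by `x_l`.
    refine (X.eq_of_rep h1 h2 ⟨_, ?_, colD_single x l hl⟩).trans ?_
    · rw [colU_ofFinset]
      intro p hp
      obtain rfl : p = (x, (T.st x).erase l) := by
        by_contra h
        exact hp (Pi.single_eq_of_ne h _)
      refine ⟨⟨Finset.Subset.refl _, Finset.erase_subset _ _⟩, ?_⟩
      have h6 := Finset.card_erase_add_one hl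
      rw [tdeg]
      simp only
      omega
    · rw [Finset.smul_sum]
      simp only [mul_smul]

end ExtModel

end MinMatrix

/-! ### Homogeneous elements of injective hulls -/

section Hull

/-- The homogeneous element of degree `a` of `*E(S/P_F)` given by a scalar. -/
def hullOf (F : Finset (Fin n)) (a : Deg n) : k →ₗ[k] (injHull k F).carrier :=
  totOf (hullDiag k F) a ∘ₗ (hullSub k F a).mkQ

lemma hullOf_mem (F : Finset (Fin n)) (a : Deg n) (c : k) :
    hullOf F a c ∈ (injHull k F).gr a :=
  totOf_mem (hullDiag k F) a _

lemma exists_hullOf {F : Finset (Fin n)} {a : Deg n} (y : (injHull k F).carrier)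
    (hy : y ∈ (injHull k F).gr a) : ∃ c, hullOf F a c = y := by
  obtain ⟨v, rfl⟩ := exists_totOf (hullDiag k F) a y hy
  obtain ⟨c, rfl⟩ := Submodule.Quotient.mk_surjective (hullSub k F a) v
  exact ⟨c, rfl⟩

lemma hullOf_eq_zero {F : Finset (Fin n)} {a : Deg n} (h : ¬ Deg.supp a ⊆ F) (c : k) :
    hullOf F a c = 0 := by
  have : (hullSub k F a).mkQ c = 0 := by
    rw [Submodule.mkQ_apply, Submodule.Quotient.mk_eq_zero]
    exact fun h' => absurd h' h
  exact (congrArg (totOf (hullDiag k F) a) this).trans (map_zero _)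

lemma mon_smul_hullOf (F : Finset (Fin n)) {a b : Deg n} (h : a ≤ b) (c : k) :
    mon k a b • hullOf F a c = hullOf F b c :=
  mon_smul_totOf (hullDiag k F) h _

lemma hullMap_hullOf {F G : Finset (Fin n)} (h : G ⊆ F) (a : Deg n) (c : k) :
    (hullMap k h).lin (hullOf F a c) = hullOf G a c :=
  tot_map_totOf (hullNat k h) a _

/-- The scalar of a component of `*E(S/P_F)`. -/
def hullScalar (k : Type u) [Field k] {n : ℕ} (F : Finset (Fin n)) (a : Deg n) :
    (k ⧸ hullSub k F a) →ₗ[k] k :=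
  if h : Deg.supp a ⊆ F then (hullSub k F a).liftQ LinearMap.id (fun _ hc => hc h) else 0

/-- The linear form on `*E(S/P_F)` sending the natural basis elements to `1`. -/
def hullEval (F : Finset (Fin n)) : (injHull k F).carrier →ₗ[k] k :=
  DirectSum.toModule k (Deg n) k (hullScalar k F)

lemma hullEval_hullOf {F : Finset (Fin n)} {a : Deg n} (h : Deg.supp a ⊆ F) (c : k) :
    hullEval F (hullOf F a c) = c := by
  refine (DirectSum.toModule_lof k (φ := hullScalar k F) a _).trans ?_
  rw [hullScalar, dif_pos h]
  rfl

lemma eq_zero_of_hullEval {F : Finset (Fin n)} {a : Deg n} {y : (injHull k F).carrier}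
    (hy : y ∈ (injHull k F).gr a) (h : Deg.supp a ⊆ F → hullEval F y = 0) : y = 0 := by
  obtain ⟨c, rfl⟩ := exists_hullOf y hy
  by_cases ha : Deg.supp a ⊆ F
  · have := h ha
    rw [hullEval_hullOf ha] at this
    rw [this, map_zero]
  · exact hullOf_eq_zero ha c

lemma hullEval_mon_smul {F : Finset (Fin n)} {a b : Deg n} (h : a ≤ b) (hb : Deg.supp b ⊆ F)
    {y : (injHull k F).carrier} (hy : y ∈ (injHull k F).gr a) :
    hullEval F (mon k a b • y) = hullEval F y := by
  obtain ⟨c, rfl⟩ := exists_hullOf y hy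
  rw [mon_smul_hullOf F h, hullEval_hullOf hb, hullEval_hullOf ((Deg.supp_mono h).trans hb)]

lemma hullEval_hullMap {F G : Finset (Fin n)} (h : G ⊆ F) {a : Deg n} (ha : Deg.supp a ⊆ G)
    {y : (injHull k F).carrier} (hy : y ∈ (injHull k F).gr a) :
    hullEval G ((hullMap k h).lin y) = hullEval F y := by
  obtain ⟨c, rfl⟩ := exists_hullOf y hy
  rw [hullMap_hullOf, hullEval_hullOf ha, hullEval_hullOf (ha.trans h)]

end Hull

/-! ### Modules determined by supports and their maps to injective hulls. -/

lemma mon_add_right (a b c : Deg n) : mon k (a + c) (b + c) = mon k a b := by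
  rw [mon, mon, add_sub_add_right_eq_sub]

lemma mon_add_left (a b c : Deg n) : mon k (c + a) (c + b) = mon k a b := by
  rw [mon, mon, add_sub_add_left_eq_sub]

lemma add_le_add_deg {a b : Deg n} (h : a ≤ b) (c : Deg n) : c + a ≤ c + b :=
  Deg.le_def.2 fun i => by
    rw [Deg.add_apply, Deg.add_apply]
    have := Deg.le_def.1 h i
    omega

lemma supp_add {a b : Deg n} (ha : 0 ≤ a) (hb : 0 ≤ b) :
    Deg.supp (a + b) = Deg.supp a ∪ Deg.supp b := by
  ext i
  have h1 := Deg.le_def.1 ha i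
  have h2 := Deg.le_def.1 hb i
  simp only [Finset.mem_union, Deg.mem_supp, Deg.add_apply, Deg.zero_apply] at h1 h2 ⊢
  omega

/-- The componentwise maximum of a degree and a squarefree vector. -/
def supFinset (a : Deg n) (F : Finset (Fin n)) : Deg n :=
  fun i => max (a.coord i) ((Deg.ofFinset F).coord i)

lemma supFinset_apply (a : Deg n) (F : Finset (Fin n)) (i : Fin n) :
    (supFinset a F).coord i = max (a.coord i) ((Deg.ofFinset F).coord i) := rfl

lemma le_supFinset (a : Deg n) (F : Finset (Fin n)) : a ≤ supFinset a F :=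
  Deg.le_def.2 fun _ => le_max_left _ _

lemma ofFinset_le_supFinset (a : Deg n) (F : Finset (Fin n)) : Deg.ofFinset F ≤ supFinset a F :=
  Deg.le_def.2 fun _ => le_max_right _ _

lemma supFinset_mono {a b : Deg n} (h : a ≤ b) (F : Finset (Fin n)) :
    supFinset a F ≤ supFinset b F :=
  Deg.le_def.2 fun i => max_le_max_right _ (Deg.le_def.1 h i)

lemma supp_supFinset {a : Deg n} {F : Finset (Fin n)} (h : Deg.supp a ⊆ F) :
    Deg.supp (supFinset a F) = F := by
  ext i
  have h1 := @h i
  rw [Deg.mem_supp] at h1 ⊢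
  rw [supFinset_apply, Deg.ofFinset_apply]
  split_ifs with h2
  · simp [h2]
  · have h3 : ¬ 0 < a.coord i := fun h => h2 (h1 h)
    simp [h2]
    omega

/-- A module that vanishes outside of `ℕⁿ`, and whose components in degrees in `ℕⁿ` depend only
on the support of the degree. -/
structure SuppDetermined (N : GrMod k n) : Prop where
  eq_zero : ∀ a : Deg n, ¬ 0 ≤ a → ∀ y ∈ N.gr a, y = 0
  bijective : ∀ (a b : Deg n) (h : a ≤ b), 0 ≤ a → Deg.supp b = Deg.supp a →
    Function.Bijective (N.mulMap h)

lemma mulMap_mulMap (N : GrMod k n) {a b c : Deg n} (h : a ≤ b) (h' : b ≤ c) (y : N.gr a) :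
    N.mulMap h' (N.mulMap h y) = N.mulMap (h.trans h') y :=
  Subtype.ext (by rw [coe_mulMap, coe_mulMap, coe_mulMap, ← mul_smul, mon_mul h h'])

namespace SuppDetermined

variable {N : GrMod k n} (hN : N.SuppDetermined)

/-- For `supp a ⊆ F` the degree `a` need not lie below the vector of `F`. The join of the two lies
above both and has support `F`, so inverting this bijection gives a map `N_a → N_F`. -/
lemma bijective_supFinset (hN : N.SuppDetermined) {a : Deg n} {F : Finset (Fin n)}
    (h : Deg.supp a ⊆ F) : Function.Bijective (N.mulMap (ofFinset_le_supFinset a F)) :=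
  hN.bijective _ _ _ (ofFinset_nonneg F) ((supp_supFinset h).trans (supp_ofFinset F).symm)

/-- Multiplication `N_a → N_F` along `supp a ⊆ F`. -/
def toSq {a : Deg n} {F : Finset (Fin n)} (h : Deg.supp a ⊆ F) :
    N.gr a →ₗ[k] N.gr (Deg.ofFinset F) :=
  (LinearEquiv.ofBijective _ (hN.bijective_supFinset h)).symm.toLinearMap ∘ₗ
    N.mulMap (le_supFinset a F)

lemma mulMap_toSq {a : Deg n} {F : Finset (Fin n)} (h : Deg.supp a ⊆ F) (y : N.gr a) :
    N.mulMap (ofFinset_le_supFinset a F) (hN.toSq h y) = N.mulMap (le_supFinset a F) y :=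
  LinearEquiv.apply_symm_apply (LinearEquiv.ofBijective _ (hN.bijective_supFinset h)) _

lemma toSq_mulMap {a b : Deg n} {F : Finset (Fin n)} (h : a ≤ b) (hb : Deg.supp b ⊆ F)
    (y : N.gr a) : hN.toSq hb (N.mulMap h y) = hN.toSq ((Deg.supp_mono h).trans hb) y := by
  apply (hN.bijective_supFinset hb).1
  rw [mulMap_toSq, ← mulMap_mulMap N (ofFinset_le_supFinset a F) (supFinset_mono h F),
    mulMap_toSq, mulMap_mulMap, mulMap_mulMap]

lemma toSq_self {F : Finset (Fin n)} (h : Deg.supp (Deg.ofFinset F) ⊆ F)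
    (y : N.gr (Deg.ofFinset F)) : hN.toSq h y = y := by
  apply (hN.bijective_supFinset h).1
  rw [mulMap_toSq]

lemma supp_add_subset {F : Finset (Fin n)} {a b : Deg n} (hb : 0 ≤ b) (hbF : Deg.supp b ⊆ F)
    (ha : 0 ≤ a) (h : Deg.supp a ⊆ F) : Deg.supp (b + a) ⊆ F := by
  rw [supp_add hb ha]
  exact Finset.union_subset hbF h

/-- A linear form on the component `N_F` comes from a morphism to a shift of `*E(S/P_F)`. -/
lemma exists_hom_injHull (hN : N.SuppDetermined) {F : Finset (Fin n)} {b : Deg n} (hb : 0 ≤ b)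
    (hbF : Deg.supp b ⊆ F) (f : N.gr (Deg.ofFinset F) →ₗ[k] k) :
    ∃ φ : N ⟶ (injHull k F).shift b, ∀ y : N.gr (Deg.ofFinset F),
      hullEval F (φ.lin y) = f y := by
  -- The form on `N_F` is transported to every `N_a` with `supp a ⊆ F`. For other `a ≥ 0` the target
  -- vanishes in degree `b + a`, and for `a ≱ 0` the source vanishes, so the value `0` is forced.
  let g (a : Deg n) : N.gr a →ₗ[k] ((injHull k F).shift b).gr a :=
    if h : Deg.supp a ⊆ F then
      LinearMap.codRestrict ((injHull k F).gr (b + a)) (hullOf F (b + a) ∘ₗ f ∘ₗ hN.toSq h)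
        (fun _ => hullOf_mem _ _ _)
    else 0
  have hg {a : Deg n} (h : Deg.supp a ⊆ F) (y : N.gr a) :
      (g a y).1 = hullOf F (b + a) (f (hN.toSq h y)) := by
    have h1 : g a = LinearMap.codRestrict ((injHull k F).gr (b + a))
        (hullOf F (b + a) ∘ₗ f ∘ₗ hN.toSq h) (fun _ => hullOf_mem _ _ _) := dif_pos h
    rw [h1]
    rfl
  refine ⟨homOfComponents g ?_, fun y => ?_⟩
  · intro a c h y
    by_cases ha : 0 ≤ a
    swap
    · obtain rfl : y = 0 := Subtype.ext (hN.eq_zero a ha y.1 y.2)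
      simp only [map_zero]
    by_cases hc : Deg.supp c ⊆ F
    · refine Subtype.ext ((hg hc _).trans ?_)
      rw [toSq_mulMap hN h hc, coe_mulMap, hg ((Deg.supp_mono h).trans hc), ← mon_add_left a c b]
      exact (mon_smul_hullOf F (add_le_add_deg h b) _).symm
    · have h1 : ¬ Deg.supp (b + c) ⊆ F := by
        rw [supp_add hb (ha.trans h)]
        exact fun h2 => hc (Finset.union_subset_right h2)
      have h2 (z : ((injHull k F).shift b).gr c) : z = 0 :=
        Subtype.ext (eq_zero_of_hullEval (a := b + c) z.2 (fun h => absurd h h1))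
      rw [h2 (g c _), h2 (mulMap _ _ _)]
  · have hF : Deg.supp (Deg.ofFinset F) ⊆ F := (supp_ofFinset F).subset
    refine (congrArg (hullEval F) (homOfComponents_lin g _ _ y)).trans ?_
    refine (congrArg (hullEval F) (hg hF y)).trans ?_
    rw [hullEval_hullOf (supp_add_subset hb hbF (ofFinset_nonneg F) hF), toSq_self]

/-- A morphism to a shift of `*E(S/P_F)` is determined by a linear form on `N_F`. -/
lemma hom_injHull_eq_zero (hN : N.SuppDetermined) {F : Finset (Fin n)} {b : Deg n} (hb : 0 ≤ b)
    (φ : N ⟶ (injHull k F).shift b)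
    (hφ : Deg.supp b ⊆ F → ∀ y : N.gr (Deg.ofFinset F), hullEval F (φ.lin y) = 0) : φ = 0 := by
  refine hom_ext_gr fun a y hy => ?_
  by_cases ha : 0 ≤ a
  swap
  · rw [hN.eq_zero a ha y hy, map_zero, map_zero]
  refine eq_zero_of_hullEval (φ.map_mem a y hy) fun hs => ?_
  rw [supp_add hb ha] at hs
  have haF := Finset.union_subset_right hs
  have hbF := Finset.union_subset_left hs
  have hs' : Deg.supp (b + supFinset a F) ⊆ F :=
    supp_add_subset hb hbF (ha.trans (le_supFinset a F)) (supp_supFinset haF).subset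
  -- Passing through the join of `a` and `F` does not change the evaluation, since the support of
  -- its sum with `b` stays inside `F`.
  have key {c : Deg n} (hc : c ≤ supFinset a F) (z : N.gr c) :
      hullEval F (φ.lin (N.mulMap hc z)) = hullEval F (φ.lin z) := by
    rw [coe_mulMap, map_smul, ← mon_add_left c _ b]
    exact hullEval_mon_smul (add_le_add_deg hc b) hs' (φ.map_mem c z z.2)
  rw [← key (le_supFinset a F) ⟨y, hy⟩, ← hN.mulMap_toSq haF, key (ofFinset_le_supFinset a F)]
  exact hφ hbF _

end SuppDetermined

/-! ### Evaluations on the dualizing complex. -/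

section Omega

variable (p : ℤ) (G : Finset (Fin n))

/-- The projection of `ω^p` to a summand. -/
def omegaπ (k : Type u) [Field k] {n : ℕ} (p : ℤ) (G : {F : Finset (Fin n) // (F.card : ℤ) = -p}) :
    (dualizingComplex k n).X p ⟶ injHull k G.1 :=
  biproduct.π (fun F : {F : Finset (Fin n) // (F.card : ℤ) = -p} => injHull k F.1) G

/-- The inclusion of a summand in `ω^p`. -/
def omegaι (k : Type u) [Field k] {n : ℕ} (p : ℤ) (G : {F : Finset (Fin n) // (F.card : ℤ) = -p}) :
    injHull k G.1 ⟶ (dualizingComplex k n).X p :=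
  biproduct.ι (fun F : {F : Finset (Fin n) // (F.card : ℤ) = -p} => injHull k F.1) G

lemma omega_hom_ext {N : GrMod k n} {b : Deg n} {p : ℤ}
    {φ : N ⟶ ((dualizingComplex k n).X p).shift b}
    (h : ∀ G, φ ≫ shiftMap (omegaπ k p G) b = 0) : φ = 0 := by
  refine hom_ext (LinearMap.ext fun y => ?_)
  have h1 : ∑ G, omegaπ k p G ≫ omegaι k p G = 𝟙 ((dualizingComplex k n).X p) :=
    biproduct.total (f := fun F : {F : Finset (Fin n) // (F.card : ℤ) = -p} => injHull k F.1)
  have h2 := congrArg (fun f : (dualizingComplex k n).X p ⟶ _ =>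
    linHom f (show ((dualizingComplex k n).X p).carrier from φ.lin y)) h1
  rw [map_sum, LinearMap.sum_apply] at h2
  refine h2.symm.trans (Finset.sum_eq_zero fun G _ => ?_)
  have h3 : (omegaπ k p G).lin (φ.lin y) = 0 := congrArg (fun f => Hom.lin f y) (h G)
  exact (congrArg (omegaι k p G).lin h3).trans (map_zero _)

lemma d_omegaπ {p : ℤ} (q : ℤ) (G : {F : Finset (Fin n) // (F.card : ℤ) = -q}) :
    (dualizingComplex k n).d p q ≫ omegaπ k q G =
      ∑ F, omegaπ k p F ≫ omegaComp k F.1 G.1 := by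
  refine (biproduct.matrix_π _ _).trans ?_
  rw [biproduct.desc_eq]
  rfl

/-- The linear form `hullEval` on the summand `*E(S/P_G)` of `ω^p`, and `0` if there is no such
summand. -/
def omegaEval : ((dualizingComplex k n).X p).carrier →ₗ[k] k :=
  if h : (G.card : ℤ) = -p then hullEval G ∘ₗ (omegaπ k p ⟨G, h⟩).lin.restrictScalars k else 0

variable {p G}

lemma omegaEval_apply (h : (G.card : ℤ) = -p) (y : ((dualizingComplex k n).X p).carrier) :
    omegaEval p G y = hullEval G ((omegaπ k p ⟨G, h⟩).lin y) := by
  rw [omegaEval, dif_pos h]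
  rfl

lemma omegaEval_of_ne (h : (G.card : ℤ) ≠ -p) (y : ((dualizingComplex k n).X p).carrier) :
    omegaEval p G y = 0 := by
  rw [omegaEval, dif_neg h]
  rfl

lemma omegaEval_mon_smul {a b : Deg n} (h : a ≤ b) (hb : Deg.supp b ⊆ G)
    {y : ((dualizingComplex k n).X p).carrier} (hy : y ∈ ((dualizingComplex k n).X p).gr a) :
    omegaEval p G (mon k a b • y) = omegaEval p G y := by
  by_cases hG : (G.card : ℤ) = -p
  · rw [omegaEval_apply hG, omegaEval_apply hG, map_smul]
    exact hullEval_mon_smul h hb (Hom.map_mem _ _ _ hy)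
  · rw [omegaEval_of_ne hG, omegaEval_of_ne hG]

lemma omegaEval_omegaι_self (h : (G.card : ℤ) = -p) (y : (injHull k G).carrier) :
    omegaEval p G ((omegaι k p ⟨G, h⟩).lin y) = hullEval G y := by
  rw [omegaEval_apply h]
  exact congrArg (hullEval G) (congrArg (fun f => Hom.lin f y) (biproduct.ι_π_self
    (fun F : {F : Finset (Fin n) // (F.card : ℤ) = -p} => injHull k F.1) ⟨G, h⟩))

lemma omegaEval_omegaι_ne {F : {F : Finset (Fin n) // (F.card : ℤ) = -p}} (h : F.1 ≠ G)
    (y : (injHull k F.1).carrier) : omegaEval p G ((omegaι k p F).lin y) = 0 := by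
  by_cases hG : (G.card : ℤ) = -p
  · rw [omegaEval_apply hG]
    refine (congrArg (hullEval G) (congrArg (fun f => Hom.lin f y) (biproduct.ι_π_ne
      (fun F : {F : Finset (Fin n) // (F.card : ℤ) = -p} => injHull k F.1)
      (j := F) (j' := ⟨G, hG⟩) fun h' => h (congrArg Subtype.val h')))).trans ?_
    exact map_zero _
  · exact omegaEval_of_ne hG _

lemma hullEval_omegaComp {F : Finset (Fin n)} {a : Deg n} (ha : Deg.supp a ⊆ G)
    {y : (injHull k F).carrier} (hy : y ∈ (injHull k F).gr a) :
    hullEval G ((omegaComp k F G).lin y) = (incidence F G : k) * hullEval F y := by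
  by_cases h : G ⊆ F
  · rw [omegaComp, dif_pos h]
    have h1 : Hom.lin (incidence F G • hullMap k h) y = incidence F G • (hullMap k h).lin y := rfl
    rw [h1, map_zsmul, hullEval_hullMap h ha hy, zsmul_eq_mul]
  · rw [omegaComp, dif_neg h, incidence_eq_zero (F := F) (G := G)
      (fun j _ hj => h (hj ▸ Finset.erase_subset j F)),
      Int.cast_zero, zero_mul]
    exact map_zero _

/-- Natural surjections preserve the evaluation in degrees with support in `G`, so only the
incidence numbers remain. Sets `F` of the wrong cardinality contribute zero, which allows a sum over
all `F`. -/
lemma omegaEval_d (q : ℤ) (hG : (G.card : ℤ) = -q) {a : Deg n}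
    (ha : Deg.supp a ⊆ G) {y : ((dualizingComplex k n).X p).carrier}
    (hy : y ∈ ((dualizingComplex k n).X p).gr a) :
    omegaEval q G (((dualizingComplex k n).d p q).lin y) =
      ∑ F, (incidence F G : k) * omegaEval p F y := by
  have h1 : (omegaπ k q ⟨G, hG⟩).lin (((dualizingComplex k n).d p q).lin y) =
      ∑ F, (omegaComp k F.1 G).lin ((omegaπ k p F).lin y) := by
    have h2 := congrArg (fun f => linHom f y) (d_omegaπ (k := k) (p := p) q ⟨G, hG⟩)
    rw [map_sum, LinearMap.sum_apply] at h2
    exact h2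
  rw [omegaEval_apply hG, h1, map_sum]
  have h3 (F : {F : Finset (Fin n) // (F.card : ℤ) = -p}) :
      hullEval G ((omegaComp k F.1 G).lin ((omegaπ k p F).lin y)) =
        (incidence F.1 G : k) * omegaEval p F.1 y := by
    rw [hullEval_omegaComp ha (Hom.map_mem _ _ _ hy), omegaEval_apply F.2]
  rw [Finset.sum_congr rfl fun F _ => h3 F,
    ← Finset.sum_subtype (Finset.univ.filter fun F => (F.card : ℤ) = -p) (by simp)
      (fun F => (incidence F G : k) * omegaEval p F y)]
  refine Finset.sum_subset (Finset.subset_univ _) fun F _ hF => ?_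
  rw [omegaEval_of_ne (by simpa using hF), mul_zero]

end Omega

/-! ### Linear forms on maps to the dualizing complex. -/

namespace MinMatrix

variable {T : MinMatrix k n}

namespace StrandModel

variable {i : ℤ} {N : GrMod k n} (X : T.StrandModel i N)

lemma suppDetermined (X : T.StrandModel i N) : N.SuppDetermined := ⟨X.eq_zero, X.bijective⟩

/-- The linear form on `Hom(N, ω^p(H))` given by evaluation at a generator. -/
def homForm (p : ℤ) (H : Finset (Fin n)) (x : T.B) :
    (N ⟶ ((dualizingComplex k n).X p).shift (Deg.ofFinset H)) →ₗ[k] k where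
  toFun φ := omegaEval p (T.st x)ᶜ (φ.lin (X.v x))
  map_add' _ _ := map_add (omegaEval (k := k) p (T.st x)ᶜ) _ _
  map_smul' c _ := map_smul (omegaEval (k := k) p (T.st x)ᶜ) c _

lemma homForm_apply (p : ℤ) (H : Finset (Fin n)) (x : T.B)
    (φ : N ⟶ ((dualizingComplex k n).X p).shift (Deg.ofFinset H)) :
    X.homForm p H x φ = omegaEval p (T.st x)ᶜ (φ.lin (X.v x)) := rfl

lemma supp_ofFinset_add {F G H : Finset (Fin n)} (hF : F ⊆ H) (hG : G ⊆ H) :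
    Deg.supp (Deg.ofFinset F + Deg.ofFinset G) ⊆ H := by
  rw [supp_add (ofFinset_nonneg F) (ofFinset_nonneg G), supp_ofFinset, supp_ofFinset]
  exact Finset.union_subset hF hG

/-- A map to `ω^p(H)` amounts to a linear form on each `N_G` with `|G| = -p` and `H ⊆ G`, and `N_G`
is spanned by the `v x` with `st x = Gᶜ` and `dg x + |st x| = i`. -/
lemma eq_zero_of_homForm {p : ℤ} {H : Finset (Fin n)}
    (φ : N ⟶ ((dualizingComplex k n).X p).shift (Deg.ofFinset H))
    (h : ∀ x, T.dg x + (T.st x).card = i → ((T.st x)ᶜ.card : ℤ) = -p → H ⊆ (T.st x)ᶜ →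
      X.homForm p H x φ = 0) : φ = 0 := by
  refine omega_hom_ext fun G => ?_
  refine X.suppDetermined.hom_injHull_eq_zero (ofFinset_nonneg H) _ fun hH y => ?_
  rw [supp_ofFinset] at hH
  obtain ⟨F, hF⟩ : ∃ F, F = G.1ᶜ := ⟨_, rfl⟩
  have hG : G.1 = Fᶜ := by rw [hF, compl_compl]
  obtain ⟨t, ht, hy⟩ := X.span F y.1 (by rw [← hG]; exact y.2)
  have h1 : hullEval G.1 (Hom.lin (φ ≫ shiftMap (omegaπ k p G) (Deg.ofFinset H)) y) =
      omegaEval p G.1 (φ.lin y.1) := (omegaEval_apply G.2 _).symm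
  have h2 : omegaEval p G.1 (φ.lin y.1) = ∑ x, t x * omegaEval p G.1 (φ.lin (X.v x)) := by
    rw [hy, map_sum]
    refine (map_sum (omegaEval p G.1) _ _).trans (Finset.sum_congr rfl fun x _ => ?_)
    have h3 : φ.lin (t x • X.v x) = t x • φ.lin (X.v x) := (φ.lin.restrictScalars k).map_smul _ _
    rw [h3]
    exact map_smul (omegaEval p G.1) _ _
  rw [h1, h2]
  refine Finset.sum_eq_zero fun x _ => ?_
  by_cases h0 : t x = 0
  · rw [h0, zero_mul]
  · obtain ⟨h4, h5⟩ := ht x h0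
    rw [← h4] at hG
    have h6 := h x h5 (by rw [← hG]; exact G.2) (by rw [← hG]; exact hH)
    rw [homForm_apply, ← hG] at h6
    rw [h6, mul_zero]

/-- Independence of the generators of one component gives a form that separates `v x` from the span
of the others; it is then normalized. -/
lemma exists_form (x : T.B) (hx : T.dg x + (T.st x).card = i) :
    ∃ f : N.gr (Deg.ofFinset (T.st x)ᶜ) →ₗ[k] k, f ⟨X.v x, X.v_mem x⟩ = 1 ∧
      ∀ y (hy : X.v y ∈ N.gr (Deg.ofFinset (T.st x)ᶜ)), T.st y = T.st x →
        T.dg y + (T.st y).card = i → y ≠ x → f ⟨X.v y, hy⟩ = 0 := by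
  let w (y : {y // T.st y = T.st x ∧ T.dg y + (T.st y).card = i}) :
      N.gr (Deg.ofFinset (T.st x)ᶜ) := ⟨X.v y.1,
        (congrArg (fun F : Finset (Fin n) => N.gr (Deg.ofFinset Fᶜ)) y.2.1).le (X.v_mem y.1)⟩
  have hw : LinearIndependent k w := by
    rw [Fintype.linearIndependent_iff]
    intro g hg y
    let t (z : T.B) : k := if h : T.st z = T.st x ∧ T.dg z + (T.st z).card = i then g ⟨z, h⟩ else 0
    have h1 : t = 0 := by
      refine X.indep (T.st x) t (fun z hz => by_contra fun h => hz (dif_neg h)) ?_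
      have h2 := congrArg (N.gr (Deg.ofFinset (T.st x)ᶜ)).subtype hg
      rw [map_sum, map_zero] at h2
      rw [← h2, ← Finset.sum_subset (Finset.subset_univ (Finset.univ.filter fun z =>
        T.st z = T.st x ∧ T.dg z + (T.st z).card = i)), Finset.sum_subtype (p := fun z =>
        T.st z = T.st x ∧ T.dg z + (T.st z).card = i) _ (by simp)]
      · refine Finset.sum_congr rfl fun z _ => ?_
        simp only [t, dif_pos z.2]
        rfl
      · intro z _ hz
        rw [show t z = 0 from dif_neg (by simpa using hz), zero_smul]
    have h2 := congrFun h1 y.1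
    rwa [show t y.1 = g y from dif_pos y.2] at h2
  obtain ⟨f, hf, hf'⟩ := Submodule.exists_le_ker_of_notMem
    (linearIndependent_iff_notMem_span.1 hw ⟨x, rfl, hx⟩)
  refine ⟨(f (w ⟨x, rfl, hx⟩))⁻¹ • f, inv_mul_cancel₀ hf, fun y hy h1 h2 h3 => ?_⟩
  have h4 : f (w ⟨y, h1, h2⟩) = 0 := hf' (Submodule.subset_span
    ⟨⟨y, h1, h2⟩, ⟨trivial, fun h => h3 (congrArg Subtype.val h)⟩, rfl⟩)
  rw [LinearMap.smul_apply]
  exact (congrArg _ h4).trans (smul_zero _)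

/-- These maps are dual to the forms `homForm`: the form from `exists_form` is realized by a map to
the summand `*E(S/P_G)` with `G = (st x)ᶜ`, and generators of another degree evaluate on other
summands. -/
lemma exists_dual_hom {p : ℤ} {H : Finset (Fin n)} (x : T.B)
    (hx : T.dg x + (T.st x).card = i) (hp : ((T.st x)ᶜ.card : ℤ) = -p) (hH : H ⊆ (T.st x)ᶜ) :
    ∃ φ : N ⟶ ((dualizingComplex k n).X p).shift (Deg.ofFinset H), X.homForm p H x φ = 1 ∧
      ∀ y, T.dg y + (T.st y).card = i → y ≠ x → X.homForm p H y φ = 0 := by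
  obtain ⟨f, hf, hf'⟩ := X.exists_form x hx
  obtain ⟨φ, hφ⟩ := X.suppDetermined.exists_hom_injHull (ofFinset_nonneg H)
    ((supp_ofFinset H).subset.trans hH) f
  refine ⟨φ ≫ shiftMap (omegaι k p ⟨_, hp⟩) _, ?_, fun y hy hyx => ?_⟩
  · rw [← hf, ← hφ]
    exact omegaEval_omegaι_self hp _
  · by_cases h : T.st y = T.st x
    · have hm := X.v_mem y
      rw [h] at hm
      rw [homForm_apply, h, ← hf' y hm h hy hyx, ← hφ]
      exact omegaEval_omegaι_self hp _
    · exact omegaEval_omegaι_ne (F := ⟨(T.st x)ᶜ, hp⟩) (fun h' => h (compl_injective h').symm) _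

lemma homForm_shiftMul (p : ℤ) {H H' : Finset (Fin n)} (h : Deg.ofFinset H' ≤ Deg.ofFinset H)
    (x : T.B) (hH : H ⊆ (T.st x)ᶜ)
    (φ : N ⟶ ((dualizingComplex k n).X p).shift (Deg.ofFinset H')) :
    X.homForm p H x (φ ≫ shiftMul _ h) = X.homForm p H' x φ := by
  rw [homForm_apply, homForm_apply, ← omegaEval_mon_smul (a := Deg.ofFinset H' + Deg.ofFinset _)
    (b := Deg.ofFinset H + Deg.ofFinset (T.st x)ᶜ) _ (supp_ofFinset_add hH (Finset.Subset.refl _))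
    (φ.map_mem _ _ (X.v_mem x)), mon_add_right]
  · rfl
  · rw [add_comm, add_comm (Deg.ofFinset H)]
    exact add_le_add_deg h _

/-- The differential of `ω^•` compares the evaluation at `(st x)ᶜ` with those at `(st x \ {l})ᶜ`,
where `v x` is replaced by `x_l · v x`. By the multiplication rule this is the linear part of row
`x` of the matrix. -/
lemma homForm_d {p q : ℤ} {H : Finset (Fin n)} (x : T.B)
    (hx : T.dg x + (T.st x).card = i) (hq : ((T.st x)ᶜ.card : ℤ) = -q) (hH : H ⊆ (T.st x)ᶜ)
    (φ : N ⟶ ((dualizingComplex k n).X p).shift (Deg.ofFinset H)) :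
    X.homForm q H x (φ ≫ shiftMap ((dualizingComplex k n).d p q) _) =
      ∑ y, (if (T.st y).card + 1 = (T.st x).card then T.c x y else 0) * X.homForm p H y φ := by
  have h1 : X.homForm q H x (φ ≫ shiftMap ((dualizingComplex k n).d p q) _) =
      ∑ F, (incidence F (T.st x)ᶜ : k) * omegaEval p F (φ.lin (X.v x)) :=
    omegaEval_d q hq (supp_ofFinset_add hH (Finset.Subset.refl _)) (φ.map_mem _ _ (X.v_mem x))
  have h2 (l : Fin n) (hl : l ∈ T.st x) :
      omegaEval p ((T.st x).erase l)ᶜ (φ.lin (X.v x)) = ((koszulSign l (T.st x) : ℤ) : k) *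
        ∑ y, (if T.st y = (T.st x).erase l then T.c x y else 0) * X.homForm p H y φ := by
    have hsub : (T.st x)ᶜ ⊆ ((T.st x).erase l)ᶜ :=
      Finset.compl_subset_compl.2 (Finset.erase_subset _ _)
    have h3 := omegaEval_mon_smul (p := p) (add_le_add_deg (Deg.ofFinset_mono hsub) (Deg.ofFinset H))
      (supp_ofFinset_add (hH.trans hsub) (Finset.Subset.refl _)) (φ.map_mem _ _ (X.v_mem x))
    rw [mon_add_left] at h3
    refine h3.symm.trans ?_
    have h4 := congrArg φ.lin (X.mul x hx l hl)
    rw [map_smul] at h4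
    refine (congrArg (omegaEval p ((T.st x).erase l)ᶜ) h4).trans ?_
    have h5 (c : k) (z : N.carrier) : φ.lin (c • z) = c • φ.lin z :=
      (φ.lin.restrictScalars k).map_smul _ _
    rw [h5, map_sum]
    refine (map_smul (omegaEval p ((T.st x).erase l)ᶜ) _ _).trans ?_
    rw [smul_eq_mul]
    congr 1
    refine (map_sum (omegaEval p ((T.st x).erase l)ᶜ) _ _).trans
      (Finset.sum_congr rfl fun y _ => ?_)
    rw [h5]
    refine (map_smul (omegaEval p ((T.st x).erase l)ᶜ) _ _).trans ?_
    split_ifs with h6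
    · rw [homForm_apply, h6, smul_eq_mul]
    · rw [zero_smul, zero_mul]
  have h3 : ∑ F, (incidence F (T.st x)ᶜ : k) * omegaEval p F (φ.lin (X.v x)) =
      ∑ l ∈ T.st x, ((koszulSign l (T.st x) : ℤ) : k) *
        omegaEval p ((T.st x).erase l)ᶜ (φ.lin (X.v x)) := by
    rw [← Equiv.sum_comp (Equiv.ofBijective _ compl_bijective)]
    simp only [Equiv.ofBijective_apply, incidence_compl, Int.cast_sum, Finset.sum_mul]
    rw [Finset.sum_comm]
    refine Finset.sum_congr rfl fun l _ => ?_
    rw [Finset.sum_eq_single ((T.st x).erase l)]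
    · rw [if_pos rfl]
    · intro F _ hF
      rw [if_neg (Ne.symm hF), Int.cast_zero, zero_mul]
    · simp
  -- The sign of the incidence number and the sign in the multiplication rule agree, so their
  -- product is `1`.
  rw [h1, h3, Finset.sum_congr rfl fun l hl => by
    rw [h2 l hl, ← mul_assoc, ← Int.cast_mul, koszulSign_mul_self, Int.cast_one, one_mul],
    Finset.sum_comm]
  refine Finset.sum_congr rfl fun y _ => ?_
  rw [← Finset.sum_mul]
  congr 1
  by_cases hc : T.c x y = 0
  · simp [hc]
  have hs := T.st_ssubset x y hc
  split_ifs with h4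
  -- A generator `y` with `st y ⊂ st x` and `|st y| + 1 = |st x|` is reached by deleting exactly one
  -- `l`, so it is counted once.
  · obtain ⟨l, hl, hl'⟩ := Finset.exists_of_ssubset hs
    have h5 : T.st y = (T.st x).erase l := by
      refine Finset.eq_of_subset_of_card_le (fun m hm => Finset.mem_erase.2
        ⟨fun h => hl' (h ▸ hm), hs.1 hm⟩) ?_
      rw [Finset.card_erase_of_mem hl]
      omega
    rw [Finset.sum_eq_single l, if_pos h5]
    · intro m _ hm
      refine if_neg fun h6 => hl' ?_
      rw [h6]
      exact Finset.mem_erase.2 ⟨Ne.symm hm, hl⟩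
    · exact fun h => absurd hl h
  · refine Finset.sum_eq_zero fun l hl => if_neg fun h5 => h4 ?_
    rw [h5]
    exact Finset.card_erase_add_one hl

/-- The linear form on `𝐃(N)^p_H` given by evaluation at a generator. -/
def dualForm (p : ℤ) (H : Finset (Fin n)) (x : T.B) :
    Module.Dual k (((dualizing N).X p).gr (Deg.ofFinset H)) :=
  X.homForm p H x ∘ₗ
    (LinearEquiv.ofBijective (dualOf N p (ofFinset_nonneg H)) (dualOf_bijective _)).symm.toLinearMap

lemma dualForm_dualOf (p : ℤ) (H : Finset (Fin n)) (x : T.B)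
    (φ : N ⟶ ((dualizingComplex k n).X p).shift (Deg.ofFinset H)) :
    X.dualForm p H x (dualOf N p (ofFinset_nonneg H) φ) = X.homForm p H x φ :=
  congrArg (X.homForm p H x) (LinearEquiv.symm_apply_apply
    (LinearEquiv.ofBijective (dualOf N p (ofFinset_nonneg H)) (dualOf_bijective _)) φ)

lemma dual_ext {p : ℤ} {H : Finset (Fin n)}
    {f g : Module.Dual k (((dualizing N).X p).gr (Deg.ofFinset H))}
    (h : ∀ φ, f (dualOf N p (ofFinset_nonneg H) φ) = g (dualOf N p (ofFinset_nonneg H) φ)) :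
    f = g := LinearMap.ext fun y => by
  obtain ⟨φ, rfl⟩ := (dualOf_bijective (ofFinset_nonneg H)).2 y
  exact h φ

lemma dualForm_comp_mulMap (p : ℤ) {H H' : Finset (Fin n)}
    (h : Deg.ofFinset H' ≤ Deg.ofFinset H) (x : T.B) (hH : H ⊆ (T.st x)ᶜ) :
    X.dualForm p H x ∘ₗ ((dualizing N).X p).mulMap h = X.dualForm p H' x := dual_ext fun φ => by
  rw [LinearMap.comp_apply, mulMap_dualOf, dualForm_dualOf, dualForm_dualOf, X.homForm_shiftMul p h x hH]

lemma dualForm_comp_d {p q : ℤ} {H : Finset (Fin n)} (x : T.B)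
    (hx : T.dg x + (T.st x).card = i) (hq : ((T.st x)ᶜ.card : ℤ) = -q) (hH : H ⊆ (T.st x)ᶜ) :
    X.dualForm q H x ∘ₗ Hom.at ((dualizing N).d p q) _ =
      ∑ y, (if (T.st y).card + 1 = (T.st x).card then T.c x y else 0) • X.dualForm p H y :=
  dual_ext fun φ => by
    rw [LinearMap.comp_apply, d_dualOf, dualForm_dualOf, X.homForm_d x hx hq hH,
      LinearMap.sum_apply]
    simp only [LinearMap.smul_apply, dualForm_dualOf, smul_eq_mul]

end StrandModel

end MinMatrix

/-- An isomorphism to a shifted complex, given by its components. -/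
def isoShiftOfComponents {V : Type*} [Category* V] [Preadditive V] {C K : CochainComplex V ℤ}
    {a : ℤ} (f : ∀ j, C.X j ≅ K.X (j + a))
    (hf : ∀ j, (f j).hom ≫ (a.negOnePow • K.d (j + a) (j + 1 + a)) = C.d j (j + 1) ≫ (f (j + 1)).hom) :
    C ≅ K⟦a⟧ :=
  HomologicalComplex.Hom.isoOfComponents f (by
    rintro j _ rfl
    exact hf j)

/-! ### Comparison of a linear strand with the complex given by `ℱ`. -/

namespace MinMatrix

variable (T : MinMatrix k n)

/-- A complex with the terms and the differentials of the `i`-linear strand of a complex with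
matrix `T`. -/
structure StrandRealization (i : ℤ) (C : CochainComplex (GrMod k n) ℤ) where
  basis : ∀ j, SqBasis (C.X j)
    (fun x : {x : T.B // T.dg x = j ∧ T.dg x + (T.st x).card = i} => T.st x.1)
  coef_d : ∀ j x y, (basis (j + 1)).coef y ((C.d j (j + 1)).lin ((basis j).gen x)) = T.c x.1 y.1

variable {T}

namespace StrandModel

variable {i : ℤ} {N : GrMod k n} (X : T.StrandModel i N)

/-- The element of `ℱ(N)^m` given by evaluation at a generator. -/
def evalGen (m : ℤ) (x : T.B) : ((calF N).X m).carrier :=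
  alexOf ((dualizing N).X (-m)) (ofFinset_nonneg (T.st x)) (X.dualForm (-m) _ x)

lemma evalGen_mem (m : ℤ) (x : T.B) : X.evalGen m x ∈ ((calF N).X m).gr (Deg.ofFinset (T.st x)) :=
  alexOf_mem _ _

lemma mon_smul_evalGen (m : ℤ) (x : T.B) {a : Deg n} (ha : 0 ≤ a)
    (h : Deg.ofFinset (T.st x) ≤ a) : (mon k (Deg.ofFinset (T.st x)) a • X.evalGen m x :
      ((calF N).X m).carrier) = alexOf ((dualizing N).X (-m)) ha (X.dualForm (-m) _ x) := by
  refine (mon_smul_alexOf _ h _).trans (congrArg (alexOf _ ha) ?_)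
  refine X.dualForm_comp_mulMap (-m) _ x ?_
  rw [supp_ofFinset]

/-- The signs that make the evaluations compatible with the differential of a shifted complex. -/
def shiftSign (k : Type u) [Field k] (a j : ℤ) : k := (((a * j).negOnePow : ℤ) : k)

lemma shiftSign_mul_self (a j : ℤ) : shiftSign k a j * shiftSign k a j = 1 := by
  rw [shiftSign, ← Int.cast_mul, ← Units.val_mul, Int.units_mul_self, Units.val_one, Int.cast_one]

lemma shiftSign_succ (a j : ℤ) :
    shiftSign k a (j + 1) = ((a.negOnePow : ℤ) : k) * shiftSign k a j := by
  rw [shiftSign, shiftSign, mul_add, mul_one, Int.negOnePow_add, Units.val_mul, Int.cast_mul,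
    mul_comm]

variable {C : CochainComplex (GrMod k n) ℤ} (R : T.StrandRealization i C)

/-- The map from a linear strand to `ℱ(N)`, sending the generators to the evaluations at the
corresponding elements of `N`. -/
def strandMap (a j : ℤ) : C.X j ⟶ (calF N).X (j + a) :=
  (R.basis j).lift (fun x => shiftSign k a j • X.evalGen (j + a) x.1)
    (fun x => Submodule.smul_mem _ _ (X.evalGen_mem _ x.1))

lemma strandMap_gen (a j : ℤ) (x) : (X.strandMap R a j).lin ((R.basis j).gen x) =
    shiftSign k a j • X.evalGen (j + a) x.1 := SqBasis.lift_gen ..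

lemma strandMap_lin (a j : ℤ) {b : Deg n} (hb : 0 ≤ b) (y : (C.X j).carrier)
    (hy : y ∈ (C.X j).gr b) : (X.strandMap R a j).lin y = alexOf ((dualizing N).X (-(j + a))) hb
      (∑ x, ((R.basis j).coef x y * shiftSign k a j) • X.dualForm (-(j + a)) _ x.1) := by
  classical
  refine (SqBasis.lift_lin _ _ _ y hy).trans ?_
  rw [map_sum]
  refine Finset.sum_congr rfl fun x _ => ?_
  rw [map_smul]
  split_ifs with h
  · rw [smul_comm (mon k _ _) (shiftSign k a j), X.mon_smul_evalGen _ _ hb h]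
    exact (mul_smul _ _ _).symm
  · rw [(R.basis j).coef_eq_zero x b y hy h, zero_mul, zero_smul]
    rfl

/-- This is the source of the shift by `n - i`. The two negations come from the indexing of `ω^p` by
`|G| = -p` and from `𝐀`, which reads `𝐃(N)` in degree `-m`. -/
lemma card_compl_eq {x : T.B} {j : ℤ} (h : T.dg x = j ∧ T.dg x + (T.st x).card = i) :
    ((T.st x)ᶜ.card : ℤ) = -(-(j + (n - i))) := by
  have h1 := Finset.card_add_card_compl (T.st x)
  rw [Fintype.card_fin] at h1
  omega

lemma compl_supp_subset {F : Finset (Fin n)} {a : Deg n} (h : Deg.ofFinset F ≤ a) :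
    (Deg.supp a)ᶜ ⊆ Fᶜ :=
  Finset.compl_subset_compl.2 ((ofFinset_le_iff ((ofFinset_nonneg F).trans h)).1 h)

/-- In degree `a ≥ 0` the target consists of linear forms on maps to `ω^p((supp a)ᶜ)`. The strand
generators with `st x ⊆ supp a` give a basis of these forms, dual to the maps of `exists_dual_hom`.
-/
lemma isIso_strandMap (j : ℤ) : IsIso (X.strandMap R (n - i) j) := by
  classical
  refine isIso_of_gr_bijective _ (fun a y hy h => ?_) (fun a z hz => ?_)
  · refine (R.basis j).eq_zero a y hy fun x => ?_
    by_cases hx : Deg.ofFinset (T.st x.1) ≤ a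
    swap
    · exact (R.basis j).coef_eq_zero x a y hy hx
    have ha := (ofFinset_nonneg _).trans hx
    rw [X.strandMap_lin R _ j ha y hy] at h
    have h1 := alexOf_injective ha (h.trans (map_zero _).symm)
    -- Testing the vanishing form on the dual map of `x` isolates the coefficient of `x`, up to a
    -- sign.
    obtain ⟨φ, hφ, hφ'⟩ := X.exists_dual_hom x.1 x.2.2 (card_compl_eq x.2) (compl_supp_subset hx)
    have h2 := LinearMap.congr_fun h1 (dualOf N _ (ofFinset_nonneg _) φ)
    rw [LinearMap.sum_apply, Finset.sum_eq_single x, LinearMap.smul_apply, dualForm_dualOf, hφ,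
      smul_eq_mul, mul_one, LinearMap.zero_apply] at h2
    · have h3 := congrArg (· * shiftSign k (n - i) j) h2
      simpa only [mul_assoc, shiftSign_mul_self, mul_one, zero_mul] using h3
    · intro y _ hy
      rw [LinearMap.smul_apply, dualForm_dualOf,
        hφ' y.1 y.2.2 (fun h => hy (Subtype.ext h)), smul_zero]
    · simp
  · by_cases ha : 0 ≤ a
    swap
    · refine ⟨0, Submodule.zero_mem _, ?_⟩
      rw [map_zero, alexander_eq_zero ha z hz]
      rfl
    obtain ⟨f, rfl⟩ := exists_alexOf ha z hz
    have hd (x : {x : T.B // T.dg x = j ∧ T.dg x + (T.st x).card = i}) :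
        ∃ φ : N ⟶ ((dualizingComplex k n).X (-(j + (n - i)))).shift
          (Deg.ofFinset (Deg.supp a)ᶜ), Deg.ofFinset (T.st x.1) ≤ a →
          X.homForm _ _ x.1 φ = 1 ∧
          ∀ y, T.dg y + (T.st y).card = i → y ≠ x.1 → X.homForm _ _ y φ = 0 := by
      by_cases hx : Deg.ofFinset (T.st x.1) ≤ a
      · obtain ⟨φ, hφ⟩ := X.exists_dual_hom x.1 x.2.2 (card_compl_eq x.2) (compl_supp_subset hx)
        exact ⟨φ, fun _ => hφ⟩
      · exact ⟨0, fun h => absurd h hx⟩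
    choose φ hφ using hd
    -- The coefficients of a preimage are the values of `f` on the dual maps, corrected by the sign
    -- built into `strandMap`.
    let q (x : {x : T.B // T.dg x = j ∧ T.dg x + (T.st x).card = i}) : k :=
      if Deg.ofFinset (T.st x.1) ≤ a then
        f (dualOf N _ (ofFinset_nonneg _) (φ x)) * shiftSign k (n - i) j else 0
    obtain ⟨y, hy, hy'⟩ := (R.basis j).exists_coef q a (fun x hx => by
      by_contra h
      exact hx (if_neg h))
    refine ⟨y, hy, ?_⟩
    rw [X.strandMap_lin R _ j ha y hy]
    refine congrArg (alexOf _ ha) (dual_ext fun ψ => ?_)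
    -- Every map is recovered from its evaluations at the generators, because the difference of the
    -- two sides is killed by all relevant forms.
    have h1 : ψ = ∑ x, (if Deg.ofFinset (T.st x.1) ≤ a then X.homForm _ _ x.1 ψ else 0) • φ x := by
      rw [← sub_eq_zero]
      refine X.eq_zero_of_homForm _ fun x hx hc hH => ?_
      have hxa : Deg.ofFinset (T.st x) ≤ a := by
        rw [ofFinset_le_iff ha]
        exact Finset.compl_subset_compl.1 hH
      have hxj : T.dg x = j := by
        have h1 := Finset.card_add_card_compl (T.st x)
        rw [Fintype.card_fin] at h1
        omega
      rw [map_sub, map_sum, Finset.sum_eq_single ⟨x, hxj, hx⟩, if_pos hxa, map_smul,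
        (hφ ⟨x, hxj, hx⟩ hxa).1, smul_eq_mul, mul_one, sub_self]
      · intro z _ hz
        rw [map_smul]
        split_ifs with h
        · rw [(hφ z h).2 x hx (fun h => hz (Subtype.ext h.symm)), smul_zero]
        · rw [zero_smul]
      · simp
    conv_rhs => rw [h1]
    rw [map_sum, map_sum, LinearMap.sum_apply]
    refine Finset.sum_congr rfl fun x _ => ?_
    rw [LinearMap.smul_apply, dualForm_dualOf, map_smul, map_smul, hy']
    simp only [q]
    split_ifs
    · rw [mul_assoc, shiftSign_mul_self, mul_one, smul_eq_mul, smul_eq_mul, mul_comm]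
    · rw [zero_mul, zero_smul, zero_smul]

lemma d_evalGen {m m' : ℤ} (x : T.B) (hx : T.dg x + (T.st x).card = i)
    (hm : ((T.st x)ᶜ.card : ℤ) = -(-m)) :
    ((calF N).d m m').lin (X.evalGen m x) =
      alexOf ((dualizing N).X (-m')) (ofFinset_nonneg (T.st x))
        (∑ y, (if (T.st y).card + 1 = (T.st x).card then T.c x y else 0) •
          X.dualForm (-m') _ y) := by
  refine (alexander_map_alexOf ((dualizing N).d (-m') (-m)) (ofFinset_nonneg (T.st x)) _).trans ?_
  refine congrArg (alexOf _ _) (X.dualForm_comp_d x hx hm ?_)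
  rw [supp_ofFinset]

/-- The sign `shiftSign` changes by `(-1)^(n - i)` from one degree to the next, which is the sign
that the shift puts on the differential of `ℱ(N)`. -/
lemma strandMap_comm (j : ℤ) : X.strandMap R (n - i) j ≫
    (((n : ℤ) - i).negOnePow • (calF N).d (j + (n - i)) (j + 1 + (n - i))) =
    C.d j (j + 1) ≫ X.strandMap R (n - i) (j + 1) := by
  refine (R.basis j).hom_ext fun x => ?_
  have h1 := X.strandMap_lin R (n - i) (j + 1) (ofFinset_nonneg (T.st x.1))
    ((C.d j (j + 1)).lin ((R.basis j).gen x)) ((C.d j (j + 1)).map_mem _ _ ((R.basis j).gen_mem x))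
  refine Eq.trans ?_ h1.symm
  have h2 (z : ((calF N).X (j + (n - i))).carrier) :
      Hom.lin (((n : ℤ) - i).negOnePow • (calF N).d (j + (n - i)) (j + 1 + (n - i))) z =
      ((((n : ℤ) - i).negOnePow : ℤ) : k) • ((calF N).d (j + (n - i)) (j + 1 + (n - i))).lin z := by
    rw [Int.cast_smul_eq_zsmul]
    rfl
  rw [comp_lin, LinearMap.comp_apply, h2, X.strandMap_gen]
  have h3 := (Hom.lin ((calF N).d (j + (n - i)) (j + 1 + (n - i)))).restrictScalars k |>.map_smul
    (shiftSign k (n - i) j) (X.evalGen (j + (n - i)) x.1)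
  refine (congrArg _ h3).trans ?_
  rw [LinearMap.restrictScalars_apply, X.d_evalGen x.1 x.2.2 (card_compl_eq x.2)]
  refine (mul_smul _ _ _).symm.trans ?_
  refine (map_smul (alexOf ((dualizing N).X (-(j + 1 + (n - i)))) (ofFinset_nonneg (T.st x.1)))
    _ _).symm.trans (congrArg (alexOf _ _) ?_)
  rw [Finset.smul_sum, ← shiftSign_succ, ← Finset.sum_subset (Finset.subset_univ
    (Finset.univ.filter fun y => T.dg y = j + 1 ∧ T.dg y + (T.st y).card = i)),
    Finset.sum_subtype (p := fun y => T.dg y = j + 1 ∧ T.dg y + (T.st y).card = i) _ (by simp)]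
  · refine Finset.sum_congr rfl fun y _ => ?_
    rw [R.coef_d, ← mul_smul, if_pos, mul_comm]
    have := x.2
    have := y.2
    omega
  · intro y _ hy
    -- An entry that raises `dg` by one and lowers `|st|` by one keeps `dg + |st| = i`, so linear
    -- entries never leave the strand.
    have h4 : (if (T.st y).card + 1 = (T.st x.1).card then T.c x.1 y else 0) = 0 := by
      by_contra h5
      split_ifs at h5 with h6
      · have h7 := T.dg_eq _ _ h5
        have := x.2
        refine hy (Finset.mem_filter.2 ⟨Finset.mem_univ _, ?_⟩)
        omega
      · exact h5 rfl
    rw [h4, zero_smul, smul_zero]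

/-- The linear strand of a complex with matrix `T` is `ℱ(N)`, up to a shift. -/
lemma nonempty_strand_iso (X : T.StrandModel i N) (R : T.StrandRealization i C) :
    Nonempty (C ≅ (calF N)⟦(n : ℤ) - i⟧) := by
  have h := X.isIso_strandMap R
  exact ⟨isoShiftOfComponents (fun j => @asIso _ _ _ _ (X.strandMap R (n - i) j) (h j))
    (X.strandMap_comm R)⟩

end StrandModel

end MinMatrix

/-- Change of the index set of a basis. -/
def SqBasis.reindex {M : GrMod k n} {ι κ : Type} [Fintype ι] [Fintype κ] {s : ι → Finset (Fin n)}
    {t : κ → Finset (Fin n)} (B : SqBasis M s) (e : ι ≃ κ) (hs : ∀ x, t (e x) = s x) :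
    SqBasis M t where
  gen y := B.gen (e.symm y)
  gen_mem y := by
    have h := B.gen_mem (e.symm y)
    rwa [← hs, e.apply_symm_apply] at h
  coef y := B.coef (e.symm y)
  coef_monomial y := B.coef_monomial (e.symm y)
  coef_gen_self y := B.coef_gen_self (e.symm y)
  coef_gen_ne y z h := B.coef_gen_ne _ _ fun h' => h (e.symm.injective h')
  coef_eq_zero y a z hz h := by
    refine B.coef_eq_zero (e.symm y) a z hz ?_
    rwa [← hs, e.apply_symm_apply]
  eq_zero a y hy h := B.eq_zero a y hy fun x => by
    have := h (e x)
    rwa [e.symm_apply_apply] at this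

/-! ### The matrix of a minimal resolution and of its linear strands. -/

namespace MinRes

variable {M : CochainComplex (GrMod k n) ℤ} (R : MinRes M)

/-- The basis of a term of a minimal resolution. -/
def sqBasis (j : ℤ) : SqBasis (R.P.X j) (fun x : (F : Finset (Fin n)) × Fin (R.β j F) => x.1) :=
  SqBasis.ofIso (SqBasis.biproduct fun x : (F : Finset (Fin n)) × Fin (R.β j F) => x.1) (R.iso j)

/-- The entries of the differential of a minimal resolution. -/
def entry (j l : ℤ) (x : (F : Finset (Fin n)) × Fin (R.β j F))
    (y : (F : Finset (Fin n)) × Fin (R.β l F)) : k :=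
  evalOne k n ((R.component j l x y).lin (1 : MvPolynomial (Fin n) k))

lemma coef_d (j l : ℤ) (x : (F : Finset (Fin n)) × Fin (R.β j F))
    (y : (F : Finset (Fin n)) × Fin (R.β l F)) :
    (R.sqBasis l).coef y ((R.P.d j l).lin ((R.sqBasis j).gen x)) = R.entry j l x y := rfl

lemma entry_eq_zero {j l : ℤ} (h : j + 1 ≠ l) (x : (F : Finset (Fin n)) × Fin (R.β j F))
    (y : (F : Finset (Fin n)) × Fin (R.β l F)) : R.entry j l x y = 0 := by
  rw [← R.coef_d, R.P.shape j l h, zero_lin, LinearMap.zero_apply, map_zero]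

/-- Homogeneity gives the inclusion of degrees; equality would make the entry a unit constant, which
minimality excludes. -/
lemma ssubset_of_entry {j : ℤ} {x : (F : Finset (Fin n)) × Fin (R.β j F)}
    {y : (F : Finset (Fin n)) × Fin (R.β (j + 1) F)} (h : R.entry j (j + 1) x y ≠ 0) :
    y.1 ⊂ x.1 := by
  have h1 : y.1 ⊆ x.1 := by
    by_contra h2
    refine h ((R.coef_d _ _ _ _).symm.trans ((R.sqBasis (j + 1)).coef_eq_zero y _ _
      (Hom.map_mem _ _ _ ((R.sqBasis j).gen_mem x)) ?_))
    rwa [ofFinset_le_ofFinset]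
  refine Finset.ssubset_iff_subset_ne.2 ⟨h1, fun h2 => h ?_⟩
  rw [entry, R.component_eq_zero j x y (by rw [h2])]
  exact map_zero _

lemma sum_entry {j l m : ℤ} (x : (F : Finset (Fin n)) × Fin (R.β j F))
    (z : (F : Finset (Fin n)) × Fin (R.β m F)) :
    ∑ y, R.entry j l x y * R.entry l m y z = 0 := by
  have h1 := (R.sqBasis l).coef_lin (R.sqBasis m) (R.P.d l m)
    ((R.P.d j l).lin ((R.sqBasis j).gen x)) z
  have h2 : (R.P.d l m).lin ((R.P.d j l).lin ((R.sqBasis j).gen x)) = 0 :=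
    congrArg (fun f => Hom.lin f ((R.sqBasis j).gen x)) (R.P.d_comp_d j l m)
  rw [h2, map_zero] at h1
  exact h1.symm

/-- The generators of a minimal resolution. -/
abbrev Gens : Type := (j : ℤ) × ((F : Finset (Fin n)) × Fin (R.β j F))

lemma isEmpty_of_isZero {j : ℤ} (h : IsZero (R.P.X j)) :
    IsEmpty ((F : Finset (Fin n)) × Fin (R.β j F)) := ⟨fun x => by
  have h1 := isZero_iff_gr.1 h _ _ ((R.sqBasis j).gen_mem x)
  have h2 := (R.sqBasis j).coef_gen_self x
  rw [h1, map_zero] at h2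
  exact zero_ne_one h2⟩

/-- The resolution is bounded, and a zero term has no generators because a generator has coordinate
`1` at itself. -/
instance : Finite R.Gens := by
  obtain ⟨a, b, h⟩ := R.bounded
  refine Finite.of_surjective (fun x : (j : Set.Icc a b) × ((F : Finset (Fin n)) ×
    Fin (R.β j.1 F)) => (⟨x.1.1, x.2⟩ : R.Gens)) fun ⟨j, y⟩ => ?_
  by_cases hj : j < a ∨ b < j
  · exact (R.isEmpty_of_isZero (h j hj)).elim y
  · exact ⟨⟨⟨j, by rw [Set.mem_Icc]; omega⟩, y⟩, rfl⟩

lemma gens_mk_injective (j : ℤ) : Function.Injective fun y => (⟨j, y⟩ : R.Gens) :=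
  fun _ _ h => eq_of_heq (Sigma.mk.inj h).2

/-- The matrix of the differential of a minimal resolution. -/
def matrix : MinMatrix k n where
  B := R.Gens
  fintype := Fintype.ofFinite _
  decEq := Classical.decEq _
  dg x := x.1
  st x := x.2.1
  c x y := R.entry x.1 y.1 x.2 y.2
  st_ssubset := by
    rintro ⟨j, x⟩ ⟨l, y⟩ h
    obtain rfl : j + 1 = l := by_contra fun h' => h (R.entry_eq_zero h' _ _)
    exact R.ssubset_of_entry h
  dg_eq := by
    rintro ⟨j, x⟩ ⟨l, y⟩ h
    exact by_contra fun h' => h (R.entry_eq_zero (Ne.symm h') _ _)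
  sum_c := by
    rintro ⟨j, x⟩ ⟨m, z⟩
    let : Fintype R.Gens := Fintype.ofFinite _
    refine Eq.trans ?_ (R.sum_entry (l := j + 1) x z)
    symm
    refine Fintype.sum_of_injective (fun y => (⟨j + 1, y⟩ : R.Gens)) (R.gens_mk_injective _) _ _
      (fun y hy => ?_) (fun _ => rfl)
    rw [R.entry_eq_zero (fun h => hy ?_), zero_mul]
    obtain ⟨l, y⟩ := y
    obtain rfl : j + 1 = l := h
    exact ⟨y, rfl⟩

/-- The generators of a term of a minimal resolution. -/
def gensEquiv (j : ℤ) : ((F : Finset (Fin n)) × Fin (R.β j F)) ≃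
    {x : R.matrix.B // R.matrix.dg x = j} :=
  Equiv.ofBijective (fun y => ⟨⟨j, y⟩, rfl⟩) ⟨fun y z h => R.gens_mk_injective j
    (congrArg Subtype.val h), by rintro ⟨⟨_, y⟩, rfl⟩; exact ⟨y, rfl⟩⟩

/-- A minimal resolution, in terms of its matrix. -/
def realization : R.matrix.Realization R.P where
  basis j := (R.sqBasis j).reindex (R.gensEquiv j) (fun _ => rfl)
  coef_d j l x y := by
    obtain ⟨x, rfl⟩ := (R.gensEquiv j).surjective x
    obtain ⟨y, rfl⟩ := (R.gensEquiv l).surjective y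
    simp only [SqBasis.reindex, Equiv.symm_apply_apply]
    exact R.coef_d j l x y

/-- The generators of a term of a linear strand. -/
def strandGensEquiv (i j : ℤ) :
    {x : (F : Finset (Fin n)) × Fin (R.β j F) // (x.1.card : ℤ) = i - j} ≃
    {x : R.matrix.B // R.matrix.dg x = j ∧ R.matrix.dg x + (R.matrix.st x).card = i} :=
  Equiv.ofBijective (fun y => ⟨⟨j, y.1⟩, rfl, by
      change j + (y.1.1.card : ℤ) = i
      rw [y.2]
      ring⟩)
    ⟨fun y z h => Subtype.ext (R.gens_mk_injective j (congrArg Subtype.val h)), by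
      rintro ⟨⟨_, y⟩, rfl, h⟩
      refine ⟨⟨y, ?_⟩, rfl⟩
      rw [← h]
      exact (add_sub_cancel_left _ _).symm⟩

lemma strand_coef_d (i j l : ℤ)
    (x : {x : (F : Finset (Fin n)) × Fin (R.β j F) // (x.1.card : ℤ) = i - j})
    (y : {x : (F : Finset (Fin n)) × Fin (R.β l F) // (x.1.card : ℤ) = i - l}) :
    (SqBasis.biproduct fun x : {x : (F : Finset (Fin n)) × Fin (R.β l F) //
      (x.1.card : ℤ) = i - l} => x.1.1).coef y (((R.strand i).d j l).lin
        ((SqBasis.biproduct fun x : {x : (F : Finset (Fin n)) × Fin (R.β j F) //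
          (x.1.card : ℤ) = i - j} => x.1.1).gen x)) = R.entry j l x.1 y.1 := by
  have h : biproduct.ι (fun x : {x : (F : Finset (Fin n)) × Fin (R.β j F) //
      (x.1.card : ℤ) = i - j} => freeFamily k (R.β j) x.1) x ≫
      (R.strand i).d j l ≫ biproduct.π (fun x : {x : (F : Finset (Fin n)) × Fin (R.β l F) //
      (x.1.card : ℤ) = i - l} => freeFamily k (R.β l) x.1) y = R.component j l x.1 y.1 := by
    refine (congrArg _ (biproduct.matrix_π _ _)).trans ?_
    exact biproduct.ι_desc _ _
  exact congrArg (fun f => evalOne k n (Hom.lin f (1 : MvPolynomial (Fin n) k))) h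

/-- A linear strand of a minimal resolution, in terms of the matrix of the resolution. -/
def strandRealization (i : ℤ) : R.matrix.StrandRealization i (R.strand i) where
  basis j := (SqBasis.biproduct fun x : {x : (F : Finset (Fin n)) × Fin (R.β j F) //
    (x.1.card : ℤ) = i - j} => x.1.1).reindex (R.strandGensEquiv i j) (fun _ => rfl)
  coef_d j x y := by
    obtain ⟨x, rfl⟩ := (R.strandGensEquiv i j).surjective x
    obtain ⟨y, rfl⟩ := (R.strandGensEquiv i (j + 1)).surjective y
    simp only [SqBasis.reindex, Equiv.symm_apply_apply]
    exact R.strand_coef_d i j (j + 1) x y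

end MinRes

lemma ProjRes.isKProjective {K : CochainComplex (GrMod k n) ℤ} (E : ProjRes K) :
    E.Q.IsKProjective := by
  obtain ⟨b, hb⟩ := E.boundedAbove
  have := E.projective
  have : E.Q.IsStrictlyLE b := (CochainComplex.isStrictlyLE_iff _ _).2 hb
  exact CochainComplex.isKProjective_of_projective _ b

end GrMod

end

theorem theorem3p7 {k : Type u} [Field k] {n : ℕ} (M : CochainComplex (GrMod k n) ℤ)
    (hM : GrMod.IsBoundedSquarefree M) (R : GrMod.MinRes M)
    (E : GrMod.ProjRes (GrMod.alexanderComplex M)) (i : ℤ) :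
    Nonempty (R.strand i ≅
      (GrMod.calF (E.extMod i (GrMod.canonical k n)))⟦(n : ℤ) - i⟧) := by
  have := E.isKProjective
  have := E.quasiIso
  have := R.quasiIso
  -- Duality reverses the resolution map, so `𝐀(M)` maps to `𝐀(P)`. The given resolution and the
  -- Koszul resolution both map quasi-isomorphically to `𝐀(P)`, which makes them comparable.
  let f : GrMod.alexanderComplex M ⟶ GrMod.alexanderComplex R.P :=
    contraMap (GrMod.alexander k n) R.π
  have : QuasiIso f := quasiIso_contraMap _ _
  obtain ⟨e⟩ := homotopyEquiv_of_isKProjective (E.π ≫ f) R.realization.aug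
  -- The description of Ext found for the Koszul resolution is carried to the given one along the
  -- homotopy equivalence; its strand model then identifies `ℱ` of Ext with the strand.
  exact (((R.matrix.extModel i).ofIso (contraHomologyIso
    ((GrMod.gHom k n).flip.obj (GrMod.canonical k n)) e i)).strandModel).nonempty_strand_iso
    (R.strandRealization i)
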